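/- Let $R=\mathbb Z[\alpha,\beta,\delta]$ and let $I=\langle p_1,p_2\rangle\subset R$ be the ideal generated by $$p_1=\alpha^2\delta+2\alpha\beta\delta^2-\delta^2+\beta^2\delta,\qquad p_2=\alpha\beta\delta^3+\alpha^2\delta^2+\beta^2\delta^2+\alpha\beta\delta-\delta .$$ For a (planar) link diagram $D$, let the generalized bracket $\langle D\rangle_3\in R$ be defined by the following rules: it depends only on $D$ up to planar isotopy; $\langle\varnothing\rangle_3=1$ for the empty diagram; $\langle D\cup\bigcirc\rangle_3=\delta\,\langle D\rangle_3$, where $\bigcirc$ is a closed curve without crossings with itself or with $D$; and, for every crossing of $D$, $\langle D\rangle_3=\alpha\,\langle D_1\rangle_3+\beta\,\langle D_2\rangle_3$, where $D_1$ and $D_2$ arise from $D$ by smoothing this crossing so that $D_1$ joins the two regions swept by the overstrand when it is turned counterclockwise onto the understrand, and $D_2$ joins the other two. Equivalently, $\langle D\rangle_3=\sum_s\alpha^{a(s)}\beta^{b(s)}\delta^{k(s)}$, where $s$ runs over the choices of one of the two smoothings at every crossing, $a(s)$ and $b(s)$ are the numbers of crossings smoothed as in $D_1$ and as in $D_2$,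 and $k(s)$ is the number of closed curves that result; this sum satisfies the rules above. Then the class $I+\langle D\rangle_3\in R/I$ is a regular isotopy invariant: if the link diagrams $D$ and $D'$ are related by a finite sequence of planar isotopies and Reidemeister moves II and III (and their inverses), then $I+\langle D\rangle_3=I+\langle D'\rangle_3$. -/

import Mathlib

open Equiv

/-- A link diagram presented as a combinatorial map whose set of darts (half-edges) is `H`.
The edges of the underlying plane graph are the orbits of `edge`, and `rot` takes a dart to the next
dart counterclockwise around its vertex.  All vertices have valency 4 (the crossings) or 2 (points
marked on a strand, without geometric meaning; they allow closed curves without crossings).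
At a crossing, `isOver x` says that the dart `x` lies on the overcrossing strand; at a vertex of
valency 2 the value of `isOver` means nothing. Planarity is a separate condition, see `Planar`. -/
structure Diagram (H : Type) where
  edge : Perm H
  rot : Perm H
  isOver : H → Prop
  edge_edge : ∀ x, edge (edge x) = x
  edge_ne : ∀ x, edge x ≠ x
  rot_four : ∀ x, rot (rot (rot (rot x))) = x
  rot_ne : ∀ x, rot x ≠ x
  isOver_rot : ∀ x, rot (rot x) ≠ x → (isOver (rot x) ↔ ¬ isOver x)

namespace Diagram

variable {H H' : Type}

/-- The dart `x` is at a crossing (a vertex of valency 4). -/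
def IsCrossing (D : Diagram H) (x : H) : Prop := D.rot (D.rot x) ≠ x

/-- The darts `x` and `y` are at the same vertex. -/
def SameVertex (D : Diagram H) (x y : H) : Prop := D.rot.SameCycle x y

/-- The face permutation: walk along the edge of a dart, then turn to the neighbouring dart. -/
def face (D : Diagram H) : Perm H := D.rot⁻¹ * D.edge

/-- The number of orbits of a permutation. -/
noncomputable def numOrbits (σ : Perm H) : ℕ := Nat.card (Quotient (Perm.SameCycle.setoid σ))

/-- The number of connected components of the underlying graph (`Quot` identifies along the
equivalence relation generated by the given relation). -/
noncomputable def numComponents (D : Diagram H) : ℕ :=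
  Nat.card (Quot fun x y : H => y = D.edge x ∨ y = D.rot x)

/-- Euler's formula `V - E + F = 2 C`: every connected component is drawn on a sphere. As
`V - E + F ≤ 2` for each component, the sum formula is equivalent to the one for each component. -/
def Planar (D : Diagram H) : Prop :=
  numOrbits D.rot + numOrbits D.face = numOrbits D.edge + 2 * D.numComponents

/-! ### Smoothings, and disjoint union with a circle -/

open Classical in
/-- The rotation after smoothing: `d` and `rot d` are exchanged, and so are `rot² d` and `rot³ d`. -/
noncomputable def smoothRot (D : Diagram H) (d : H) : Perm H :=
  D.rot * swap (D.rot d) (D.rot⁻¹ d)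

theorem smoothRot_cases (D : Diagram H) (d x : H) :
    D.smoothRot d x = D.rot x ∧ x ≠ D.rot d ∧ x ≠ D.rot (D.rot (D.rot d)) ∨
      x = D.rot d ∧ D.smoothRot d x = d ∨
      x = D.rot (D.rot (D.rot d)) ∧ D.smoothRot d x = D.rot (D.rot d) := by
  classical
  have hinv : D.rot⁻¹ d = D.rot (D.rot (D.rot d)) := by
    rw [Perm.inv_eq_iff_eq]; exact (D.rot_four d).symm
  unfold smoothRot
  rw [← hinv]
  by_cases h1 : x = D.rot d
  · right; left; subst h1; simp
  · by_cases h2 : x = D.rot⁻¹ d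
    · right; right; subst h2; simp
    · left
      exact ⟨by rw [Perm.mul_apply, swap_apply_of_ne_of_ne h1 h2], h1, h2⟩

/-- The smoothing of the crossing at the dart `d` that joins `d` to `rot d` and `rot² d` to
`rot³ d`. (If `d` is not at a crossing then nothing changes.) -/
noncomputable def smooth (D : Diagram H) (d : H) : Diagram H where
  edge := D.edge
  rot := D.smoothRot d
  isOver := D.isOver
  edge_edge := D.edge_edge
  edge_ne := D.edge_ne
  rot_four := by
    have key := D.smoothRot_cases d
    have h4 := D.rot_four
    have inj := D.rot.injective
    grind
  rot_ne := by
    have key := D.smoothRot_cases d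
    have h4 := D.rot_four
    have hn := D.rot_ne
    grind
  isOver_rot := by
    have key := D.smoothRot_cases d
    have h4 := D.rot_four
    have hn := D.rot_ne
    have ho := D.isOver_rot
    grind

/-- The diagram without darts. -/
def empty : Diagram Empty where
  edge := 1
  rot := 1
  isOver := fun _ => False
  edge_edge := fun x => x.elim
  edge_ne := fun x => x.elim
  rot_four := fun x => x.elim
  rot_ne := fun x => x.elim
  isOver_rot := fun x => x.elim

/-- The disjoint union `D ∪ ○` with a closed curve that has no crossing with itself or with `D`. -/
def addCircle (D : Diagram H) : Diagram (H ⊕ Bool) where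
  edge := sumCongr D.edge boolNot
  rot := sumCongr D.rot boolNot
  isOver := Sum.elim D.isOver fun _ => False
  edge_edge := by rintro (x | x) <;> simp [D.edge_edge]
  edge_ne := by rintro (x | x) <;> simp [D.edge_ne]
  rot_four := by rintro (x | x) <;> simp [D.rot_four]
  rot_ne := by rintro (x | x) <;> simp [D.rot_ne]
  isOver_rot := by
    rintro (x | x) h
    · simpa using D.isOver_rot x (by simpa using h)
    · simp at h

/-! ### The bracket -/

/-- The crossings: the orbits of `rot` of length 4. -/
def Crossing (D : Diagram H) : Type :=
  Quotient ((Perm.SameCycle.setoid D.rot).comap (Subtype.val : {x : H // D.IsCrossing x} → H))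

/-- A state chooses a smoothing of each crossing: `true` stands for the smoothing with
coefficient `α`, and `false` for the one with coefficient `β`. -/
abbrev State (D : Diagram H) : Type := D.Crossing → Bool

open Classical in
/-- The dart that is joined to `x` at its vertex in the state `s`. At a crossing the `α`-smoothing
joins each dart on the understrand to the next one counterclockwise (it opens the regions
swept by the overstrand when turned counterclockwise), the `β`-smoothing does so for each dart on
the overstrand. -/
noncomputable def partner (D : Diagram H) (s : D.State) (x : H) : H :=
  if h : D.IsCrossing x then
    if (s (Quotient.mk _ ⟨x, h⟩) = true ↔ D.isOver x) then D.rot⁻¹ x else D.rot x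
  else D.rot x

/-- The number of closed curves of a state. -/
noncomputable def loops (D : Diagram H) (s : D.State) : ℕ :=
  Nat.card (Quot fun x y : H => y = D.edge x ∨ y = D.partner s x)

end Diagram

/-- The ring `ℤ[α, β, δ]`. -/
abbrev BracketRing : Type := MvPolynomial (Fin 3) ℤ

namespace BracketRing

noncomputable def α : BracketRing := MvPolynomial.X 0
noncomputable def β : BracketRing := MvPolynomial.X 1
noncomputable def δ : BracketRing := MvPolynomial.X 2

noncomputable def p₁ : BracketRing := α ^ 2 * δ + 2 * α * β * δ ^ 2 - δ ^ 2 + β ^ 2 * δ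

noncomputable def p₂ : BracketRing :=
  α * β * δ ^ 3 + α ^ 2 * δ ^ 2 + β ^ 2 * δ ^ 2 + α * β * δ - δ

/-- The ideal `⟨p₁, p₂⟩`. -/
noncomputable def I : Ideal BracketRing := Ideal.span {p₁, p₂}

end BracketRing

namespace Diagram

variable {H H' : Type}

open BracketRing in
/-- The generalized bracket, as the sum over all states of `α ^ a * β ^ b * δ ^ k`, with `a` and `b`
the numbers of smoothings of the two kinds and `k` the number of closed curves. -/
noncomputable def bracket (D : Diagram H) : BracketRing :=
  ∑ᶠ s : D.State,
    α ^ Nat.card {c // s c = true} * β ^ Nat.card {c // s c = false} * δ ^ D.loops s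

/-! ### Isotopy and Reidemeister moves -/

/-- Isomorphism of diagrams (orientation-preserving, as `rot` is respected). -/
def Iso (D : Diagram H) (D' : Diagram H') : Prop :=
  ∃ f : H ≃ H', (∀ x, f (D.edge x) = D'.edge (f x)) ∧ (∀ x, f (D.rot x) = D'.rot (f x)) ∧
    ∀ x, D.IsCrossing x → (D'.isOver (f x) ↔ D.isOver x)

/-- `D'` is `D` with one more marked point, on the edge of the dart `d`. -/
def Subdivision (D : Diagram H) (D' : Diagram (H ⊕ Bool)) : Prop :=
  ∃ d : H,
    D'.edge (.inl d) = .inr false ∧ D'.edge (.inl (D.edge d)) = .inr true ∧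
    (∀ x, x ≠ d → x ≠ D.edge d → D'.edge (.inl x) = .inl (D.edge x)) ∧
    (∀ x, D'.rot (.inl x) = .inl (D.rot x)) ∧ (∀ b, D'.rot (.inr b) = .inr (!b)) ∧
    ∀ x, D.IsCrossing x → (D'.isOver (.inl x) ↔ D.isOver x)

/-- Move II, from `D` to `D'`. In `D` the distinct crossings at `a` and `b` are joined by two edges
that bound a face with two sides, and one strand is over the other one at both crossings. In `D'` the
two strands do not meet: each of the two crossings is replaced by two marked points, one on each
strand, that is, opposite darts are joined. (As `b` and `edge a` coincide, `b` is not a parameter.) -/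
def MoveII (D D' : Diagram H) : Prop :=
  ∃ a b : H, D.IsCrossing a ∧ D.IsCrossing b ∧ ¬ D.SameVertex a b ∧
    D.edge a = b ∧ D.edge (D.rot a) = D.rot⁻¹ b ∧ (D.isOver a ↔ D.isOver b) ∧
    D'.edge = D.edge ∧ D'.isOver = D.isOver ∧
    (∀ x, D.SameVertex a x ∨ D.SameVertex b x → D'.rot x = D.rot (D.rot x)) ∧
    ∀ x, ¬ (D.SameVertex a x ∨ D.SameVertex b x) → D'.rot x = D.rot x

open Classical in
/-- The exchange of darts that describes move III at a triangle with corners `a, b, c`, where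
`a`, `b`, `c` point along the sides of the triangle. The strand along the side from `a` to `rot b`
has the darts `rot² a, a, rot b, rot⁻¹ b` in this order; it now meets the two
crossings in the other order (in the same direction), so what was attached to `rot² a` is now
attached to `rot b`, what was attached to `rot⁻¹ b` is now attached to `a`, and the
side of the new triangle joins `rot⁻¹ b` to `rot² a`. -/
noncomputable def triangleSwap (D : Diagram H) (a b c : H) : Perm H :=
  swap a (D.rot⁻¹ b) * swap (D.rot (D.rot a)) (D.rot b) *
  (swap b (D.rot⁻¹ c) * swap (D.rot (D.rot b)) (D.rot c)) *
  (swap c (D.rot⁻¹ a) * swap (D.rot (D.rot c)) (D.rot a))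

/-- Move III, from `D` to `D'`. In `D` three distinct crossings are the corners of a face with three
sides. The strand along the side that leaves a corner in the dart `a` is over the other strand there
if `isOver a`, so the last condition on `D` says that the three strands are not cyclically one above
the other: there are a top, a middle and a bottom strand. -/
def MoveIII (D D' : Diagram H) : Prop :=
  ∃ a b c : H, D.IsCrossing a ∧ D.IsCrossing b ∧ D.IsCrossing c ∧
    ¬ D.SameVertex a b ∧ ¬ D.SameVertex b c ∧ ¬ D.SameVertex c a ∧
    D.edge a = D.rot b ∧ D.edge b = D.rot c ∧ D.edge c = D.rot a ∧
    ¬ ((D.isOver a ↔ D.isOver b) ∧ (D.isOver b ↔ D.isOver c)) ∧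
    D'.rot = D.rot ∧ D'.isOver = D.isOver ∧
    D'.edge = D.triangleSwap a b c * D.edge * (D.triangleSwap a b c)⁻¹

end Diagram

/-- A link diagram: a finite planar diagram. Each connected component is thus drawn on the sphere; how
the components lie relative to each other is not recorded, so that more pairs of
diagrams count as isotopic than for curves drawn in the plane, and invariance says more. -/
structure LinkDiagram where
  Dart : Type
  finite : Finite Dart
  diagram : Diagram Dart
  planar : diagram.Planar

namespace LinkDiagram

/-- The generalized bracket of a link diagram. -/
noncomputable def bracket (D : LinkDiagram) : BracketRing := D.diagram.bracket

/-- An elementary step of a regular isotopy: a planar isotopy (which becomes an isomorphism, or the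
insertion of a marked point), a move II or a move III, between planar diagrams. -/
inductive Step : LinkDiagram → LinkDiagram → Prop
  | iso (D D' : LinkDiagram) (h : D.diagram.Iso D'.diagram) : Step D D'
  | subdivision {H : Type} (fin : Finite H) (fin' : Finite (H ⊕ Bool)) (D : Diagram H)
      (D' : Diagram (H ⊕ Bool)) (hD : D.Planar) (hD' : D'.Planar) (h : D.Subdivision D') :
      Step ⟨H, fin, D, hD⟩ ⟨H ⊕ Bool, fin', D', hD'⟩
  | moveII {H : Type} (fin : Finite H) (D D' : Diagram H) (hD : D.Planar) (hD' : D'.Planar)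
      (h : D.MoveII D') : Step ⟨H, fin, D, hD⟩ ⟨H, fin, D', hD'⟩
  | moveIII {H : Type} (fin : Finite H) (D D' : Diagram H) (hD : D.Planar) (hD' : D'.Planar)
      (h : D.MoveIII D') : Step ⟨H, fin, D, hD⟩ ⟨H, fin, D', hD'⟩

/-- Regular isotopy: the equivalence relation generated by planar isotopy and the Reidemeister
moves II and III. -/
def RegularIsotopic : LinkDiagram → LinkDiagram → Prop := Relation.EqvGen Step

end LinkDiagram

/-! The invariance rests on one fact about single crossings. Fix the smoothings at all other
crossings of a planar diagram. The two ways to smooth the remaining one then give numbers of closed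
curves `k` and `l` that differ by exactly 1. For such `k`, `l`, both positive, `(α β - 1) δ ^ k +
(α² + β² + α β δ) δ ^ l` is a power of `δ` times `p₁` (if `k = l + 1`) or `p₂` (if `l = k + 1`), see
`mem_I_of_adjacent`. Summing over states shows that `(α β - 1) ⟨V⟩ + (α² + β² + α β δ) ⟨U⟩` lies in
`I` whenever `V` and `U` are the two smoothings of a crossing (`smooth_mem_I`).

That the numbers differ, and are not equal, is where planarity enters, and it enters only there.
Euler's formula says that the mod 2 cohomology of the surface vanishes in degree 1. As all valencies
are even, the regions have a checkerboard colouring (`Planar.exists_checkerboard`). Hence every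
state pairs darts of opposite colours, its curves are the cycles of a permutation of the darts of
one colour, and exchanging the smoothings at a crossing multiplies this permutation by a
transposition (`card_loops_rematch`).

For move II, expand both corners of the bigon. Two of the four smoothings give the same diagram `U`,
in which each strand turns back. A third gives `U` with an additional circle, and the last gives
`V`, in which the strands pass through and which is isotopic to the result of the move. So the
bracket is `α β ⟨V⟩ + (α² + β² + α β δ) ⟨U⟩`, and its difference to `⟨V⟩` is the element above
(`Bigon.bracket_sub_mem`).

For move III, Kauffman's argument applies. One strand is over or under both others; expand the
crossing `c` of these two. One smoothing opens the triangle, and the strand slides by an isotopy.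
The other leaves a bigon, which can be removed modulo `I` before and after the move, with isotopic
results.

Smoothing keeps the set of darts and turns a crossing into two marked points, so diagrams that are
isotopic differ in where marked points lie. `bracket_eq_of_arcMap` compares them through maps of
darts that respect arcs and are isomorphic only at the crossings. -/

namespace Diagram

variable {H H' : Type}

/-! ### Checkerboard colourings of planar diagrams -/

/-- The colour of a dart is that of the region to its left; regions that share an edge have
different colours. -/
def Checkerboard (D : Diagram H) (c : H → Bool) : Prop :=
  (∀ x, c (D.edge x) = !c x) ∧ ∀ x, c (D.rot x) = !c x

/-- The mod 2 functions that are constant along a relation. -/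
def invariants (r : H → H → Prop) : Submodule (ZMod 2) (H → ZMod 2) where
  carrier := {f | ∀ x y, r x y → f x = f y}
  add_mem' hf hg x y h := by simp [hf x y h, hg x y h]
  zero_mem' := by simp
  smul_mem' a f hf x y h := by simp [hf x y h]

/-- Invariant functions are the functions on the classes; this turns the counts in Euler's formula
into dimensions. -/
theorem finrank_invariants [Finite H] (r : H → H → Prop) :
    Module.finrank (ZMod 2) (invariants r) = Nat.card (Quot r) := by
  have e : (Quot r → ZMod 2) ≃ₗ[ZMod 2] invariants r :=
    { toFun := fun f => ⟨fun x => f (Quot.mk r x), fun x y h => congrArg f (Quot.sound h)⟩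
      map_add' := fun _ _ => rfl
      map_smul' := fun _ _ => rfl
      invFun := fun f => Quot.lift f.1 f.2
      left_inv := fun f => by ext ⟨x⟩; rfl
      right_inv := fun f => rfl }
  have := Fintype.ofFinite (Quot r)
  rw [← e.finrank_eq, Module.finrank_fintype_fun_eq_card, Nat.card_eq_fintype_card]

theorem finrank_invariants_sameCycle [Finite H] (σ : Perm H) :
    Module.finrank (ZMod 2) (invariants σ.SameCycle) = numOrbits σ :=
  finrank_invariants _

theorem mem_invariants_sameCycle {σ : Perm H} {f : H → ZMod 2} :
    f ∈ invariants σ.SameCycle ↔ ∀ x, f (σ x) = f x := by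
  constructor
  · intro h x
    exact (h x (σ x) (Perm.sameCycle_apply_right.2 (Perm.SameCycle.refl _ _))).symm
  · rintro h x y ⟨n, rfl⟩
    induction n using Int.induction_on with
    | zero => rfl
    | succ n ih => rw [add_comm, zpow_add, zpow_one, Perm.mul_apply, h, ih]
    | pred n ih =>
      rw [ih, sub_eq_neg_add, zpow_add, zpow_neg_one, Perm.mul_apply]
      simpa using h (σ⁻¹ ((σ ^ (-(n : ℤ))) x))

theorem face_apply (D : Diagram H) (x : H) : D.face x = D.rot⁻¹ (D.edge x) := rfl

theorem two_eq_zero_zmod (a : ZMod 2) : a + a = 0 := CharTwo.add_self_eq_zero a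

theorem sum_eq_zero_of_edge_invariant [Fintype H] (D : Diagram H) {f : H → ZMod 2}
    (h : ∀ x, f (D.edge x) = f x) : ∑ x, f x = 0 :=
  Finset.sum_involution (fun x _ => D.edge x) (fun x _ => by rw [h, two_eq_zero_zmod])
    (fun x _ _ => D.edge_ne x) (fun _ _ => Finset.mem_univ _) (fun x _ => D.edge_edge x)

/-- All valencies are even: `rot` at a marked point and `rot²` at a crossing form an involution
without fixed points, and the terms cancel in pairs mod 2. -/
theorem sum_eq_zero_of_rot_invariant [Fintype H] (D : Diagram H) {f : H → ZMod 2}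
    (h : ∀ x, f (D.rot x) = f x) : ∑ x, f x = 0 := by
  classical
  refine Finset.sum_involution (fun x _ => if D.rot (D.rot x) = x then D.rot x else D.rot (D.rot x))
    (fun x _ => ?_) (fun x _ _ => ?_) (fun _ _ => Finset.mem_univ _) (fun x _ => ?_)
  · split_ifs <;> simp only [h, two_eq_zero_zmod]
  · split_ifs with h1
    · exact D.rot_ne x
    · exact h1
  · have h4 := D.rot_four
    have := D.rot.injective
    grind

/-- The coboundary of a function on the regions (or on the vertices). -/
def coboundary (D : Diagram H) : (H → ZMod 2) →ₗ[ZMod 2] (H → ZMod 2) where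
  toFun f x := f x + f (D.edge x)
  map_add' f g := by ext x; simp; ring
  map_smul' a f := by ext x; simp; ring

/-- Rank and nullity of `f ↦ f + f ∘ edge`: image and kernel both consist of functions that are
constant on edges. -/
theorem card_le_two_mul_numOrbits_edge [Fintype H] (D : Diagram H) :
    Fintype.card H ≤ 2 * numOrbits D.edge := by
  have h := D.coboundary.finrank_range_add_finrank_ker
  have hle : ∀ f x, D.coboundary f (D.edge x) = D.coboundary f x := fun f x => by
    simp [coboundary, D.edge_edge, add_comm]
  have h1 : Module.finrank (ZMod 2) D.coboundary.range ≤ numOrbits D.edge := by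
    rw [← finrank_invariants_sameCycle]
    refine Submodule.finrank_mono ?_
    rintro _ ⟨f, rfl⟩
    exact mem_invariants_sameCycle.2 (hle f)
  have h2 : Module.finrank (ZMod 2) D.coboundary.ker ≤ numOrbits D.edge := by
    rw [← finrank_invariants_sameCycle]
    refine Submodule.finrank_mono fun f hf => mem_invariants_sameCycle.2 fun x => ?_
    have := congrFun (LinearMap.mem_ker.1 hf) x
    exact (CharTwo.add_eq_zero.1 this).symm
  rw [Module.finrank_fintype_fun_eq_card] at h
  omega

/-- A colouring of the regions with coboundary the constant function 1 is wanted. Coboundaries of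
regions are orthogonal to all functions that are constant on vertices or on edges. Euler's formula
makes the dimensions agree, so they form the whole orthogonal complement, and 1 belongs to it
because vertices and edges have an even number of darts. -/
theorem Planar.exists_checkerboard [Finite H] {D : Diagram H} (hD : D.Planar) :
    ∃ c, D.Checkerboard c := by
  classical
  have := Fintype.ofFinite H
  let B : LinearMap.BilinForm (ZMod 2) (H → ZMod 2) := dotProductBilin (ZMod 2) (ZMod 2)
  have hBapp : ∀ f g, B f g = ∑ x, f x * g x := fun f g => rfl
  have hrefl : B.IsRefl := fun f g h => by
    rw [hBapp] at h ⊢; rw [← h]; exact Finset.sum_congr rfl fun _ _ => mul_comm _ _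
  have hnd : B.Nondegenerate := by
    refine hrefl.nondegenerate_iff_separatingLeft.2 ?_
    intro f hf
    ext x
    have := hf (Pi.single x 1)
    simpa [hBapp, Pi.single_apply] using this
  let A := invariants D.rot.SameCycle
  let E := invariants D.edge.SameCycle
  let F := invariants D.face.SameCycle
  let C := invariants fun x y : H => y = D.edge x ∨ y = D.rot x
  have memC : ∀ f, f ∈ C ↔ (∀ x, f (D.edge x) = f x) ∧ ∀ x, f (D.rot x) = f x := by
    intro f
    constructor
    · exact fun h => ⟨fun x => (h _ _ (Or.inl rfl)).symm, fun x => (h _ _ (Or.inr rfl)).symm⟩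
    · rintro ⟨h1, h2⟩ x y (rfl | rfl)
      · exact (h1 x).symm
      · exact (h2 x).symm
  have hface : ∀ f ∈ F, ∀ x, f (D.edge x) = f (D.rot⁻¹ x) := by
    intro f hf x
    have := mem_invariants_sameCycle.1 hf (D.edge x)
    rw [face_apply, D.edge_edge] at this
    exact this.symm
  -- the coboundaries of colourings of the regions
  let W := F.map D.coboundary
  have hW : Module.finrank (ZMod 2) W + Module.finrank (ZMod 2) C = numOrbits D.face := by
    have h := (D.coboundary.domRestrict F).finrank_range_add_finrank_ker
    rw [LinearMap.range_domRestrict, finrank_invariants_sameCycle] at h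
    rw [← h]
    congr 1
    rw [LinearMap.ker_domRestrict]
    -- A function that is constant on regions and on edges is also constant on vertices, hence on
    -- components.
    have : C = F ⊓ D.coboundary.ker := by
      ext f
      rw [memC, Submodule.mem_inf]
      have hk : f ∈ D.coboundary.ker ↔ ∀ x, f (D.edge x) = f x := by
        rw [LinearMap.mem_ker, funext_iff]
        exact forall_congr' fun x => (CharTwo.add_eq_zero).trans eq_comm
      rw [hk]
      constructor
      · rintro ⟨h1, h2⟩
        refine ⟨mem_invariants_sameCycle.2 fun x => ?_, h1⟩
        rw [face_apply, ← h1 x]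
        simpa using (h2 (D.rot⁻¹ (D.edge x))).symm
      · rintro ⟨h1, h2⟩
        refine ⟨h2, fun x => ?_⟩
        have := hface f h1 (D.rot x)
        rw [h2] at this
        simpa using this
    rw [this, ← LinearEquiv.finrank_eq
      (Submodule.comapSubtypeEquivOfLe (p := F ⊓ D.coboundary.ker) inf_le_left),
      Submodule.comap_inf, Submodule.comap_subtype_self, top_inf_eq]
  have hAE : Module.finrank (ZMod 2) ↥(A ⊔ E) + Module.finrank (ZMod 2) C =
      numOrbits D.rot + numOrbits D.edge := by
    have : C = A ⊓ E := by
      ext f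
      rw [memC, Submodule.mem_inf, mem_invariants_sameCycle, mem_invariants_sameCycle, and_comm]
    rw [this, Submodule.finrank_sup_add_finrank_inf_eq, finrank_invariants_sameCycle,
      finrank_invariants_sameCycle]
  have horth := LinearMap.BilinForm.finrank_orthogonal hnd (A ⊔ E)
  rw [Module.finrank_fintype_fun_eq_card] at horth
  have hWle : W ≤ B.orthogonal (A ⊔ E) := by
    rintro _ ⟨g, hg, rfl⟩
    rw [LinearMap.BilinForm.mem_orthogonal_iff]
    intro u hu
    obtain ⟨f, hf, k, hk, rfl⟩ := Submodule.mem_sup.1 hu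
    rw [map_add, LinearMap.add_apply]
    have h1 : B k (D.coboundary g) = 0 := by
      rw [hBapp]
      refine D.sum_eq_zero_of_edge_invariant fun x => ?_
      rw [mem_invariants_sameCycle.1 hk]
      simp [coboundary, D.edge_edge, add_comm]
    have h2 : B f (D.coboundary g) = 0 := by
      rw [hBapp]
      have : ∀ x, f x * D.coboundary g x = f x * g x + f x * g (D.rot⁻¹ x) := fun x => by
        rw [← hface g hg x]; simp [coboundary, mul_add]
      simp only [this, Finset.sum_add_distrib]
      -- Since `f` is invariant under `rot`, reindexing makes the two sums equal, and they cancel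
      -- mod 2.
      rw [← Equiv.sum_comp D.rot fun x => f x * g (D.rot⁻¹ x)]
      have hinv : ∀ x, D.rot⁻¹ (D.rot x) = x := D.rot.symm_apply_apply
      simp only [hinv, mem_invariants_sameCycle.1 hf, two_eq_zero_zmod]
    rw [h1, h2, add_zero]
  have hone : (fun _ => 1 : H → ZMod 2) ∈ B.orthogonal (A ⊔ E) := by
    rw [LinearMap.BilinForm.mem_orthogonal_iff]
    intro u hu
    obtain ⟨f, hf, k, hk, rfl⟩ := Submodule.mem_sup.1 hu
    rw [map_add, LinearMap.add_apply, hBapp, hBapp]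
    simp only [mul_one]
    rw [D.sum_eq_zero_of_rot_invariant (mem_invariants_sameCycle.1 hf),
      D.sum_eq_zero_of_edge_invariant (mem_invariants_sameCycle.1 hk), add_zero]
  have hC : Module.finrank (ZMod 2) C = D.numComponents := finrank_invariants _
  have hcard := D.card_le_two_mul_numOrbits_edge
  have hsup : Module.finrank (ZMod 2) ↥(A ⊔ E) ≤ Fintype.card H := by
    rw [← Module.finrank_fintype_fun_eq_card (ZMod 2)]; exact Submodule.finrank_le _
  have heq : W = B.orthogonal (A ⊔ E) := by
    -- With `V`, `E`, `F`, `C` as in Euler's formula, `W` has dimension `F - C`, and the complement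
    -- has dimension `|H| - (V + E - C) ≤ E - V + C`, which equals `F - C`.
    refine Submodule.eq_of_le_of_finrank_le hWle ?_
    unfold Planar at hD
    omega
  rw [← heq] at hone
  obtain ⟨g, hg, hg1⟩ := hone
  have h1 : ∀ x, g x + g (D.edge x) = 1 := fun x => congrFun hg1 x
  have key : ∀ a b : ZMod 2, a + b = 1 → decide (b = 0) = !decide (a = 0) := by decide
  refine ⟨fun x => decide (g x = 0), fun x => key _ _ (h1 x), fun x => key _ _ ?_⟩
  -- The darts `x` and `edge (rot x)` border the same region, so the rule across edges also gives
  -- the rule for `rot`.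
  have := h1 (D.rot x)
  rw [hface g hg, show D.rot⁻¹ (D.rot x) = x from D.rot.symm_apply_apply x] at this
  rw [add_comm]; exact this

/-! ### Counting the classes of a relation -/

theorem card_quot_congr {r : H → H → Prop} {r' : H' → H' → Prop} (f : H → H') (g : H' → H)
    (hf : ∀ x y, r x y → Relation.EqvGen r' (f x) (f y))
    (hg : ∀ x y, r' x y → Relation.EqvGen r (g x) (g y))
    (hgf : ∀ x, Relation.EqvGen r (g (f x)) x) (hfg : ∀ x, Relation.EqvGen r' (f (g x)) x) :
    Nat.card (Quot r) = Nat.card (Quot r') :=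
  Nat.card_congr
    { toFun := Quot.lift (fun x => Quot.mk r' (f x)) fun x y h => Quot.eqvGen_sound (hf x y h)
      invFun := Quot.lift (fun x => Quot.mk r (g x)) fun x y h => Quot.eqvGen_sound (hg x y h)
      left_inv := by rintro ⟨x⟩; exact Quot.eqvGen_sound (hgf x)
      right_inv := by rintro ⟨x⟩; exact Quot.eqvGen_sound (hfg x) }

theorem eqvGen_of_eqvGen {r : H → H → Prop} {r' : H' → H' → Prop} (f : H → H')
    (hf : ∀ x y, r x y → Relation.EqvGen r' (f x) (f y)) {x y : H} (h : Relation.EqvGen r x y) :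
    Relation.EqvGen r' (f x) (f y) := by
  induction h with
  | rel x y h => exact hf x y h
  | refl x => exact .refl _
  | symm x y _ ih => exact .symm _ _ ih
  | trans x y z _ _ h1 h2 => exact .trans _ _ _ h1 h2

/-- Add the pair `(p, q)` to a relation. -/
def addPair (r : H → H → Prop) (p q x y : H) : Prop := r x y ∨ x = p ∧ y = q

/-- A chain that uses the new pair begins and ends in the classes of `p` and `q`. -/
theorem eqvGen_addPair {r : H → H → Prop} {p q x y : H}
    (h : Relation.EqvGen (addPair r p q) x y) :
    Relation.EqvGen r x y ∨ (Relation.EqvGen r x p ∨ Relation.EqvGen r x q) ∧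
      (Relation.EqvGen r y p ∨ Relation.EqvGen r y q) := by
  have tr : ∀ {x y z}, Relation.EqvGen r x y → Relation.EqvGen r y z → Relation.EqvGen r x z :=
    fun h1 h2 => .trans _ _ _ h1 h2
  have sy : ∀ {x y}, Relation.EqvGen r x y → Relation.EqvGen r y x := fun h => .symm _ _ h
  induction h with
  | rel x y h =>
    obtain h | ⟨rfl, rfl⟩ := h
    · exact .inl (.rel _ _ h)
    · exact .inr ⟨.inl (.refl _), .inr (.refl _)⟩
  | refl x => exact .inl (.refl _)
  | symm x y _ ih => exact ih.imp sy And.symm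
  | trans x y z _ _ h1 h2 =>
    obtain h1 | ⟨h1, h1'⟩ := h1
    · obtain h2 | ⟨h2, h2'⟩ := h2
      · exact .inl (tr h1 h2)
      · exact .inr ⟨h2.imp (tr h1) (tr h1), h2'⟩
    · obtain h2 | ⟨h2, h2'⟩ := h2
      · exact .inr ⟨h1, h1'.imp (tr (sy h2)) (tr (sy h2))⟩
      · exact .inr ⟨h1, h2'⟩

theorem card_quot_eq_addPair {r : H → H → Prop} {p q : H} (h : Relation.EqvGen r p q) :
    Nat.card (Quot r) = Nat.card (Quot (addPair r p q)) :=
  card_quot_congr id id (fun _ _ h => .rel _ _ (.inl h))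
    (by rintro x y (h' | ⟨rfl, rfl⟩); exacts [.rel _ _ h', h]) (fun _ => .refl _) fun _ => .refl _

/-- The new pair merges two classes. Without the class of `p`, the old classes are in bijection with
the new ones; the class of `q` represents the merged one. -/
theorem card_quot_eq_addPair_add_one [Finite H] {r : H → H → Prop} {p q : H}
    (h : ¬ Relation.EqvGen r p q) :
    Nat.card (Quot r) = Nat.card (Quot (addPair r p q)) + 1 := by
  classical
  have hfin : Finite {u : Quot r // u ≠ Quot.mk r p} := inferInstance
  rw [← Nat.card_congr (Equiv.optionSubtypeNe (Quot.mk r p)), Finite.card_option]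
  congr 1
  let φ : Quot r → Quot (addPair r p q) :=
    Quot.lift (Quot.mk _) fun x y h => Quot.sound (.inl h)
  have hφ : ∀ x, φ (Quot.mk r x) = Quot.mk _ x := fun _ => rfl
  have hmk : ∀ x y, Quot.mk r x = Quot.mk r y ↔ Relation.EqvGen r x y := fun x y => Quot.eq
  refine Nat.card_congr (Equiv.ofBijective (fun u : {u : Quot r // u ≠ Quot.mk r p} => φ u) ⟨?_, ?_⟩)
  · rintro ⟨⟨x⟩, hx⟩ ⟨⟨y⟩, hy⟩ hxy
    have hxp : ¬ Relation.EqvGen r x p := fun h => hx ((hmk _ _).2 h)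
    have hyp : ¬ Relation.EqvGen r y p := fun h => hy ((hmk _ _).2 h)
    refine Subtype.ext ((hmk _ _).2 ?_)
    obtain h1 | ⟨h1 | h1, h2 | h2⟩ := eqvGen_addPair (Quot.eq.1 hxy)
    · exact h1
    · exact absurd h1 hxp
    · exact absurd h1 hxp
    · exact absurd h2 hyp
    · exact .trans _ _ _ h1 (.symm _ _ h2)
  · rintro ⟨x⟩
    by_cases hx : Quot.mk r x = Quot.mk r p
    · refine ⟨⟨Quot.mk r q, fun hq => h (.symm _ _ ((hmk _ _).1 hq))⟩, ?_⟩
      have h1 : φ (Quot.mk r x) = φ (Quot.mk r p) := congrArg φ hx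
      rw [hφ, hφ] at h1
      change Quot.mk _ q = Quot.mk _ x
      rw [h1]
      exact (Quot.sound (.inr ⟨rfl, rfl⟩)).symm
    · exact ⟨⟨Quot.mk r x, hx⟩, rfl⟩

/-! ### Cycles of permutations that differ by a transposition. -/

/-- Two different cycles merge: from `p`, the permutation `τ` enters the `σ`-cycle of `q` at `σ q`
and follows it. It cannot leave this cycle before it reaches `q`, and by finiteness it does reach
`q`. -/
theorem sameCycle_swap_of_not [Finite H] {σ τ : Perm H} {p q : H}
    (hp : τ p = σ q) (hτ : ∀ x, x ≠ p → x ≠ q → τ x = σ x) (h : ¬ σ.SameCycle p q) :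
    τ.SameCycle p q := by
  by_contra hn
  have key : ∀ n : ℕ, (τ ^ (n + 1)) p = (σ ^ (n + 1)) q := by
    intro n
    induction n with
    | zero => simpa using hp
    | succ n ih =>
      rw [pow_succ' τ, Perm.mul_apply, ih, pow_succ' σ (n + 1), Perm.mul_apply]
      refine hτ _ (fun h' => h ?_) fun h' => hn ?_
      · exact Perm.SameCycle.symm ⟨(n + 1 : ℕ), by rw [zpow_natCast, h']⟩
      · exact ⟨(n + 1 : ℕ), by rw [zpow_natCast, ih, h']⟩
  obtain ⟨n, hn0, hn1⟩ := (Perm.SameCycle.refl σ q).exists_pow_eq''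
  have := key (n - 1)
  rw [Nat.sub_add_cancel hn0, hn1.2] at this
  exact hn ⟨n, by simpa using this⟩

/-- A common cycle splits: `τ` sends the end `q` of the arc from `σ p` to `q` back to its beginning.
-/
theorem not_sameCycle_swap [Finite H] {σ τ : Perm H} {p q : H} (hpq : p ≠ q)
    (hq : τ q = σ p) (hτ : ∀ x, x ≠ p → x ≠ q → τ x = σ x) (h : σ.SameCycle p q) :
    ¬ τ.SameCycle p q := by
  classical
  have hex : ∃ n : ℕ, (σ ^ n) p = q := by
    obtain ⟨n, -, hn⟩ := h.exists_pow_eq'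
    exact ⟨n, hn⟩
  -- Minimality keeps `p` off the arc: if `σ ^ i` fixed `p` with `1 ≤ i < n`, then `σ ^ (n - i)`
  -- would already take `p` to `q`.
  let n := Nat.find hex
  have hn : (σ ^ n) p = q := Nat.find_spec hex
  have hmin : ∀ m < n, (σ ^ m) p ≠ q := fun m hm => Nat.find_min hex hm
  have hn0 : 0 < n := Nat.pos_of_ne_zero fun h0 => hpq (by simpa [h0] using hn)
  -- the arc from `σ p` to `q` is closed under `τ` and does not contain `p`
  have hclosed : ∀ m : ℕ, ∃ i, 1 ≤ i ∧ i ≤ n ∧ (τ ^ m) q = (σ ^ i) p := by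
    intro m
    induction m with
    | zero => exact ⟨n, hn0, le_rfl, hn.symm⟩
    | succ m ih =>
      obtain ⟨i, hi1, hi2, hi⟩ := ih
      rw [pow_succ', Perm.mul_apply, hi]
      rcases hi2.lt_or_eq with hlt | rfl
      · refine ⟨i + 1, by omega, hlt, ?_⟩
        rw [pow_succ', Perm.mul_apply]
        refine hτ _ (fun h' => ?_) (hmin i hlt)
        refine hmin (n - i) (by omega) ?_
        have := hn
        rw [← Nat.sub_add_cancel hi2, pow_add, Perm.mul_apply, h'] at this
        exact this
      · exact ⟨1, le_rfl, hn0, by rw [hn, hq, pow_one]⟩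
  intro hs
  obtain ⟨m, -, hm⟩ := hs.symm.exists_pow_eq'
  obtain ⟨i, hi1, hi2, hi⟩ := hclosed m
  rw [hm] at hi
  rcases hi2.lt_or_eq with hlt | rfl
  · refine hmin (n - i) (by omega) ?_
    have := hn
    rw [← Nat.sub_add_cancel hi2, pow_add, Perm.mul_apply, ← hi] at this
    exact this
  · exact hpq (hi.trans hn)

/-! ### Closed curves formed by two matchings -/

/-- Going twice along the curves formed by two matchings, on the darts of one colour. -/
def loopPerm (E P : H → H) (c : H → Bool) (hE : ∀ x, E (E x) = x) (hP : ∀ x, P (P x) = x)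
    (cE : ∀ x, c (E x) = !c x) (cP : ∀ x, c (P x) = !c x) : Perm {x // c x = true} where
  toFun x := ⟨E (P x), by rw [cE, cP, x.2]; rfl⟩
  invFun x := ⟨P (E x), by rw [cP, cE, x.2]; rfl⟩
  left_inv x := Subtype.ext (by simp [hE, hP])
  right_inv x := Subtype.ext (by simp [hE, hP])

/-- The retraction `t` onto the darts of colour `true` replaces each other dart by its `P`-partner.
It makes `P`-steps trivial and turns an `E`-step into one step of the permutation, forwards or
backwards. -/
theorem eqvGen_iff_sameCycle_loopPerm (E P : H → H) (c : H → Bool) (hE : ∀ x, E (E x) = x)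
    (hP : ∀ x, P (P x) = x) (cE : ∀ x, c (E x) = !c x) (cP : ∀ x, c (P x) = !c x)
    (p q : {x // c x = true}) :
    Relation.EqvGen (fun x y => y = E x ∨ y = P x) p.1 q.1 ↔
      (loopPerm E P c hE hP cE cP).SameCycle p q := by
  set σ := loopPerm E P c hE hP cE cP with hσ
  constructor
  · let t : H → {x // c x = true} := fun x =>
      if h : c x = true then ⟨x, h⟩ else ⟨P x, by rw [cP]; simpa using h⟩
    have ht1 : ∀ x (h : c x = true), t x = ⟨x, h⟩ := fun x h => dif_pos h
    have ht2 : ∀ x (h : ¬ c x = true), (t x).1 = P x := fun x h => by simp [t, h]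
    have key : ∀ x y, Relation.EqvGen (fun x y => y = E x ∨ y = P x) x y →
        σ.SameCycle (t x) (t y) := by
      have hσ1 : ∀ x : {x // c x = true}, (σ x).1 = E (P x.1) := fun _ => rfl
      intro x y h
      induction h with
      | rel x y h =>
        obtain rfl | rfl := h
        · by_cases hx : c x = true
          · refine Perm.SameCycle.symm (Perm.sameCycle_apply_left.1 ?_)
            convert Perm.SameCycle.refl σ (t x) using 1
            apply Subtype.ext
            rw [hσ1, ht2 _ (by rw [cE, hx]; simp), hP, hE, ht1 x hx]
          · refine Perm.sameCycle_apply_left.1 ?_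
            convert Perm.SameCycle.refl σ (t (E x)) using 1
            apply Subtype.ext
            rw [hσ1, ht2 x hx, hP, ht1 (E x) (by rw [cE]; simpa using hx)]
        · convert Perm.SameCycle.refl σ (t x) using 1
          apply Subtype.ext
          by_cases hx : c x = true
          · rw [ht1 x hx, ht2 (P x) (by rw [cP, hx]; simp), hP]
          · rw [ht2 x hx, ht1 (P x) (by rw [cP]; simpa using hx)]
      | refl x => exact .refl _ _
      | symm x y _ ih => exact ih.symm
      | trans x y z _ _ h1 h2 => exact h1.trans h2
    intro h
    simpa [ht1 _ p.2, ht1 _ q.2] using key _ _ h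
  · have hstep : ∀ x : {x // c x = true},
        Relation.EqvGen (fun x y => y = E x ∨ y = P x) x.1 (σ x).1 := fun x =>
      .trans _ (P x.1) _ (.rel _ _ (.inr rfl)) (.rel _ _ (.inl rfl))
    rintro ⟨n, rfl⟩
    induction n using Int.induction_on with
    | zero => exact .refl _
    | succ n ih =>
      rw [add_comm, zpow_add, zpow_one, Perm.mul_apply]
      exact .trans _ _ _ ih (hstep _)
    | pred n ih =>
      refine .trans _ _ _ ih ?_
      rw [sub_eq_neg_add, zpow_add, zpow_neg_one, Perm.mul_apply]
      refine .symm _ _ ?_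
      have := hstep (σ⁻¹ ((σ ^ (-(n : ℤ))) p))
      rwa [show σ (σ⁻¹ ((σ ^ (-(n : ℤ))) p)) = (σ ^ (-(n : ℤ))) p from σ.apply_symm_apply _] at this

/-- If two pairs of a matching are exchanged then the number of curves changes by exactly 1, provided
that all matchings respect a 2-colouring. -/
theorem card_loops_rematch [Finite H] (E P P' : H → H) (c : H → Bool) (hE : ∀ x, E (E x) = x)
    (hP : ∀ x, P (P x) = x) (hP' : ∀ x, P' (P' x) = x) (cE : ∀ x, c (E x) = !c x)
    (cP : ∀ x, c (P x) = !c x) (cP' : ∀ x, c (P' x) = !c x) (p q : H) (hpq : p ≠ q)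
    (hc : c p = c q) (hp : P' p = P q) (hq : P' q = P p)
    (hPP : ∀ x, x ≠ p → x ≠ q → x ≠ P p → x ≠ P q → P' x = P x) :
    Nat.card (Quot fun x y => y = E x ∨ y = P x) =
        Nat.card (Quot fun x y => y = E x ∨ y = P' x) + 1 ∨
      Nat.card (Quot fun x y => y = E x ∨ y = P' x) =
        Nat.card (Quot fun x y => y = E x ∨ y = P x) + 1 := by
  wlog hcp : c p = true generalizing c
  · exact this (fun x => !c x) (by simp [cE]) (by simp [cP]) (by simp [cP']) (by simp [hc])
      (by simpa using hcp)
  have hcq : c q = true := hc ▸ hcp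
  let σ := loopPerm E P c hE hP cE cP
  let τ := loopPerm E P' c hE hP' cE cP'
  have hτp : τ ⟨p, hcp⟩ = σ ⟨q, hcq⟩ := Subtype.ext (congrArg E hp)
  have hτq : τ ⟨q, hcq⟩ = σ ⟨p, hcp⟩ := Subtype.ext (congrArg E hq)
  have hτ : ∀ x, x ≠ ⟨p, hcp⟩ → x ≠ ⟨q, hcq⟩ → τ x = σ x := by
    rintro ⟨x, hx⟩ h1 h2
    refine Subtype.ext (congrArg E (hPP x (by simpa using h1) (by simpa using h2) ?_ ?_))
    · rintro rfl; rw [cP, hcp] at hx; simp at hx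
    · rintro rfl; rw [cP, hcq] at hx; simp at hx
  have hne : (⟨p, hcp⟩ : {x // c x = true}) ≠ ⟨q, hcq⟩ := by simpa using hpq
  have h1 := eqvGen_iff_sameCycle_loopPerm E P c hE hP cE cP ⟨p, hcp⟩ ⟨q, hcq⟩
  have h2 := eqvGen_iff_sameCycle_loopPerm E P' c hE hP' cE cP' ⟨p, hcp⟩ ⟨q, hcq⟩
  -- Once `p` and `q` are identified, both matchings generate the same equivalence relation.
  have hcard : Nat.card (Quot (addPair (fun x y => y = E x ∨ y = P x) p q)) =
      Nat.card (Quot (addPair (fun x y => y = E x ∨ y = P' x) p q)) := by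
    have aux : ∀ (P P' : H → H) (_ : ∀ x, P (P x) = x) (_ : ∀ x, P' (P' x) = x)
        (_ : P' p = P q) (_ : P' q = P p)
        (_ : ∀ x, x ≠ p → x ≠ q → x ≠ P p → x ≠ P q → P' x = P x) (x y : H),
        addPair (fun x y => y = E x ∨ y = P x) p q x y →
        Relation.EqvGen (addPair (fun x y => y = E x ∨ y = P' x) p q) x y := by
      intro P P' hP hP' hp hq hPP x y h
      have key : Relation.EqvGen (addPair (fun x y => y = E x ∨ y = P' x) p q) p q :=
        .rel _ _ (.inr ⟨rfl, rfl⟩)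
      have hP1 : ∀ x, Relation.EqvGen (addPair (fun x y => y = E x ∨ y = P' x) p q) x (P' x) :=
        fun x => .rel _ _ (.inl (.inr rfl))
      have kp : Relation.EqvGen (addPair (fun x y => y = E x ∨ y = P' x) p q) p (P p) :=
        .trans _ _ _ key (hq ▸ hP1 q)
      have kq : Relation.EqvGen (addPair (fun x y => y = E x ∨ y = P' x) p q) q (P q) :=
        .trans _ _ _ (.symm _ _ key) (hp ▸ hP1 p)
      obtain (rfl | rfl) | ⟨rfl, rfl⟩ := h
      · exact .rel _ _ (.inl (.inl rfl))
      · by_cases e1 : x = p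
        · exact e1 ▸ kp
        by_cases e2 : x = q
        · exact e2 ▸ kq
        by_cases e3 : x = P p
        · rw [e3, hP]; exact .symm _ _ kp
        by_cases e4 : x = P q
        · rw [e4, hP]; exact .symm _ _ kq
        rw [← hPP x e1 e2 e3 e4]; exact hP1 x
      · exact key
    refine card_quot_congr id id (aux P P' hP hP' hp hq hPP)
      (aux P' P hP' hP hq.symm hp.symm fun x a b d e => ?_) (fun _ => .refl _) fun _ => .refl _
    exact (hPP x a b (hq ▸ e) (hp ▸ d)).symm
  -- The dart `q` is on the curve of `p` for exactly one of the two matchings; for that one the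
  -- added pair changes nothing, for the other it merges two curves.
  by_cases h : σ.SameCycle ⟨p, hcp⟩ ⟨q, hcq⟩
  · right
    rw [card_quot_eq_addPair (h1.2 h), hcard]
    exact card_quot_eq_addPair_add_one fun h' => not_sameCycle_swap hne hτq hτ h (h2.1 h')
  · left
    rw [card_quot_eq_addPair (h2.2 (sameCycle_swap_of_not hτp hτ h)), ← hcard]
    exact card_quot_eq_addPair_add_one fun h' => h (h1.1 h')

/-! ### Vertices and crossings -/

theorem rot_inv (D : Diagram H) (x : H) : D.rot⁻¹ x = D.rot (D.rot (D.rot x)) := by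
  rw [Perm.inv_eq_iff_eq]; exact (D.rot_four x).symm

theorem isCrossing_rot (D : Diagram H) {x : H} : D.IsCrossing (D.rot x) ↔ D.IsCrossing x := by
  simp [IsCrossing]

theorem sameVertex_iff (D : Diagram H) {x y : H} : D.SameVertex x y ↔
    y = x ∨ y = D.rot x ∨ y = D.rot (D.rot x) ∨ y = D.rot (D.rot (D.rot x)) := by
  constructor
  · rintro ⟨n, rfl⟩
    have h4 := D.rot_four x
    induction n using Int.induction_on with
    | zero => exact .inl rfl
    | succ n ih => rw [add_comm, zpow_add, zpow_one, Perm.mul_apply]; grind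
    | pred n ih =>
      rw [sub_eq_neg_add, zpow_add, zpow_neg_one, Perm.mul_apply, rot_inv]
      grind
  · have h : ∀ y, D.rot.SameCycle x y → D.rot.SameCycle x (D.rot y) := fun y h =>
      Perm.sameCycle_apply_right.2 h
    have h0 := Perm.SameCycle.refl D.rot x
    rintro (rfl | rfl | rfl | rfl)
    exacts [h0, h _ h0, h _ (h _ h0), h _ (h _ (h _ h0))]

theorem SameVertex.isCrossing_iff {D : Diagram H} {x y : H} (h : D.SameVertex x y) :
    D.IsCrossing x ↔ D.IsCrossing y := by
  obtain rfl | rfl | rfl | rfl := D.sameVertex_iff.1 h <;> simp only [isCrossing_rot]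

/-- The crossing at a dart. -/
def crossingAt (D : Diagram H) (x : H) (h : D.IsCrossing x) : D.Crossing := Quotient.mk _ ⟨x, h⟩

theorem crossingAt_eq_iff (D : Diagram H) {x y : H} {hx : D.IsCrossing x} {hy : D.IsCrossing y} :
    D.crossingAt x hx = D.crossingAt y hy ↔ D.SameVertex x y :=
  Quotient.eq

theorem exists_crossingAt (D : Diagram H) (c : D.Crossing) : ∃ x h, c = D.crossingAt x h := by
  obtain ⟨x, rfl⟩ := Quotient.exists_rep c
  exact ⟨x.1, x.2, rfl⟩

instance [Finite H] (D : Diagram H) : Finite D.Crossing := Quotient.finite _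

theorem partner_of_isCrossing (D : Diagram H) (s : D.State) {x : H} (h : D.IsCrossing x)
    [Decidable (s (D.crossingAt x h) = true ↔ D.isOver x)] :
    D.partner s x =
      if (s (D.crossingAt x h) = true ↔ D.isOver x) then D.rot⁻¹ x else D.rot x := by
  unfold partner
  rw [dif_pos h]
  congr

theorem partner_of_not_isCrossing (D : Diagram H) (s : D.State) {x : H} (h : ¬ D.IsCrossing x) :
    D.partner s x = D.rot x := dif_neg h

theorem crossingAt_rot (D : Diagram H) {x : H} (h : D.IsCrossing x)
    (h' : D.IsCrossing (D.rot x)) : D.crossingAt (D.rot x) h' = D.crossingAt x h :=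
  D.crossingAt_eq_iff.2 (Perm.SameCycle.symm (D.sameVertex_iff.2 (.inr (.inl rfl))))

/-- Consecutive darts at a crossing lie on different strands, so the test in `partner` has opposite
outcomes for a dart and its partner, and the second turn undoes the first. -/
theorem partner_partner (D : Diagram H) (s : D.State) (x : H) :
    D.partner s (D.partner s x) = x := by
  classical
  by_cases h : D.IsCrossing x
  · have h' : D.IsCrossing (D.rot⁻¹ x) := by rw [rot_inv]; simpa only [isCrossing_rot] using h
    have hx : D.rot (D.rot⁻¹ x) = x := D.rot.apply_symm_apply x
    have hx' : D.rot⁻¹ (D.rot x) = x := D.rot.symm_apply_apply x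
    rw [D.partner_of_isCrossing s h]
    split_ifs with hs
    · rw [D.partner_of_isCrossing s h', if_neg, hx]
      have h1 := D.isOver_rot _ h'
      have h2 : D.crossingAt (D.rot⁻¹ x) h' = D.crossingAt x h := by
        rw [← D.crossingAt_rot h' (by rwa [hx])]; simp only [hx]
      rw [hx] at h1
      rw [h2]
      tauto
    · rw [D.partner_of_isCrossing s (D.isCrossing_rot.2 h), if_pos, hx']
      have h1 := D.isOver_rot _ h
      rw [D.crossingAt_rot h]
      tauto
  · have hr : ¬ D.IsCrossing (D.rot x) := by rwa [isCrossing_rot]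
    rw [D.partner_of_not_isCrossing s h, D.partner_of_not_isCrossing s hr]
    simpa [IsCrossing] using h

theorem Checkerboard.partner {D : Diagram H} {c : H → Bool} (hc : D.Checkerboard c)
    (s : D.State) (x : H) : c (D.partner s x) = !c x := by
  classical
  by_cases h : D.IsCrossing x
  · rw [D.partner_of_isCrossing s h]
    split_ifs
    · rw [rot_inv]; simp [hc.2]
    · exact hc.2 x
  · rw [D.partner_of_not_isCrossing s h, hc.2]

/-! ### The bracket as a finite sum -/

open BracketRing

/-- The coefficient of a smoothing. -/
noncomputable def weight : Bool → BracketRing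
  | true => α
  | false => β

theorem pow_card_mul_pow_card {ι : Type} [Fintype ι] (s : ι → Bool) :
    α ^ Nat.card {c // s c = true} * β ^ Nat.card {c // s c = false} = ∏ c, weight (s c) := by
  classical
  have h : ∀ c, weight (s c) = if s c = true then α else β := fun c => by
    cases s c <;> rfl
  simp only [h, Finset.prod_ite, Finset.prod_const, Nat.card_eq_fintype_card, Fintype.card_subtype,
    Bool.not_eq_true]

theorem bracket_eq_sum (D : Diagram H) [Fintype D.Crossing] [DecidableEq D.Crossing] :
    D.bracket = ∑ s : D.State, (∏ c, weight (s c)) * δ ^ D.loops s := by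
  unfold bracket
  rw [finsum_eq_sum_of_fintype]
  simp only [pow_card_mul_pow_card]

/-- Corresponding states have equal weights. Isotopies use this with `n = 0`, an additional circle
with `n = 1`. -/
theorem bracket_eq_pow_mul [Finite H] {D : Diagram H} {D' : Diagram H'} (e : D.Crossing ≃ D'.Crossing)
    (n : ℕ) (h : ∀ s : D'.State, D'.loops s = D.loops (s ∘ e) + n) :
    D'.bracket = δ ^ n * D.bracket := by
  classical
  have := Fintype.ofFinite D.Crossing
  have := Fintype.ofEquiv _ e
  rw [bracket_eq_sum, bracket_eq_sum, Finset.mul_sum]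
  refine Fintype.sum_equiv (e.arrowCongr (Equiv.refl Bool)).symm _ _ fun s => ?_
  have hs : (e.arrowCongr (Equiv.refl Bool)).symm s = s ∘ e := rfl
  rw [hs, h, pow_add, ← Equiv.prod_comp e]
  simp only [Function.comp]
  ring

/-! ### Maps that preserve arcs and crossings -/

/-- One step along a strand, without passing a crossing. -/
def arcRel (D : Diagram H) (x y : H) : Prop := y = D.edge x ∨ ¬ D.IsCrossing x ∧ y = D.rot x

/-- The darts `x` and `y` are on the same arc of a strand between crossings. -/
def Arc (D : Diagram H) : H → H → Prop := Relation.EqvGen D.arcRel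

theorem Arc.refl (D : Diagram H) (x : H) : D.Arc x x := Relation.EqvGen.refl x

theorem Arc.symm {D : Diagram H} {x y : H} (h : D.Arc x y) : D.Arc y x := Relation.EqvGen.symm _ _ h

theorem Arc.trans {D : Diagram H} {x y z : H} (h : D.Arc x y) (h' : D.Arc y z) : D.Arc x z :=
  Relation.EqvGen.trans _ _ _ h h'

theorem Arc.edge (D : Diagram H) (x : H) : D.Arc x (D.edge x) := .rel _ _ (.inl rfl)

theorem Arc.rot {D : Diagram H} {x : H} (h : ¬ D.IsCrossing x) : D.Arc x (D.rot x) :=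
  .rel _ _ (.inr ⟨h, rfl⟩)

/-- The relation whose classes are the closed curves of a state. -/
def loopRel (D : Diagram H) (s : D.State) (x y : H) : Prop := y = D.edge x ∨ y = D.partner s x

/-- At a marked point the partner does not depend on the state, so an arc lies on one curve of every
state. -/
theorem Arc.loopRel {D : Diagram H} {x y : H} (h : D.Arc x y) (s : D.State) :
    Relation.EqvGen (D.loopRel s) x y := by
  refine eqvGen_of_eqvGen id (fun x y h => .rel _ _ ?_) h
  obtain h | ⟨h, rfl⟩ := h
  · exact .inl h
  · exact .inr (D.partner_of_not_isCrossing s h).symm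

/-- The map `f` preserves arcs, and is an isomorphism from crossings to crossings. -/
structure ArcMap (D : Diagram H) (D' : Diagram H') (f : H → H') : Prop where
  edge : ∀ x, D'.Arc (f x) (f (D.edge x))
  arc_rot : ∀ x, ¬ D.IsCrossing x → D'.Arc (f x) (f (D.rot x))
  isCrossing : ∀ x, D.IsCrossing x → D'.IsCrossing (f x)
  rot : ∀ x, D.IsCrossing x → f (D.rot x) = D'.rot (f x)
  isOver : ∀ x, D.IsCrossing x → (D'.isOver (f x) ↔ D.isOver x)

namespace ArcMap

variable {D : Diagram H} {D' : Diagram H'} {f : H → H'} {g : H' → H}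

theorem sameVertex (hf : ArcMap D D' f) {x y : H} (hx : D.IsCrossing x) (h : D.SameVertex x y) :
    D'.SameVertex (f x) (f y) := by
  have hr := fun x => D.isCrossing_rot (x := x)
  rw [sameVertex_iff] at h ⊢
  obtain rfl | rfl | rfl | rfl := h
  · exact .inl rfl
  · simp [hf.rot, hx]
  · simp [hf.rot, hx, hr]
  · simp [hf.rot, hx, hr]

/-- The map of crossings. -/
def mapCrossing (hf : ArcMap D D' f) : D.Crossing → D'.Crossing :=
  Quotient.map' (fun x => ⟨f x.1, hf.isCrossing _ x.2⟩) fun x _ h => hf.sameVertex x.2 h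

theorem mapCrossing_crossingAt (hf : ArcMap D D' f) {x : H} (hx : D.IsCrossing x) :
    hf.mapCrossing (D.crossingAt x hx) = D'.crossingAt (f x) (hf.isCrossing _ hx) := rfl

theorem partner (hf : ArcMap D D' f) (s : D'.State) {x : H} (hx : D.IsCrossing x) :
    f (D.partner (s ∘ hf.mapCrossing) x) = D'.partner s (f x) := by
  classical
  have hr := fun x => D.isCrossing_rot (x := x)
  rw [D.partner_of_isCrossing _ hx, D'.partner_of_isCrossing _ (hf.isCrossing _ hx)]
  simp only [Function.comp, hf.mapCrossing_crossingAt, hf.isOver x hx]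
  split_ifs
  · simp only [rot_inv]
    rw [hf.rot, hf.rot, hf.rot] <;> simp [hr, hx]
  · rw [hf.rot x hx]

theorem loopRel (hf : ArcMap D D' f) (s : D'.State) (x y : H)
    (h : D.loopRel (s ∘ hf.mapCrossing) x y) : Relation.EqvGen (D'.loopRel s) (f x) (f y) := by
  obtain rfl | rfl := h
  · exact (hf.edge x).loopRel s
  · by_cases hx : D.IsCrossing x
    · exact .rel _ _ (.inr (hf.partner s hx))
    · rw [D.partner_of_not_isCrossing _ hx]
      exact (hf.arc_rot x hx).loopRel s

theorem mapCrossing_mapCrossing (hf : ArcMap D D' f) (hg : ArcMap D' D g)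
    (hgf : ∀ x, D.IsCrossing x → g (f x) = x) (c : D.Crossing) :
    hg.mapCrossing (hf.mapCrossing c) = c := by
  obtain ⟨x, hx, rfl⟩ := D.exists_crossingAt c
  simp only [mapCrossing_crossingAt, hgf x hx]

end ArcMap

/-- Diagrams that differ only in the way in which arcs are drawn have the same bracket. -/
theorem bracket_eq_of_arcMap [Finite H] {D : Diagram H} {D' : Diagram H'} {f : H → H'} {g : H' → H}
    (hf : ArcMap D D' f) (hg : ArcMap D' D g)
    (hgf : ∀ x, D.IsCrossing x → g (f x) = x) (hfg : ∀ x, D'.IsCrossing x → f (g x) = x)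
    (agf : ∀ x, D.Arc (g (f x)) x) (afg : ∀ x, D'.Arc (f (g x)) x) :
    D.bracket = D'.bracket := by
  have h1 := hf.mapCrossing_mapCrossing hg hgf
  have h2 := hg.mapCrossing_mapCrossing hf hfg
  rw [bracket_eq_pow_mul ⟨hf.mapCrossing, hg.mapCrossing, h1, h2⟩ 0, pow_zero, one_mul]
  intro s
  refine (card_quot_congr f g (hf.loopRel s) ?_ (fun x => (agf x).loopRel _)
    fun x => (afg x).loopRel _).symm
  have := hg.loopRel (s ∘ hf.mapCrossing)
  simpa only [Function.comp_assoc, show hf.mapCrossing ∘ hg.mapCrossing = id from funext h2,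
    Function.comp_id] using this

theorem Iso.bracket_eq [Finite H] {D : Diagram H} {D' : Diagram H'} (h : D.Iso D') :
    D.bracket = D'.bracket := by
  obtain ⟨f, he, hr, ho⟩ := h
  have he' : ∀ x, f.symm (D'.edge x) = D.edge (f.symm x) := fun x => by
    rw [Equiv.symm_apply_eq, he, Equiv.apply_symm_apply]
  have hr' : ∀ x, f.symm (D'.rot x) = D.rot (f.symm x) := fun x => by
    rw [Equiv.symm_apply_eq, hr, Equiv.apply_symm_apply]
  have hc : ∀ x, D'.IsCrossing (f x) ↔ D.IsCrossing x := fun x => by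
    simp only [IsCrossing, ← hr, ne_eq, EmbeddingLike.apply_eq_iff_eq]
  have hc' : ∀ x, D.IsCrossing (f.symm x) ↔ D'.IsCrossing x := fun x => by
    rw [← hc, Equiv.apply_symm_apply]
  refine bracket_eq_of_arcMap (f := f) (g := f.symm)
    ⟨fun x => he x ▸ .edge _ _, fun x hx => hr x ▸ .rot (by rwa [hc]), fun x => (hc x).2,
      fun x _ => hr x, ho⟩
    ⟨fun x => he' x ▸ .edge _ _, fun x hx => hr' x ▸ .rot (by rwa [hc']), fun x => (hc' x).2,
      fun x _ => hr' x, fun x hx => ?_⟩ (by simp) (by simp) (by simp [Arc.refl]) (by simp [Arc.refl])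
  rw [← ho _ ((hc' x).2 hx), Equiv.apply_symm_apply]

theorem Subdivision.bracket_eq [Finite H] {D : Diagram H} {D' : Diagram (H ⊕ Bool)}
    (h : D.Subdivision D') : D.bracket = D'.bracket := by
  obtain ⟨d, h1, h2, h3, h4, h5, h6⟩ := h
  have hc : ∀ x, D'.IsCrossing (.inl x) ↔ D.IsCrossing x := fun x => by simp [IsCrossing, h4]
  have hc' : ∀ b, ¬ D'.IsCrossing (.inr b) := fun b => by simp [IsCrossing, h5]
  have a1 : D'.Arc (.inl d) (.inr false) := h1 ▸ .edge _ _
  have a2 : D'.Arc (.inl (D.edge d)) (.inr true) := h2 ▸ .edge _ _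
  have a3 : D'.Arc (.inr false) (.inr true) := by
    have := Arc.rot (hc' false); rwa [h5] at this
  have a : D'.Arc (.inl d) (.inl (D.edge d)) := a1.trans (a3.trans a2.symm)
  have h1' : D'.edge (.inr false) = .inl d := by rw [← h1, D'.edge_edge]
  have h2' : D'.edge (.inr true) = .inl (D.edge d) := by rw [← h2, D'.edge_edge]
  -- The retraction sends each dart of the new point to the old dart at the other end of its edge.
  refine bracket_eq_of_arcMap (f := Sum.inl)
    (g := Sum.elim id fun b => if b = true then D.edge d else d)
    ⟨fun x => ?_, fun x hx => h4 x ▸ .rot (by rwa [hc]), fun x => (hc x).2, fun x _ => (h4 x).symm, h6⟩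
    ⟨?_, ?_, ?_, ?_, ?_⟩ (by simp) ?_ (by simp [Arc.refl]) ?_
  · by_cases e1 : x = d
    · rwa [e1]
    by_cases e2 : x = D.edge d
    · rw [e2, D.edge_edge]; exact a.symm
    rw [← h3 x e1 e2]; exact .edge _ _
  · rintro (x | _ | _)
    · by_cases e1 : x = d
      · rw [e1, h1]; exact .refl _ _
      by_cases e2 : x = D.edge d
      · rw [e2, h2]; exact .refl _ _
      rw [h3 x e1 e2]; exact .edge _ _
    · rw [h1']; exact .refl _ _
    · rw [h2']; exact .refl _ _
  · rintro (x | _ | _) hx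
    · rw [h4]; exact .rot (by rwa [hc] at hx)
    · rw [h5]; exact .edge _ _
    · rw [h5]; exact (Arc.edge _ _).symm
  · rintro (x | b) hx
    · exact (hc x).1 hx
    · exact absurd hx (hc' b)
  · rintro (x | b) hx
    · rw [h4]; rfl
    · exact absurd hx (hc' b)
  · rintro (x | b) hx
    · exact (h6 x ((hc x).1 hx)).symm
    · exact absurd hx (hc' b)
  · rintro (x | b) hx
    · rfl
    · exact absurd hx (hc' b)
  · rintro (x | _ | _)
    · exact .refl _ _
    · exact a1
    · exact a2

theorem bracket_empty : Diagram.empty.bracket = 1 := by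
  classical
  have : IsEmpty Diagram.empty.Crossing := 
    ⟨fun c => by obtain ⟨x, -⟩ := exists_crossingAt _ c; exact x.elim⟩
  have := Fintype.ofIsEmpty (α := Diagram.empty.Crossing)
  have hl : ∀ s, Diagram.empty.loops s = 0 := fun s => by
    have : IsEmpty (Quot fun x y : Empty => y = Diagram.empty.edge x ∨ y = Diagram.empty.partner s x) :=
      ⟨by rintro ⟨x⟩; exact x.elim⟩
    exact Nat.card_of_isEmpty
  rw [bracket_eq_sum]
  simp [hl]

theorem addCircle_isCrossing_inl (D : Diagram H) (x : H) :
    D.addCircle.IsCrossing (.inl x) ↔ D.IsCrossing x := by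
  simp [IsCrossing, addCircle]

theorem addCircle_not_isCrossing_inr (D : Diagram H) (b : Bool) :
    ¬ D.addCircle.IsCrossing (.inr b) := by
  simp [IsCrossing, addCircle]

theorem arcMap_addCircle (D : Diagram H) : ArcMap D D.addCircle Sum.inl where
  edge x := .edge D.addCircle (.inl x)
  arc_rot x hx := .rot (D := D.addCircle) (x := .inl x) (by rwa [addCircle_isCrossing_inl])
  isCrossing x := (D.addCircle_isCrossing_inl x).2
  rot _ _ := rfl
  isOver _ _ := Iff.rfl

theorem bracket_addCircle [Finite H] (D : Diagram H) : D.addCircle.bracket = δ * D.bracket := by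
  have hr : ∀ x, D.addCircle.rot (.inl x) = .inl (D.rot x) := fun _ => rfl
  have hr' : ∀ b, D.addCircle.rot (.inr b) = .inr (!b) := fun _ => rfl
  have he : ∀ x, D.addCircle.edge (.inl x) = .inl (D.edge x) := fun _ => rfl
  have he' : ∀ b, D.addCircle.edge (.inr b) = .inr (!b) := fun _ => rfl
  have hc := D.addCircle_isCrossing_inl
  have hc' := D.addCircle_not_isCrossing_inr
  have hf := D.arcMap_addCircle
  have hbij : Function.Bijective hf.mapCrossing := by
    constructor
    · intro c c' h
      obtain ⟨x, hx, rfl⟩ := D.exists_crossingAt c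
      obtain ⟨y, hy, rfl⟩ := D.exists_crossingAt c'
      rw [hf.mapCrossing_crossingAt, hf.mapCrossing_crossingAt, crossingAt_eq_iff,
        sameVertex_iff] at h
      rw [crossingAt_eq_iff, sameVertex_iff]
      simpa only [hr, Sum.inl.injEq] using h
    · intro c
      obtain ⟨x | b, hx, rfl⟩ := D.addCircle.exists_crossingAt c
      · exact ⟨D.crossingAt x ((hc x).1 hx), rfl⟩
      · exact absurd hx (hc' b)
  have hp : ∀ s x, D.addCircle.partner s (.inl x) = .inl (D.partner (s ∘ hf.mapCrossing) x) := by
    intro s x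
    by_cases hx : D.IsCrossing x
    · exact (hf.partner s hx).symm
    · rw [partner_of_not_isCrossing _ _ hx, partner_of_not_isCrossing _ _ (by rwa [hc]), hr]
  have hp' : ∀ s b, D.addCircle.partner s (.inr b) = .inr (!b) := fun s b => by
    rw [partner_of_not_isCrossing _ _ (hc' b), hr']
  rw [bracket_eq_pow_mul (Equiv.ofBijective _ hbij) 1, pow_one]
  intro s
  unfold loops
  -- The new circle is the additional class `none`.
  rw [← Finite.card_option]
  refine Nat.card_congr
    { toFun := Quot.lift (Sum.elim (fun x => some (Quot.mk _ x)) fun _ => none) ?_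
      invFun := fun o => o.elim (Quot.mk _ (.inr false)) (Quot.lift (fun x => Quot.mk _ (.inl x)) ?_)
      left_inv := ?_
      right_inv := ?_ }
  · rintro x y h
    rcases x with x | b
    · rw [he, hp] at h
      obtain rfl | rfl := h
      · exact congrArg some (Quot.sound (.inl rfl))
      · exact congrArg some (Quot.sound (.inr rfl))
    · rw [he', hp'] at h
      obtain rfl | rfl := h <;> rfl
  · rintro x y (rfl | rfl)
    · exact Quot.sound (.inl rfl)
    · exact Quot.sound (.inr (hp s x).symm)
  · rintro ⟨x | _ | _⟩
    · rfl
    · rfl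
    · exact Quot.sound (.inl rfl)
  · rintro (_ | x)
    · rfl
    · obtain ⟨x, rfl⟩ := Quot.exists_rep x; rfl

/-! ### Smoothing a crossing -/

theorem smooth_rot_of_not_sameVertex (D : Diagram H) {d x : H} (h : ¬ D.SameVertex d x) :
    (D.smooth d).rot x = D.rot x := by
  have := D.smoothRot_cases d x
  rw [sameVertex_iff] at h
  change D.smoothRot d x = _
  tauto

theorem smooth_rot_values (D : Diagram H) {d : H} (h : D.IsCrossing d) :
    (D.smooth d).rot d = D.rot d ∧ (D.smooth d).rot (D.rot d) = d ∧
    (D.smooth d).rot (D.rot (D.rot d)) = D.rot (D.rot (D.rot d)) ∧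
    (D.smooth d).rot (D.rot (D.rot (D.rot d))) = D.rot (D.rot d) := by
  have key := D.smoothRot_cases d
  have h4 := D.rot_four
  have inj := D.rot.injective
  have hn := D.rot_ne
  change D.smoothRot d _ = _ ∧ D.smoothRot d _ = _ ∧ D.smoothRot d _ = _ ∧ D.smoothRot d _ = _
  unfold IsCrossing at h
  grind

theorem smooth_isCrossing_iff (D : Diagram H) {d : H} (h : D.IsCrossing d) (x : H) :
    (D.smooth d).IsCrossing x ↔ D.IsCrossing x ∧ ¬ D.SameVertex d x := by
  obtain ⟨h0, h1, h2, h3⟩ := D.smooth_rot_values h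
  by_cases hx : D.SameVertex d x
  · simp only [hx, not_true, and_false, iff_false, IsCrossing, not_not]
    obtain rfl | rfl | rfl | rfl := D.sameVertex_iff.1 hx
    · rw [h0, h1]
    · rw [h1, h0]
    · rw [h2, h3]
    · rw [h3, h2]
  · have hx' : ¬ D.SameVertex d (D.rot x) := fun h' => hx (Perm.sameCycle_apply_right.1 h')
    simp only [hx, not_false_eq_true, and_true, IsCrossing, D.smooth_rot_of_not_sameVertex hx,
      D.smooth_rot_of_not_sameVertex hx']

theorem smooth_sameVertex_iff (D : Diagram H) {d x : H} (h : ¬ D.SameVertex d x) (y : H) :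
    (D.smooth d).SameVertex x y ↔ D.SameVertex x y := by
  have h' : ∀ x, ¬ D.SameVertex d x → ¬ D.SameVertex d (D.rot x) :=
    fun x hx h' => hx (Perm.sameCycle_apply_right.1 h')
  rw [sameVertex_iff, sameVertex_iff, D.smooth_rot_of_not_sameVertex h,
    D.smooth_rot_of_not_sameVertex (h' _ h), D.smooth_rot_of_not_sameVertex (h' _ (h' _ h))]

theorem Checkerboard.smooth {D : Diagram H} {c : H → Bool} (hc : D.Checkerboard c) (d : H) :
    (D.smooth d).Checkerboard c := by
  refine ⟨hc.1, fun x => ?_⟩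
  change c (D.smoothRot d x) = !c x
  obtain ⟨h, -⟩ | ⟨rfl, h⟩ | ⟨rfl, h⟩ := D.smoothRot_cases d x <;> rw [h] <;> simp [hc.2]

/-- The crossings that remain after a smoothing. -/
noncomputable def smoothCrossingEquiv (D : Diagram H) (d : H) (h : D.IsCrossing d) :
    (D.smooth d).Crossing ≃ {c // c ≠ D.crossingAt d h} :=
  Equiv.ofBijective
    (Quotient.lift (fun x => ⟨D.crossingAt x.1 ((D.smooth_isCrossing_iff h x).1 x.2).1, fun h' =>
      ((D.smooth_isCrossing_iff h x).1 x.2).2 (D.crossingAt_eq_iff.1 h'.symm)⟩) fun x y hxy =>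
        Subtype.ext (D.crossingAt_eq_iff.2
          ((D.smooth_sameVertex_iff ((D.smooth_isCrossing_iff h x).1 x.2).2 y).1 hxy))) <| by
    constructor
    · rintro ⟨x⟩ ⟨y⟩ hxy
      refine (D.smooth d).crossingAt_eq_iff.2 ?_
      rw [D.smooth_sameVertex_iff ((D.smooth_isCrossing_iff h x).1 x.2).2 y]
      exact D.crossingAt_eq_iff.1 (congrArg Subtype.val hxy)
    · rintro ⟨c, hc⟩
      obtain ⟨x, hx, rfl⟩ := D.exists_crossingAt c
      refine ⟨(D.smooth d).crossingAt x ((D.smooth_isCrossing_iff h x).2 ⟨hx, fun h' => ?_⟩), rfl⟩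
      exact hc (D.crossingAt_eq_iff.2 h'.symm)

open Classical in
/-- The state that is `v` at the crossing `c` and `s` at the other crossings. -/
noncomputable def extendState (D : Diagram H) (c : D.Crossing) (v : Bool)
    (s : {c' // c' ≠ c} → Bool) : D.State := fun c' => if h : c' = c then v else s ⟨c', h⟩

open Classical in
-- A state joins `d` to `rot d` exactly if its value at this crossing is `true` for an under-dart
-- `d` and `false` for an over-dart; hence the value `decide (¬ D.isOver d)`.
theorem smooth_partner (D : Diagram H) {d : H} (h : D.IsCrossing d) (s : (D.smooth d).State) (x : H) :
    (D.smooth d).partner s x = D.partner (D.extendState (D.crossingAt d h)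
      (decide (¬ D.isOver d)) (s ∘ (D.smoothCrossingEquiv d h).symm)) x := by
  by_cases hx : (D.smooth d).IsCrossing x
  · have hx' := (D.smooth_isCrossing_iff h x).1 hx
    rw [partner_of_isCrossing _ _ hx, partner_of_isCrossing _ _ hx'.1]
    have hne : D.crossingAt x hx'.1 ≠ D.crossingAt d h := fun h' =>
      hx'.2 (D.crossingAt_eq_iff.1 h'.symm)
    have : D.extendState (D.crossingAt d h)
        (decide (¬ D.isOver d)) (s ∘ (D.smoothCrossingEquiv d h).symm) (D.crossingAt x hx'.1) =
        s ((D.smooth d).crossingAt x hx) := by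
      rw [extendState, dif_neg hne, Function.comp]
      congr 1
      rw [Equiv.symm_apply_eq]
      rfl
    rw [this, rot_inv, rot_inv]
    have h' : ∀ x, ¬ D.SameVertex d x → ¬ D.SameVertex d (D.rot x) :=
      fun x hx h' => hx (Perm.sameCycle_apply_right.1 h')
    rw [D.smooth_rot_of_not_sameVertex hx'.2, D.smooth_rot_of_not_sameVertex (h' _ hx'.2),
      D.smooth_rot_of_not_sameVertex (h' _ (h' _ hx'.2))]
    rfl
  · rw [partner_of_not_isCrossing _ _ hx]
    by_cases hs : D.SameVertex d x
    · have hx' := hs.isCrossing_iff.1 h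
      have hcr : D.crossingAt x hx' = D.crossingAt d h := D.crossingAt_eq_iff.2 hs.symm
      rw [partner_of_isCrossing _ _ hx', hcr, extendState, dif_pos rfl, rot_inv]
      obtain ⟨h0, h1, h2, h3⟩ := D.smooth_rot_values h
      have o1 := D.isOver_rot _ h
      have o2 := D.isOver_rot _ (D.isCrossing_rot.2 h)
      have o3 := D.isOver_rot _ (D.isCrossing_rot.2 (D.isCrossing_rot.2 h))
      have h4 := D.rot_four
      obtain rfl | rfl | rfl | rfl := D.sameVertex_iff.1 hs
      · rw [h0, if_neg]; simp
      · rw [h1, if_pos, h4]; simp; tauto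
      · rw [h2, if_neg]; simp; tauto
      · rw [h3, if_pos, h4]; simp; tauto
    · have : ¬ D.IsCrossing x := fun h' => hx ((D.smooth_isCrossing_iff h x).2 ⟨h', hs⟩)
      rw [partner_of_not_isCrossing _ _ this, D.smooth_rot_of_not_sameVertex hs]

open Classical in
theorem bracket_smooth (D : Diagram H) {d : H} (h : D.IsCrossing d) [Fintype D.Crossing]
    {c : D.Crossing} (hc : c = D.crossingAt d h) :
    (D.smooth d).bracket = ∑ s : {c' // c' ≠ c} → Bool, (∏ c', weight (s c')) *
      δ ^ D.loops (D.extendState c (decide (¬ D.isOver d)) s) := by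
  subst hc
  let e := D.smoothCrossingEquiv d h
  have := Fintype.ofEquiv _ e.symm
  rw [bracket_eq_sum]
  refine Fintype.sum_equiv (e.arrowCongr (Equiv.refl Bool)) _ _ fun s => ?_
  have hs : e.arrowCongr (Equiv.refl Bool) s = s ∘ e.symm := rfl
  rw [hs, ← Equiv.prod_comp e.symm]
  congr 2
  unfold loops
  simp only [D.smooth_partner h]
  rfl

open Classical in
theorem bracket_eq_sum_extendState (D : Diagram H) (c : D.Crossing) [Fintype D.Crossing] :
    D.bracket = ∑ v : Bool, weight v *
      ∑ s : {c' // c' ≠ c} → Bool, (∏ c', weight (s c')) * δ ^ D.loops (D.extendState c v s) := by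
  rw [bracket_eq_sum, ← Equiv.sum_comp (Equiv.funSplitAt c Bool).symm, Fintype.sum_prod_type]
  refine Finset.sum_congr rfl fun v _ => ?_
  rw [Finset.mul_sum]
  refine Finset.sum_congr rfl fun s _ => ?_
  have hs : (Equiv.funSplitAt c Bool).symm (v, s) = D.extendState c v s := by
    ext c'
    simp only [Equiv.funSplitAt, Equiv.piSplitAt, extendState, Equiv.coe_fn_symm_mk]
    split_ifs with h
    · subst h; rfl
    · rfl
  rw [hs, Fintype.prod_eq_mul_prod_subtype_ne _ c, mul_assoc]
  congr 1
  · simp [extendState]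
  · congr 1
    refine Finset.prod_congr rfl fun c' _ => ?_
    simp [extendState, c'.2]

/-- Split the state sum at the crossing of `x`. As `x` is on the overstrand and `rot x` on the
understrand, the value `true` smooths at `rot x` and `false` smooths at `x`. -/
theorem bracket_skein [Finite H] (D : Diagram H) {x : H} (h : D.IsCrossing x) (ho : D.isOver x) :
    D.bracket = α * (D.smooth (D.rot x)).bracket + β * (D.smooth x).bracket := by
  classical
  have := Fintype.ofFinite D.Crossing
  have ho' : ¬ D.isOver (D.rot x) := fun h' => (D.isOver_rot x h).1 h' ho
  rw [D.bracket_eq_sum_extendState (D.crossingAt x h), Fintype.sum_bool, D.bracket_smooth h rfl,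
    D.bracket_smooth (D.isCrossing_rot.2 h) (D.crossingAt_rot h _).symm]
  simp only [ho, ho', not_true, not_false_eq_true, decide_true, decide_false, weight]

/-! ### Exchanging the two smoothings of a crossing -/

/-- This is where the generators of `I` come from: each of them is the expression for exponents 1
and 2 in one of the two orders. Positivity allows the remaining power of `δ` to be factored out. -/
theorem mem_I_of_adjacent {k l : ℕ} (h : k = l + 1 ∨ l = k + 1) (hk : 0 < k) (hl : 0 < l) :
    (α * β - 1) * δ ^ k + (α ^ 2 + β ^ 2 + α * β * δ) * δ ^ l ∈ I := by
  have h1 : p₁ ∈ I := Ideal.subset_span (by simp)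
  have h2 : p₂ ∈ I := Ideal.subset_span (by simp)
  obtain rfl | rfl := h
  · obtain ⟨m, rfl⟩ : ∃ m, l = m + 1 := ⟨l - 1, by omega⟩
    convert I.mul_mem_left (δ ^ m) h1 using 1
    unfold p₁
    ring
  · obtain ⟨m, rfl⟩ : ∃ m, k = m + 1 := ⟨k - 1, by omega⟩
    convert I.mul_mem_left (δ ^ m) h2 using 1
    unfold p₂
    ring

theorem loops_pos [Finite H] (D : Diagram H) (s : D.State) (x : H) : 0 < D.loops s :=
  Nat.card_pos_iff.2 ⟨⟨Quot.mk _ x⟩, inferInstance⟩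

/-- Changing the smoothing exchanges the partners of the opposite darts `d` and `rot² d`, which have
the same colour; so `card_loops_rematch` applies. -/
theorem loops_extendState [Finite H] {D : Diagram H} {c : H → Bool} (hc : D.Checkerboard c) {d : H}
    (h : D.IsCrossing d) (s : {c' // c' ≠ D.crossingAt d h} → Bool) (v : Bool) :
    D.loops (D.extendState (D.crossingAt d h) v s) =
        D.loops (D.extendState (D.crossingAt d h) (!v) s) + 1 ∨
      D.loops (D.extendState (D.crossingAt d h) (!v) s) =
        D.loops (D.extendState (D.crossingAt d h) v s) + 1 := by
  classical
  have hv : ∀ w, D.extendState (D.crossingAt d h) w s (D.crossingAt d h) = w := fun w => dif_pos rfl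
  have h' : D.IsCrossing (D.rot (D.rot d)) := by simpa only [isCrossing_rot] using h
  have hcr : D.crossingAt (D.rot (D.rot d)) h' = D.crossingAt d h :=
    D.crossingAt_eq_iff.2 (D.sameVertex_iff.2 (by simp [D.rot_four]))
  have o1 := D.isOver_rot _ h
  have o2 := D.isOver_rot _ (D.isCrossing_rot.2 h)
  have h4 := D.rot_four
  have hp : ∀ w, D.partner (D.extendState (D.crossingAt d h) w s) d =
      if (w = true ↔ D.isOver d) then D.rot (D.rot (D.rot d)) else D.rot d := fun w => by
    rw [D.partner_of_isCrossing _ h, hv, rot_inv]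
  have hq : ∀ w, D.partner (D.extendState (D.crossingAt d h) w s) (D.rot (D.rot d)) =
      if (w = true ↔ D.isOver d) then D.rot d else D.rot (D.rot (D.rot d)) := fun w => by
    have : D.isOver (D.rot (D.rot d)) ↔ D.isOver d := by tauto
    rw [D.partner_of_isCrossing _ h', hcr, hv, rot_inv, h4, this]
  refine card_loops_rematch D.edge _ _ c D.edge_edge (D.partner_partner _) (D.partner_partner _)
    hc.1 (hc.partner _) (hc.partner _) d (D.rot (D.rot d)) (Ne.symm h) (by simp [hc.2]) ?_ ?_ ?_
  · rw [hp, hq]; cases v <;> simp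
  · rw [hp, hq]; cases v <;> simp
  · intro x e1 e2 e3 e4
    by_cases hx : D.IsCrossing x
    · have hne : D.crossingAt x hx ≠ D.crossingAt d h := by
        rw [ne_eq, crossingAt_eq_iff]
        intro h'
        rw [hp] at e3
        rw [hq] at e4
        have := D.sameVertex_iff.1 (Perm.SameCycle.symm h')
        split_ifs at e3 e4 <;> tauto
      rw [D.partner_of_isCrossing _ hx, D.partner_of_isCrossing _ hx]
      simp only [extendState, dif_neg hne]
    · rw [D.partner_of_not_isCrossing _ hx, D.partner_of_not_isCrossing _ hx]

/-- This holds state by state: for fixed smoothings of the other crossings, the two exponents of `δ`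
are adjacent. -/
theorem smooth_mem_I [Finite H] {D : Diagram H} {c : H → Bool} (hc : D.Checkerboard c) {d : H}
    (h : D.IsCrossing d) : (α * β - 1) * (D.smooth d).bracket +
      (α ^ 2 + β ^ 2 + α * β * δ) * (D.smooth (D.rot d)).bracket ∈ I := by
  classical
  have := Fintype.ofFinite D.Crossing
  have ho := D.isOver_rot d h
  rw [D.bracket_smooth h rfl, D.bracket_smooth (D.isCrossing_rot.2 h) (D.crossingAt_rot h _).symm,
    Finset.mul_sum, Finset.mul_sum, ← Finset.sum_add_distrib]
  refine Ideal.sum_mem _ fun s _ => ?_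
  have hd : decide (¬ D.isOver (D.rot d)) = !decide (¬ D.isOver d) := by simp [ho]
  rw [hd]
  convert I.mul_mem_left (∏ c', weight (s c')) (mem_I_of_adjacent
    (loops_extendState hc h s (decide (¬ D.isOver d))) (D.loops_pos _ d) (D.loops_pos _ d)) using 1
  ring

theorem smooth_rot_rot (D : Diagram H) (d : H) : D.smooth (D.rot (D.rot d)) = D.smooth d := by
  have : D.smoothRot (D.rot (D.rot d)) = D.smoothRot d := by
    classical
    unfold smoothRot
    rw [rot_inv, rot_inv, D.rot_four, swap_comm]
  unfold smooth
  congr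

theorem bracket_skein_of_isCrossing [Finite H] (D : Diagram H) {x : H} (h : D.IsCrossing x)
    [Decidable (D.isOver x)] : D.bracket = weight (decide (D.isOver x)) *
      (D.smooth (D.rot x)).bracket + weight (!decide (D.isOver x)) * (D.smooth x).bracket := by
  by_cases ho : D.isOver x
  · simpa [ho, weight] using D.bracket_skein h ho
  · have := D.bracket_skein (D.isCrossing_rot.2 h) ((D.isOver_rot x h).2 ho)
    rw [smooth_rot_rot] at this
    simpa [ho, weight, add_comm] using this

/-! ### Arcs in smoothings -/

theorem sameVertex_rot_left (D : Diagram H) {x y : H} :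
    D.SameVertex (D.rot x) y ↔ D.SameVertex x y := Perm.sameCycle_apply_left

theorem ArcMap.arc {D : Diagram H} {D' : Diagram H'} {f : H → H'} (hf : ArcMap D D' f) {x y : H}
    (h : D.Arc x y) : D'.Arc (f x) (f y) := by
  refine eqvGen_of_eqvGen f ?_ h
  rintro x y (rfl | ⟨h, rfl⟩)
  · exact hf.edge x
  · exact hf.arc_rot x h

/-- Arcs do not turn at crossings, and smoothing changes `rot` only at one crossing. -/
theorem Arc.smooth {D : Diagram H} {d : H} (hd : D.IsCrossing d) {x y : H} (h : D.Arc x y) :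
    (D.smooth d).Arc x y := by
  refine eqvGen_of_eqvGen id ?_ h
  rintro x y (rfl | ⟨h, rfl⟩)
  · exact Arc.edge (D.smooth d) x
  · have h1 : ¬ D.SameVertex d x := fun h' => h (h'.isCrossing_iff.1 hd)
    have h2 : ¬ (D.smooth d).IsCrossing x := fun h' => h ((D.smooth_isCrossing_iff hd x).1 h').1
    have := Arc.rot h2
    rwa [D.smooth_rot_of_not_sameVertex h1] at this

theorem arc_smooth_pairs (D : Diagram H) {d : H} (hd : D.IsCrossing d) :
    (D.smooth d).Arc d (D.rot d) ∧ (D.smooth d).Arc (D.rot (D.rot d)) (D.rot (D.rot (D.rot d))) := by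
  obtain ⟨h0, h1, h2, h3⟩ := D.smooth_rot_values hd
  have a : ∀ x, D.SameVertex d x → (D.smooth d).Arc x ((D.smooth d).rot x) := fun x hx =>
    .rot fun h' => ((D.smooth_isCrossing_iff hd x).1 h').2 hx
  exact ⟨h0 ▸ a d (D.sameVertex_iff.2 (by simp)), h2 ▸ a _ (D.sameVertex_iff.2 (by simp))⟩

theorem ArcMap.of_smooth {D : Diagram H} {d : H} (hd : D.IsCrossing d) {D' : Diagram H'} {f : H → H'}
    (he : ∀ x, D'.Arc (f x) (f (D.edge x)))
    (hr : ∀ x, ¬ D.IsCrossing x → D'.Arc (f x) (f (D.rot x)))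
    (h1 : D'.Arc (f d) (f (D.rot d)))
    (h2 : D'.Arc (f (D.rot (D.rot d))) (f (D.rot (D.rot (D.rot d)))))
    (hc : ∀ x, D.IsCrossing x → ¬ D.SameVertex d x →
      D'.IsCrossing (f x) ∧ f (D.rot x) = D'.rot (f x) ∧ (D'.isOver (f x) ↔ D.isOver x)) :
    ArcMap (D.smooth d) D' f := by
  have key : ∀ x, (D.smooth d).IsCrossing x →
      D'.IsCrossing (f x) ∧ f ((D.smooth d).rot x) = D'.rot (f x) ∧
        (D'.isOver (f x) ↔ D.isOver x) := fun x hx => by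
    obtain ⟨hx1, hx2⟩ := (D.smooth_isCrossing_iff hd x).1 hx
    rw [D.smooth_rot_of_not_sameVertex hx2]
    exact hc x hx1 hx2
  refine ⟨he, fun x hx => ?_, fun x hx => (key x hx).1, fun x hx => (key x hx).2.1,
    fun x hx => (key x hx).2.2⟩
  by_cases hs : D.SameVertex d x
  · obtain ⟨v0, v1, v2, v3⟩ := D.smooth_rot_values hd
    obtain rfl | rfl | rfl | rfl := D.sameVertex_iff.1 hs
    · rwa [v0]
    · rw [v1]; exact h1.symm
    · rwa [v2]
    · rw [v3]; exact h2.symm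
  · rw [D.smooth_rot_of_not_sameVertex hs]
    exact hr x fun h' => hx ((D.smooth_isCrossing_iff hd x).2 ⟨h', hs⟩)

theorem smooth_isCrossing_of_not_sameVertex (D : Diagram H) {d x : H} (hd : D.IsCrossing d)
    (hx : D.IsCrossing x) (h : ¬ D.SameVertex d x) : (D.smooth d).IsCrossing x :=
  (D.smooth_isCrossing_iff hd x).2 ⟨hx, h⟩

theorem smooth_rot_of_ne {D : Diagram H} {d e : H} (hde : ¬ D.SameVertex d e) :
     (D.smooth d).rot e = D.rot e ∧
    (D.smooth d).rot (D.rot e) = D.rot (D.rot e) ∧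
    (D.smooth d).rot (D.rot (D.rot e)) = D.rot (D.rot (D.rot e)) := by
  have h' : ∀ x, ¬ D.SameVertex d x → ¬ D.SameVertex d (D.rot x) :=
    fun x hx h' => hx (Perm.sameCycle_apply_right.1 h')
  exact ⟨D.smooth_rot_of_not_sameVertex hde, D.smooth_rot_of_not_sameVertex (h' _ hde),
    D.smooth_rot_of_not_sameVertex (h' _ (h' _ hde))⟩

theorem arc_smooth_smooth_pairs {D : Diagram H} {d e : H} (hd : D.IsCrossing d)
    (he : D.IsCrossing e) (hde : ¬ D.SameVertex d e) :
     ((D.smooth d).smooth e).Arc d (D.rot d) ∧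
    ((D.smooth d).smooth e).Arc (D.rot (D.rot d)) (D.rot (D.rot (D.rot d))) ∧
    ((D.smooth d).smooth e).Arc e (D.rot e) ∧
    ((D.smooth d).smooth e).Arc (D.rot (D.rot e)) (D.rot (D.rot (D.rot e))) := by
  have he' := D.smooth_isCrossing_of_not_sameVertex hd he hde
  obtain ⟨h1, h2⟩ := D.arc_smooth_pairs hd
  obtain ⟨h3, h4⟩ := (D.smooth d).arc_smooth_pairs he'
  obtain ⟨r1, r2, r3⟩ := smooth_rot_of_ne hde
  rw [r1] at h3 h4
  rw [r2, r3] at h4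
  exact ⟨h1.smooth he', h2.smooth he', h3, h4⟩

theorem Arc.smooth_smooth {D : Diagram H} {d e : H} (hd : D.IsCrossing d)
    (he : D.IsCrossing e) (hde : ¬ D.SameVertex d e)
    {x y : H} (h : D.Arc x y) : ((D.smooth d).smooth e).Arc x y :=
  (h.smooth hd).smooth (D.smooth_isCrossing_of_not_sameVertex hd he hde)

theorem smooth_smooth_of_isCrossing {D : Diagram H} {d e : H} (hd : D.IsCrossing d)
    (he : D.IsCrossing e) (hde : ¬ D.SameVertex d e)
    {x : H} (hx : D.IsCrossing x) (h1 : ¬ D.SameVertex d x)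
    (h2 : ¬ D.SameVertex e x) : ((D.smooth d).smooth e).IsCrossing x ∧
      ((D.smooth d).smooth e).rot x = D.rot x := by
  have he' := D.smooth_isCrossing_of_not_sameVertex hd he hde
  have h2' : ¬ (D.smooth d).SameVertex e x := by rwa [D.smooth_sameVertex_iff hde]
  refine ⟨smooth_isCrossing_of_not_sameVertex _ he'
    (D.smooth_isCrossing_of_not_sameVertex hd hx h1) h2', ?_⟩
  rw [smooth_rot_of_not_sameVertex _ h2', smooth_rot_of_not_sameVertex _ h1]

theorem smooth_smooth_isCrossing_iff {D : Diagram H} {d e : H} (hd : D.IsCrossing d)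
    (he : D.IsCrossing e) (hde : ¬ D.SameVertex d e)
    (x : H) : ((D.smooth d).smooth e).IsCrossing x ↔
    D.IsCrossing x ∧ ¬ D.SameVertex d x ∧ ¬ D.SameVertex e x := by
  rw [smooth_isCrossing_iff _ (D.smooth_isCrossing_of_not_sameVertex hd he hde),
    D.smooth_isCrossing_iff hd, D.smooth_sameVertex_iff hde, and_assoc]

theorem ArcMap.of_smooth_smooth {D : Diagram H} {d e : H} (hd : D.IsCrossing d)
    (he : D.IsCrossing e) (hde : ¬ D.SameVertex d e)
    {D' : Diagram H'} {f : H → H'}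
    (hE : ∀ x, D'.Arc (f x) (f (D.edge x)))
    (hr : ∀ x, ¬ D.IsCrossing x → D'.Arc (f x) (f (D.rot x)))
    (h1 : D'.Arc (f d) (f (D.rot d)))
    (h2 : D'.Arc (f (D.rot (D.rot d))) (f (D.rot (D.rot (D.rot d)))))
    (h3 : D'.Arc (f e) (f (D.rot e)))
    (h4 : D'.Arc (f (D.rot (D.rot e))) (f (D.rot (D.rot (D.rot e)))))
    (hc : ∀ x, D.IsCrossing x → ¬ D.SameVertex d x → ¬ D.SameVertex e x →
      D'.IsCrossing (f x) ∧ f (D.rot x) = D'.rot (f x) ∧ (D'.isOver (f x) ↔ D.isOver x)) :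
    ArcMap ((D.smooth d).smooth e) D' f := by
  have he' := D.smooth_isCrossing_of_not_sameVertex hd he hde
  obtain ⟨r1, r2, r3⟩ := smooth_rot_of_ne hde
  refine .of_smooth he' hE (fun x hx => ?_) (by rwa [r1]) (by rwa [r1, r2, r3]) fun x hx hs => ?_
  · by_cases hs : D.SameVertex d x
    · obtain ⟨v0, v1, v2, v3⟩ := D.smooth_rot_values hd
      obtain rfl | rfl | rfl | rfl := D.sameVertex_iff.1 hs
      · rwa [v0]
      · rw [v1]; exact h1.symm
      · rwa [v2]
      · rw [v3]; exact h2.symm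
    · rw [D.smooth_rot_of_not_sameVertex hs]
      exact hr x fun h' => hx ((D.smooth_isCrossing_iff hd x).2 ⟨h', hs⟩)
  · obtain ⟨hx1, hx2⟩ := (D.smooth_isCrossing_iff hd x).1 hx
    rw [D.smooth_sameVertex_iff hde] at hs
    rw [D.smooth_rot_of_not_sameVertex hx2]
    exact hc x hx1 hx2 hs

/-! ### Bigons -/

/-- The crossings at `a` and `b` are corners of a bigon with sides that run from `a` to `b` and from
`rot a` to `rot³ b`, perhaps through marked points; `S` is the set of darts on these sides. One
strand is over the other at both corners. -/
structure Bigon (D : Diagram H) (a b : H) (S : H → Prop) : Prop where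
  left : D.IsCrossing a
  right : D.IsCrossing b
  ne : ¬ D.SameVertex b a
  isOver : D.isOver a ↔ D.isOver b
  edge : ∀ x, S (D.edge x) ↔ S x
  rot : ∀ x, ¬ D.IsCrossing x → (S (D.rot x) ↔ S x)
  mem_iff : ∀ x, D.IsCrossing x → (S x ↔ x = a ∨ x = D.rot a ∨ x = b ∨ x = D.rot (D.rot (D.rot b)))
  arc : ∀ x, S x → D.Arc x a ∨ D.Arc x (D.rot a)
  arc_left : D.Arc a b
  arc_right : D.Arc (D.rot a) (D.rot (D.rot (D.rot b)))

open Classical in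
/-- The map that sends all of `S` to `t`, and fixes the other elements. -/
noncomputable def collapse (S : H → Prop) (t : H) (x : H) : H := if S x then t else x

theorem collapse_pos {S : H → Prop} {t x : H} (h : S x) : collapse S t x = t := if_pos h

theorem collapse_neg {S : H → Prop} {t x : H} (h : ¬ S x) : collapse S t x = x := if_neg h

namespace Bigon

variable {D : Diagram H} {a b : H} {S : H → Prop}

theorem mem (hB : D.Bigon a b S) : S a ∧ S (D.rot a) ∧ S b ∧ S (D.rot (D.rot (D.rot b))) := by
  have := hB.left
  have := hB.right
  refine ⟨(hB.mem_iff _ ?_).2 ?_, (hB.mem_iff _ ?_).2 ?_, (hB.mem_iff _ ?_).2 ?_,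
    (hB.mem_iff _ ?_).2 ?_⟩ <;> simp [isCrossing_rot, *]

theorem not_mem (hB : D.Bigon a b S) : ¬ S (D.rot (D.rot a)) ∧ ¬ S (D.rot (D.rot (D.rot a))) ∧
    ¬ S (D.rot b) ∧ ¬ S (D.rot (D.rot b)) := by
  have h1 := hB.left
  have h2 := hB.right
  have h3 := hB.ne
  rw [sameVertex_iff] at h3
  have hr := fun x => D.isCrossing_rot (x := x)
  have h4 := D.rot_four
  have hn := D.rot_ne
  have hinj := D.rot.injective
  have hm := hB.mem_iff
  rw [hm _ (by simp [hr, h1]), hm _ (by simp [hr, h1]), hm _ (by simp [hr, h2]),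
    hm _ (by simp [hr, h2])]
  unfold IsCrossing at h1 h2
  grind

theorem not_mem_of_not_sameVertex (hB : D.Bigon a b S) {x : H} (hx : D.IsCrossing x)
    (h1 : ¬ D.SameVertex b x) (h2 : ¬ D.SameVertex a x) : ¬ S x := by
  rw [sameVertex_iff] at h1 h2
  rw [hB.mem_iff x hx]
  tauto

/-- When the sides of the bigon shrink to one dart `t`, all steps along them become trivial and all
steps away from them are unchanged. Only the joins made by the smoothings at the two corners remain
to be checked. -/
theorem arcMap_collapse (hB : D.Bigon a b S) {d e d' e' : H} (hd : D.SameVertex b d)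
    (he : D.SameVertex a e) (hd' : D.SameVertex b d') (he' : D.SameVertex a e') (t : H)
    (h1 : ((D.smooth d').smooth e').Arc (collapse S t d) (collapse S t (D.rot d)))
    (h2 : ((D.smooth d').smooth e').Arc (collapse S t (D.rot (D.rot d)))
      (collapse S t (D.rot (D.rot (D.rot d)))))
    (h3 : ((D.smooth d').smooth e').Arc (collapse S t e) (collapse S t (D.rot e)))
    (h4 : ((D.smooth d').smooth e').Arc (collapse S t (D.rot (D.rot e)))
      (collapse S t (D.rot (D.rot (D.rot e))))) :
    ArcMap ((D.smooth d).smooth e) ((D.smooth d').smooth e') (collapse S t) := by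
  have hne : ∀ d e, D.SameVertex b d → D.SameVertex a e → ¬ D.SameVertex d e :=
    fun d e hd he h => hB.ne ((hd.trans h).trans he.symm)
  have cd := hd.isCrossing_iff.1 hB.right
  have ce := he.isCrossing_iff.1 hB.left
  have cd' := hd'.isCrossing_iff.1 hB.right
  have ce' := he'.isCrossing_iff.1 hB.left
  have hde := hne d e hd he
  have hde' := hne d' e' hd' he'
  refine .of_smooth_smooth cd ce hde (fun x => ?_) (fun x hx => ?_) h1 h2 h3 h4 fun x hx x1 x2 => ?_
  · by_cases hx : S x
    · rw [collapse_pos hx, collapse_pos ((hB.edge x).2 hx)]; exact .refl _ _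
    · rw [collapse_neg hx, collapse_neg ((hB.edge x).not.2 hx)]
      exact (Arc.edge D x).smooth_smooth cd' ce' hde'
  · by_cases hs : S x
    · rw [collapse_pos hs, collapse_pos ((hB.rot x hx).2 hs)]; exact .refl _ _
    · rw [collapse_neg hs, collapse_neg ((hB.rot x hx).not.2 hs)]
      exact (Arc.rot hx).smooth_smooth cd' ce' hde'
  · have y1 : ¬ D.SameVertex b x := fun h => x1 (hd.symm.trans h)
    have y2 : ¬ D.SameVertex a x := fun h => x2 (he.symm.trans h)
    have n1 : ¬ D.SameVertex d' x := fun h => y1 (hd'.trans h)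
    have n2 : ¬ D.SameVertex e' x := fun h => y2 (he'.trans h)
    have s1 := hB.not_mem_of_not_sameVertex hx y1 y2
    have s2 := hB.not_mem_of_not_sameVertex (D.isCrossing_rot.2 hx)
      (fun h => y1 (Perm.sameCycle_apply_right.1 h)) fun h => y2 (Perm.sameCycle_apply_right.1 h)
    obtain ⟨k1, k2⟩ := smooth_smooth_of_isCrossing cd' ce' hde' hx n1 n2
    rw [collapse_neg s1, collapse_neg s2]
    exact ⟨k1, k2.symm, Iff.rfl⟩

theorem not_mem_of_smooth_smooth (hB : D.Bigon a b S) {d e : H} (hd : D.SameVertex b d)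
    (he : D.SameVertex a e) {x : H} (hx : ((D.smooth d).smooth e).IsCrossing x) : ¬ S x := by
  rw [smooth_smooth_isCrossing_iff (hd.isCrossing_iff.1 hB.right) (he.isCrossing_iff.1 hB.left)
    fun h => hB.ne ((hd.trans h).trans he.symm)] at hx
  exact hB.not_mem_of_not_sameVertex hx.1 (fun h => hx.2.1 (hd.symm.trans h))
    fun h => hx.2.2 (he.symm.trans h)

/-- In both diagrams the outer ends `rot b`, `rot² b` are joined, and so are `rot² a`, `rot³ a`. The
sides of the bigon are part of the first arc in one diagram and of the second in the other. -/
theorem bracket_smooth_smooth_eq [Finite H] (hB : D.Bigon a b S) :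
    ((D.smooth b).smooth a).bracket = ((D.smooth (D.rot b)).smooth (D.rot a)).bracket := by
  obtain ⟨m1, m2, m3, m4⟩ := hB.mem
  obtain ⟨n1, n2, n3, n4⟩ := hB.not_mem
  have vb : D.SameVertex b b := Perm.SameCycle.refl _ _
  have va : D.SameVertex a a := Perm.SameCycle.refl _ _
  have vb' : D.SameVertex b (D.rot b) := D.sameVertex_iff.2 (by simp)
  have va' : D.SameVertex a (D.rot a) := D.sameVertex_iff.2 (by simp)
  have ca' := D.isCrossing_rot.2 hB.left
  have cb' := D.isCrossing_rot.2 hB.right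
  have hne' : ¬ D.SameVertex (D.rot b) (D.rot a) := fun h => hB.ne ((vb'.trans h).trans va'.symm)
  obtain ⟨p1, p2, p3, p4⟩ := arc_smooth_smooth_pairs hB.right hB.left hB.ne
  obtain ⟨q1, q2, q3, q4⟩ := arc_smooth_smooth_pairs cb' ca' hne'
  rw [D.rot_four] at q2 q4
  have pl := hB.arc_left.smooth_smooth hB.right hB.left hB.ne
  have pr := hB.arc_right.smooth_smooth hB.right hB.left hB.ne
  have ql := hB.arc_left.smooth_smooth cb' ca' hne'
  have qr := hB.arc_right.smooth_smooth cb' ca' hne'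
  -- Each map sends the sides to an end of the arc to which they belong in its source.
  refine bracket_eq_of_arcMap (f := collapse S (D.rot b)) (g := collapse S (D.rot (D.rot a)))
    (hB.arcMap_collapse vb va vb' va' _ ?_ ?_ ?_ ?_) (hB.arcMap_collapse vb' va' vb va _ ?_ ?_ ?_ ?_)
    ?_ ?_ ?_ ?_
  · rw [collapse_pos m3, collapse_neg n3]; exact .refl _ _
  · rw [collapse_neg n4, collapse_pos m4]; exact q1.symm
  · rw [collapse_pos m1, collapse_pos m2]; exact .refl _ _
  · rw [collapse_neg n1, collapse_neg n2]
    exact q3.symm.trans (qr.trans (q2.trans (ql.symm.trans q4.symm)))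
  · rw [collapse_neg n3, collapse_neg n4]
    exact p1.symm.trans (pl.symm.trans (p3.trans (pr.trans p2.symm)))
  · rw [D.rot_four, collapse_pos m3, collapse_pos m4]; exact .refl _ _
  · rw [collapse_pos m2, collapse_neg n1]; exact .refl _ _
  · rw [D.rot_four, collapse_pos m1, collapse_neg n2]; exact p4.symm
  · intro x hx
    have := hB.not_mem_of_smooth_smooth vb va hx
    rw [collapse_neg this, collapse_neg this]
  · intro x hx
    have := hB.not_mem_of_smooth_smooth vb' va' hx
    rw [collapse_neg this, collapse_neg this]
  · intro x
    by_cases hx : S x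
    · rw [collapse_pos hx, collapse_neg n3]
      have key := p1.symm.trans pl.symm
      obtain h | h := hB.arc x hx
      · exact key.trans (h.smooth_smooth hB.right hB.left hB.ne).symm
      · exact (key.trans p3).trans (h.smooth_smooth hB.right hB.left hB.ne).symm
    · rw [collapse_neg hx, collapse_neg hx]; exact .refl _ _
  · intro x
    by_cases hx : S x
    · rw [collapse_pos hx, collapse_neg n1]
      obtain h | h := hB.arc x hx
      · exact (((q3.symm.trans qr).trans q2).trans ql.symm).trans
          (h.smooth_smooth cb' ca' hne').symm
      · exact q3.symm.trans (h.smooth_smooth cb' ca' hne').symm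
    · rw [collapse_neg hx, collapse_neg hx]; exact .refl _ _

/-- Here the bigon is closed off at both corners: its sides form a separate circle, and the outer
ends are joined as in the diagram on the right. -/
theorem bracket_smooth_smooth_eq_mul [Finite H] (hB : D.Bigon a b S) :
    ((D.smooth (D.rot b)).smooth a).bracket = δ * ((D.smooth b).smooth a).bracket := by
  classical
  obtain ⟨m1, m2, m3, m4⟩ := hB.mem
  obtain ⟨n1, n2, n3, n4⟩ := hB.not_mem
  have vb : D.SameVertex b b := Perm.SameCycle.refl _ _
  have va : D.SameVertex a a := Perm.SameCycle.refl _ _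
  have vb' : D.SameVertex b (D.rot b) := D.sameVertex_iff.2 (by simp)
  have cb' := D.isCrossing_rot.2 hB.right
  have hne' : ¬ D.SameVertex (D.rot b) a := fun h => hB.ne (vb'.trans h)
  obtain ⟨p1, p2, p3, p4⟩ := arc_smooth_smooth_pairs hB.right hB.left hB.ne
  obtain ⟨q1, q2, q3, q4⟩ := arc_smooth_smooth_pairs cb' hB.left hne'
  rw [D.rot_four] at q2
  have pl := hB.arc_left.smooth_smooth hB.right hB.left hB.ne
  have pr := hB.arc_right.smooth_smooth hB.right hB.left hB.ne
  have ql := hB.arc_left.smooth_smooth cb' hB.left hne'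
  have qr := hB.arc_right.smooth_smooth cb' hB.left hne'
  set E := (D.smooth b).smooth a with hE
  set E' := (D.smooth (D.rot b)).smooth a with hE'
  have up : ∀ {x y}, E.Arc x y → E.addCircle.Arc (.inl x) (.inl y) := fun h => E.arcMap_addCircle.arc h
  -- The sides go to the added circle; the inverse map returns this circle to the dart `a` on the
  -- sides.
  let f : H → H ⊕ Bool := fun x => if S x then .inr false else .inl x
  have fpos : ∀ {x}, S x → f x = .inr false := fun h => if_pos h
  have fneg : ∀ {x}, ¬ S x → f x = .inl x := fun h => if_neg h
  have hg := hB.arcMap_collapse vb va vb' va (D.rot b)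
    (by rw [collapse_pos m3, collapse_neg n3]; exact .refl _ _)
    (by rw [collapse_neg n4, collapse_pos m4]; exact q1.symm)
    (by rw [collapse_pos m1, collapse_pos m2]; exact .refl _ _)
    (by rw [collapse_neg n1, collapse_neg n2]; exact q4)
  rw [← bracket_addCircle]
  refine bracket_eq_of_arcMap (f := f) (g := Sum.elim (collapse S (D.rot b)) fun _ => a)
    (.of_smooth_smooth cb' hB.left hne' (fun x => ?_) (fun x hx => ?_) ?_ ?_ ?_ ?_
      fun x hx x1 x2 => ?_)
    ⟨?_, ?_, ?_, ?_, ?_⟩ ?_ ?_ ?_ ?_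
  · by_cases hx : S x
    · rw [fpos hx, fpos ((hB.edge x).2 hx)]; exact .refl _ _
    · rw [fneg hx, fneg ((hB.edge x).not.2 hx)]
      exact up ((Arc.edge D x).smooth_smooth hB.right hB.left hB.ne)
  · by_cases hs : S x
    · rw [fpos hs, fpos ((hB.rot x hx).2 hs)]; exact .refl _ _
    · rw [fneg hs, fneg ((hB.rot x hx).not.2 hs)]
      exact up ((Arc.rot hx).smooth_smooth hB.right hB.left hB.ne)
  · rw [fneg n3, fneg n4]
    exact up (p1.symm.trans (pl.symm.trans (p3.trans (pr.trans p2.symm))))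
  · rw [D.rot_four, fpos m3, fpos m4]; exact .refl _ _
  · rw [fpos m1, fpos m2]; exact .refl _ _
  · rw [fneg n1, fneg n2]; exact up p4
  · have y1 : ¬ D.SameVertex b x := fun h => x1 (vb'.symm.trans h)
    have s1 := hB.not_mem_of_not_sameVertex hx y1 x2
    have s2 := hB.not_mem_of_not_sameVertex (D.isCrossing_rot.2 hx)
      (fun h => y1 (Perm.sameCycle_apply_right.1 h)) fun h => x2 (Perm.sameCycle_apply_right.1 h)
    obtain ⟨k1, k2⟩ := smooth_smooth_of_isCrossing hB.right hB.left hB.ne hx y1 x2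
    rw [fneg s1, fneg s2]
    exact ⟨(addCircle_isCrossing_inl _ _).2 k1, congrArg Sum.inl k2.symm, Iff.rfl⟩
  · rintro (x | c)
    · exact hg.edge x
    · exact .refl _ _
  · rintro (x | c) hx
    · exact hg.arc_rot x ((addCircle_isCrossing_inl _ _).not.1 hx)
    · exact .refl _ _
  · rintro (x | c) hx
    · exact hg.isCrossing x ((addCircle_isCrossing_inl _ _).1 hx)
    · exact absurd hx (addCircle_not_isCrossing_inr _ _)
  · rintro (x | c) hx
    · exact hg.rot x ((addCircle_isCrossing_inl _ _).1 hx)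
    · exact absurd hx (addCircle_not_isCrossing_inr _ _)
  · rintro (x | c) hx
    · exact hg.isOver x ((addCircle_isCrossing_inl _ _).1 hx)
    · exact absurd hx (addCircle_not_isCrossing_inr _ _)
  · intro x hx
    have := hB.not_mem_of_smooth_smooth vb' va hx
    rw [fneg this, Sum.elim_inl, collapse_neg this]
  · rintro (x | c) hx
    · have := hB.not_mem_of_smooth_smooth vb va ((addCircle_isCrossing_inl _ _).1 hx)
      rw [Sum.elim_inl, collapse_neg this, fneg this]
    · exact absurd hx (addCircle_not_isCrossing_inr _ _)
  · intro x
    by_cases hx : S x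
    · rw [fpos hx, Sum.elim_inr]
      obtain h | h := hB.arc x hx
      · exact (h.smooth_smooth cb' hB.left hne').symm
      · exact q3.trans (h.smooth_smooth cb' hB.left hne').symm
    · rw [fneg hx, Sum.elim_inl, collapse_neg hx]; exact .refl _ _
  · rintro (x | c)
    · rw [Sum.elim_inl]
      by_cases hx : S x
      · rw [collapse_pos hx, fneg n3]
        have key := p1.symm.trans pl.symm
        obtain h | h := hB.arc x hx
        · exact up (key.trans (h.smooth_smooth hB.right hB.left hB.ne).symm)
        · exact up ((key.trans p3).trans (h.smooth_smooth hB.right hB.left hB.ne).symm)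
      · rw [collapse_neg hx, fneg hx]; exact .refl _ _
    · rw [Sum.elim_inr, fpos m1]
      cases c
      · exact .refl _ _
      · exact .edge E.addCircle (.inr false)

/-- Removing a bigon does not change the bracket modulo `I`. -/
theorem bracket_sub_mem [Finite H] (hB : D.Bigon a b S) {c : H → Bool} (hc : D.Checkerboard c) :
    D.bracket - ((D.smooth b).smooth (D.rot a)).bracket ∈ I := by
  classical
  have hr := D.smooth_rot_of_not_sameVertex hB.ne
  have hcr := D.smooth_isCrossing_of_not_sameVertex hB.right hB.left hB.ne
  have vb' : D.SameVertex b (D.rot b) := D.sameVertex_iff.2 (by simp)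
  have hne' : ¬ D.SameVertex (D.rot b) a := fun h => hB.ne (vb'.trans h)
  have hr' := D.smooth_rot_of_not_sameVertex hne'
  have hcr' := D.smooth_isCrossing_of_not_sameVertex (D.isCrossing_rot.2 hB.right) hB.left hne'
  -- After the smoothing at `b`, the two smoothings at `a` give the diagrams with strands passing
  -- through and with strands turning back.
  have key := smooth_mem_I (hc.smooth b) ((D.smooth b).isCrossing_rot.2 hcr)
  rw [smooth_rot_rot, hr] at key
  have e0 := D.bracket_skein_of_isCrossing hB.right
  have e1 := (D.smooth b).bracket_skein_of_isCrossing hcr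
  have e2 := (D.smooth (D.rot b)).bracket_skein_of_isCrossing hcr'
  rw [hr] at e1
  rw [hr', hB.bracket_smooth_smooth_eq_mul, ← hB.bracket_smooth_smooth_eq] at e2
  have o1 : (D.smooth b).isOver a ↔ D.isOver b := hB.isOver
  have o2 : (D.smooth (D.rot b)).isOver a ↔ D.isOver b := hB.isOver
  -- The strands passing through get the coefficient `α β`; the diagram with turned strands gets `α²
  -- + β² + α β δ`, because the same strand is over at both corners.
  rw [e0, e1, e2]
  simp only [o1, o2]
  convert key using 1
  by_cases ho : D.isOver b
  · simp only [ho, decide_true, Bool.not_true, weight]; ring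
  · simp only [ho, decide_false, Bool.not_false, weight]; ring

end Bigon

/-! ### Move II -/

/-- The two edges of the face are the sides of a bigon without marked points. It remains to see that
`D'` is isotopic to the smoothing in which the strands pass through: both join `rot² a` to `rot² b`
and `rot³ a` to `rot b`. -/
theorem MoveII.bracket_sub_mem [Finite H] {D D' : Diagram H} (h : D.MoveII D') {c : H → Bool}
    (hc : D.Checkerboard c) : D.bracket - D'.bracket ∈ I := by
  classical
  obtain ⟨a, b, ha, hb, hab, e1, e2, ho, hE, hO, hR, hR'⟩ := h
  rw [rot_inv] at e2
  have hr := fun x => D.isCrossing_rot (x := x)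
  have h4 := D.rot_four
  have hn := D.rot_ne
  have hinj := D.rot.injective
  have hee := D.edge_edge
  have hne : ¬ D.SameVertex b a := fun h => hab h.symm
  let S : H → Prop := fun x => x = a ∨ x = b ∨ x = D.rot a ∨ x = D.rot (D.rot (D.rot b))
  have hB : D.Bigon a b S :=
    { left := ha
      right := hb
      ne := hne
      isOver := ho
      edge := fun x => by grind
      rot := fun x hx => by
        have n1 : ∀ y, D.IsCrossing y → x ≠ y ∧ D.rot x ≠ y := fun y hy =>
          ⟨fun h => hx (h ▸ hy), fun h => hx (by rwa [← hr, h])⟩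
        have := n1 a ha
        have := n1 b hb
        have := n1 (D.rot a) (by simpa [hr])
        have := n1 (D.rot (D.rot (D.rot b))) (by simpa [hr])
        simp only [S]
        tauto
      mem_iff := fun x hx => by simp only [S]; tauto
      arc := by
        rintro x (rfl | rfl | rfl | rfl)
        · exact .inl (.refl _ _)
        · exact .inl (e1 ▸ Arc.edge D a).symm
        · exact .inr (.refl _ _)
        · exact .inr (e2 ▸ Arc.edge D _).symm
      arc_left := e1 ▸ Arc.edge D a
      arc_right := e2 ▸ Arc.edge D _ }
  obtain ⟨n1, n2, n3, n4⟩ := hB.not_mem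
  convert hB.bracket_sub_mem hc using 2
  have va' : D.SameVertex a (D.rot a) := D.sameVertex_iff.2 (by simp)
  have ca' := D.isCrossing_rot.2 ha
  have hne' : ¬ D.SameVertex b (D.rot a) := fun h => hne (h.trans va'.symm)
  obtain ⟨q1, q2, q3, q4⟩ := arc_smooth_smooth_pairs hb ca' hne'
  have ql := hB.arc_left.smooth_smooth hb ca' hne'
  have qr := hB.arc_right.smooth_smooth hb ca' hne'
  have ciff := smooth_smooth_isCrossing_iff hb ca' hne'
  set E := (D.smooth b).smooth (D.rot a) with hEdef
  have svr : ∀ z x, D.SameVertex z (D.rot x) ↔ D.SameVertex z x := fun z x =>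
    Perm.sameCycle_apply_right
  have cD' : ∀ x, D'.IsCrossing x ↔ D.IsCrossing x ∧ ¬ D.SameVertex a x ∧ ¬ D.SameVertex b x := by
    intro x
    by_cases hx : D.SameVertex a x ∨ D.SameVertex b x
    · have : ¬ D'.IsCrossing x := by
        unfold IsCrossing
        rw [hR x hx, hR _ (by simpa only [svr] using hx), h4]
        simp
      tauto
    · have : D'.IsCrossing x ↔ D.IsCrossing x := by
        unfold IsCrossing
        rw [hR' x hx, hR' _ (by simpa only [svr] using hx)]
      tauto
  have notS : ∀ x, (D.IsCrossing x → ¬ D.SameVertex a x ∧ ¬ D.SameVertex b x) → ¬ S x := by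
    rintro x hx (rfl | rfl | rfl | rfl)
    · exact (hx ha).1 (Perm.SameCycle.refl _ _)
    · exact (hx hb).2 (Perm.SameCycle.refl _ _)
    · exact (hx ca').1 va'
    · exact (hx (by simpa [hr])).2 (D.sameVertex_iff.2 (by simp))
  have pE : ∀ x, D'.Arc x (D.edge x) := fun x => hE ▸ Arc.edge D' x
  have pR : ∀ x, D.SameVertex a x ∨ D.SameVertex b x → D'.Arc x (D.rot (D.rot x)) := fun x hx => by
    rw [← hR x hx]
    exact .rot fun h => by rw [cD'] at h; tauto
  have p0 := pR a (.inl (Perm.SameCycle.refl _ _))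
  have p1 := pR (D.rot a) (.inl va')
  have p2 := pR b (.inr (Perm.SameCycle.refl _ _))
  have p3 := pR (D.rot b) (.inr (D.sameVertex_iff.2 (by simp)))
  have pl : D'.Arc a b := e1 ▸ pE a
  have pr : D'.Arc (D.rot a) (D.rot (D.rot (D.rot b))) := e2 ▸ pE _
  rw [h4] at q4
  -- the strands of the bigon are attached to `u` and `v`
  let f : H → H → H → H := fun u v x =>
    if x = a ∨ x = b then u else if x = D.rot a ∨ x = D.rot (D.rot (D.rot b)) then v else x
  have f1 : ∀ u v, f u v a = u := fun u v => if_pos (.inl rfl)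
  have f2 : ∀ u v, f u v b = u := fun u v => if_pos (.inr rfl)
  have f3 : ∀ u v, f u v (D.rot a) = v := fun u v => by
    have : D.rot a ≠ b := fun h => hab (h ▸ va')
    simp [f, hn, this]
  have f4 : ∀ u v, f u v (D.rot (D.rot (D.rot b))) = v := fun u v => by
    have h1 : D.rot (D.rot (D.rot b)) ≠ a := fun h => hne (D.sameVertex_iff.2 (by simp [h]))
    have h2 : D.rot (D.rot (D.rot b)) ≠ b := fun h => hn b (by have := h4 b; rwa [h] at this)
    simp [f, h1, h2]
  have f0 : ∀ u v x, ¬ S x → f u v x = x := fun u v x hx => by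
    have h1 : ¬ (x = a ∨ x = b) := fun h => hx (by simp only [S]; tauto)
    have h2 : ¬ (x = D.rot a ∨ x = D.rot (D.rot (D.rot b))) := fun h => hx (by simp only [S]; tauto)
    exact (if_neg h1).trans (if_neg h2)
  have hfix : ∀ u v x, (D.IsCrossing x ∧ ¬ D.SameVertex a x ∧ ¬ D.SameVertex b x) →
      f u v x = x ∧ f u v (D.rot x) = D.rot x := fun u v x hx =>
    ⟨f0 _ _ _ (notS x fun _ => hx.2), f0 _ _ _ (notS _ fun _ => by simpa only [svr] using hx.2)⟩
  have hedge : ∀ {G : Diagram H} (_ : ∀ x, G.Arc x (D.edge x)) (u v x : H),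
      G.Arc (f u v x) (f u v (D.edge x)) := by
    intro G hG u v x
    by_cases hx : S x
    · obtain rfl | rfl | rfl | rfl := hx
      · rw [e1, f1, f2]; exact .refl _ _
      · rw [← e1, hee, f1, e1, f2]; exact .refl _ _
      · rw [e2, f3, f4]; exact .refl _ _
      · rw [← e2, hee, f3, e2, f4]; exact .refl _ _
    · rw [f0 _ _ x hx, f0 _ _ _ ((hB.edge x).not.2 hx)]; exact hG x
  -- In `D'` the side through `a` continues to `rot² a` and the other one to `rot³ a`. In `E` it is
  -- the other way round, so the map back has the two attaching darts exchanged.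
  have hD'E : ArcMap D' E (f (D.rot (D.rot a)) (D.rot (D.rot (D.rot a)))) := by
    have cE : ∀ x, D'.IsCrossing x → D.IsCrossing x ∧ ¬ D.SameVertex a x ∧ ¬ D.SameVertex b x :=
      fun x => (cD' x).1
    have k : ∀ x, D'.IsCrossing x → E.IsCrossing x ∧ E.rot x = D.rot x := fun x hx => by
      obtain ⟨k1, k2, k3⟩ := cE x hx
      exact smooth_smooth_of_isCrossing hb ca' hne' k1 k3 (by rwa [sameVertex_rot_left])
    refine ⟨fun x => ?_, fun x hx => ?_, fun x hx => ?_, fun x hx => ?_, fun x hx => ?_⟩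
    · rw [hE]; exact hedge (fun x => Arc.edge E x) _ _ x
    · by_cases hs : D.SameVertex a x ∨ D.SameVertex b x
      · rw [hR x hs]
        rw [sameVertex_iff, sameVertex_iff] at hs
        rcases hs with (rfl | rfl | rfl | rfl) | (rfl | rfl | rfl | rfl)
        · rw [f1, f0 _ _ _ n1]; exact .refl _ _
        · rw [f3, f0 _ _ _ n2]; exact .refl _ _
        · rw [h4, f1, f0 _ _ _ n1]; exact .refl _ _
        · rw [h4, f3, f0 _ _ _ n2]; exact .refl _ _
        · rw [f2, f0 _ _ _ n4]; exact q3.symm.trans (qr.trans q2.symm)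
        · rw [f4, f0 _ _ _ n3]; exact q1.symm.trans (ql.symm.trans q4.symm)
        · rw [h4, f2, f0 _ _ _ n4]; exact (q3.symm.trans (qr.trans q2.symm)).symm
        · rw [h4, f4, f0 _ _ _ n3]; exact (q1.symm.trans (ql.symm.trans q4.symm)).symm
      · have hx' : ¬ D.IsCrossing x := fun h => hx ((cD' x).2 (by tauto))
        have s1 := notS x fun h => absurd h hx'
        have s2 := notS (D.rot x) fun h => absurd ((hr x).1 h) hx'
        rw [hR' x hs, f0 _ _ _ s1, f0 _ _ _ s2]
        exact (Arc.rot hx').smooth_smooth hb ca' hne'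
    · rw [(hfix _ _ x (cE x hx)).1]; exact (k x hx).1
    · obtain ⟨k1, k2⟩ := hfix (D.rot (D.rot a)) (D.rot (D.rot (D.rot a))) x (cE x hx)
      have := cE x hx
      rw [hR' x (by tauto), k1, k2, (k x hx).2]
    · rw [(hfix _ _ x (cE x hx)).1, hO]; rfl
  have hED' : ArcMap E D' (f (D.rot (D.rot (D.rot a))) (D.rot (D.rot a))) := by
    refine .of_smooth_smooth hb ca' hne' (hedge pE _ _) (fun x hx => ?_) ?_ ?_ ?_ ?_
      fun x hx x1 x2 => ?_
    · have s1 := notS x fun h => absurd h hx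
      have s2 := notS (D.rot x) fun h => absurd ((hr x).1 h) hx
      have hv : ¬ (D.SameVertex a x ∨ D.SameVertex b x) := by
        rintro (h | h)
        · exact hx (h.isCrossing_iff.1 ha)
        · exact hx (h.isCrossing_iff.1 hb)
      rw [f0 _ _ _ s1, f0 _ _ _ s2, ← hR' x hv]
      exact .rot fun h => hx ((cD' x).1 h).1
    · rw [f2, f0 _ _ _ n3]; exact p1.symm.trans (pr.trans p3.symm)
    · rw [f4, f0 _ _ _ n4]; exact p2.symm.trans (pl.symm.trans p0)
    · rw [f3, f0 _ _ _ n1]; exact .refl _ _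
    · rw [h4, f1, f0 _ _ _ n2]; exact .refl _ _
    · rw [sameVertex_rot_left] at x2
      obtain ⟨k1, k2⟩ := hfix (D.rot (D.rot (D.rot a))) (D.rot (D.rot a)) x ⟨hx, x2, x1⟩
      rw [k1, k2, hR' x (by tauto), hO]
      exact ⟨(cD' x).2 ⟨hx, x2, x1⟩, rfl, Iff.rfl⟩
  refine bracket_eq_of_arcMap hD'E hED' (fun x hx => ?_) (fun x hx => ?_) (fun x => ?_) fun x => ?_
  · have := (cD' x).1 hx
    rw [(hfix _ _ x this).1, (hfix _ _ x this).1]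
  · have := (ciff x).1 hx
    rw [sameVertex_rot_left] at this
    have : D.IsCrossing x ∧ ¬ D.SameVertex a x ∧ ¬ D.SameVertex b x := by tauto
    rw [(hfix _ _ x this).1, (hfix _ _ x this).1]
  · by_cases hx : S x
    · obtain rfl | rfl | rfl | rfl := hx
      · rw [f1, f0 _ _ _ n1]; exact p0.symm
      · rw [f2, f0 _ _ _ n1]; exact p0.symm.trans pl
      · rw [f3, f0 _ _ _ n2]; exact p1.symm
      · rw [f4, f0 _ _ _ n2]; exact p1.symm.trans pr
    · rw [f0 _ _ _ hx, f0 _ _ _ hx]; exact .refl _ _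
  · by_cases hx : S x
    · obtain rfl | rfl | rfl | rfl := hx
      · rw [f1, f0 _ _ _ n2]; exact q4
      · rw [f2, f0 _ _ _ n2]; exact q4.trans ql
      · rw [f3, f0 _ _ _ n1]; exact q3.symm
      · rw [f4, f0 _ _ _ n1]; exact q3.symm.trans qr
    · rw [f0 _ _ _ hx, f0 _ _ _ hx]; exact .refl _ _

/-! ### Move III -/

theorem exists_map_corner (D : Diagram H) {a : H} (ha : D.IsCrossing a) (p₀ p₁ p₂ p₃ : H) :
    ∃ f : H → H, f a = p₀ ∧ f (D.rot a) = p₁ ∧ f (D.rot (D.rot a)) = p₂ ∧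
      f (D.rot (D.rot (D.rot a))) = p₃ := by
  classical
  have h3 : D.rot (D.rot (D.rot a)) ≠ a := fun h => by
    have := D.rot_four a; rw [h] at this; exact D.rot_ne a this
  exact ⟨fun x => if x = a then p₀ else if x = D.rot a then p₁ else
    if x = D.rot (D.rot a) then p₂ else p₃, by simp, by simp [D.rot_ne],
    by simp [D.rot_ne, show D.rot (D.rot a) ≠ a from ha],
    by simp [D.rot_ne, h3, show D.rot (D.rot a) ≠ a from ha]⟩

theorem sameVertex_self (D : Diagram H) (a : H) : D.SameVertex a a ∧ D.SameVertex a (D.rot a) ∧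
    D.SameVertex a (D.rot (D.rot a)) ∧ D.SameVertex a (D.rot (D.rot (D.rot a))) := by
  simp only [sameVertex_iff]; simp

theorem exists_map_corners (D : Diagram H) {a b c : H} (ha : D.IsCrossing a) (hb : D.IsCrossing b)
    (hc : D.IsCrossing c) (hab : ¬ D.SameVertex a b) (hbc : ¬ D.SameVertex b c)
    (hca : ¬ D.SameVertex c a) (p₀ p₁ p₂ p₃ q₀ q₁ q₂ q₃ r₀ r₁ r₂ r₃ : H) :
    ∃ f : H → H, (f a = p₀ ∧ f (D.rot a) = p₁ ∧ f (D.rot (D.rot a)) = p₂ ∧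
      f (D.rot (D.rot (D.rot a))) = p₃) ∧ (f b = q₀ ∧ f (D.rot b) = q₁ ∧ f (D.rot (D.rot b)) = q₂ ∧
      f (D.rot (D.rot (D.rot b))) = q₃) ∧ (f c = r₀ ∧ f (D.rot c) = r₁ ∧ f (D.rot (D.rot c)) = r₂ ∧
      f (D.rot (D.rot (D.rot c))) = r₃) ∧
      ∀ x, ¬ D.SameVertex a x → ¬ D.SameVertex b x → ¬ D.SameVertex c x → f x = x := by
  classical
  obtain ⟨fa, hfa⟩ := D.exists_map_corner ha p₀ p₁ p₂ p₃
  obtain ⟨fb, hfb⟩ := D.exists_map_corner hb q₀ q₁ q₂ q₃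
  obtain ⟨fc, hfc⟩ := D.exists_map_corner hc r₀ r₁ r₂ r₃
  let f := fun x => if D.SameVertex a x then fa x else if D.SameVertex b x then fb x else
    if D.SameVertex c x then fc x else x
  have ea : ∀ x, D.SameVertex a x → f x = fa x := fun x h => if_pos h
  have eb : ∀ x, D.SameVertex b x → f x = fb x := fun x h => by
    have h1 : ¬ D.SameVertex a x := fun h' => hab (h'.trans h.symm)
    simp only [f, h1, h, if_true, if_false]
  have ec : ∀ x, D.SameVertex c x → f x = fc x := fun x h => by
    have h1 : ¬ D.SameVertex a x := fun h' => hca (h.trans h'.symm)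
    have h2 : ¬ D.SameVertex b x := fun h' => hbc (h'.trans h.symm)
    simp only [f, h1, h2, h, if_true, if_false]
  obtain ⟨sa0, sa1, sa2, sa3⟩ := D.sameVertex_self a
  obtain ⟨sb0, sb1, sb2, sb3⟩ := D.sameVertex_self b
  obtain ⟨sc0, sc1, sc2, sc3⟩ := D.sameVertex_self c
  refine ⟨f, ?_, ?_, ?_, fun x h1 h2 h3 => by simp only [f, h1, h2, h3, if_false]⟩
  · rw [ea _ sa0, ea _ sa1, ea _ sa2, ea _ sa3]; exact hfa
  · rw [eb _ sb0, eb _ sb1, eb _ sb2, eb _ sb3]; exact hfb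
  · rw [ec _ sc0, ec _ sc1, ec _ sc2, ec _ sc3]; exact hfc

/-- Move III at the triangle with corners `a`, `b`, `c`, where the strand along the side from `a`
to `b` is over or under both other strands, and `τ` is the exchange of darts. -/
structure Slide (D D' : Diagram H) (τ : H → H) (a b c : H) : Prop where
  ca : D.IsCrossing a
  cb : D.IsCrossing b
  cc : D.IsCrossing c
  ne_ab : ¬ D.SameVertex a b
  ne_bc : ¬ D.SameVertex b c
  ne_ca : ¬ D.SameVertex c a
  edge_a : D.edge a = D.rot b
  edge_b : D.edge b = D.rot c
  edge_c : D.edge c = D.rot a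
  isOver_iff : D.isOver a ↔ ¬ D.isOver b
  rot : D'.rot = D.rot
  isOver : D'.isOver = D.isOver
  edge : ∀ x, D'.edge (τ x) = τ (D.edge x)
  map_a : τ a = D.rot (D.rot (D.rot b)) ∧ τ (D.rot a) = D.rot (D.rot c) ∧
    τ (D.rot (D.rot a)) = D.rot b ∧ τ (D.rot (D.rot (D.rot a))) = c
  map_b : τ b = D.rot (D.rot (D.rot c)) ∧ τ (D.rot b) = D.rot (D.rot a) ∧
    τ (D.rot (D.rot b)) = D.rot c ∧ τ (D.rot (D.rot (D.rot b))) = a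
  map_c : τ c = D.rot (D.rot (D.rot a)) ∧ τ (D.rot c) = D.rot (D.rot b) ∧
    τ (D.rot (D.rot c)) = D.rot a ∧ τ (D.rot (D.rot (D.rot c))) = b
  map_of_not : ∀ x, ¬ D.SameVertex a x → ¬ D.SameVertex b x → ¬ D.SameVertex c x → τ x = x

theorem isCrossing_of_rot_eq {D D' : Diagram H} (h : D'.rot = D.rot) (x : H) :
    D'.IsCrossing x ↔ D.IsCrossing x := by
  unfold IsCrossing; rw [h]

theorem sameVertex_of_rot_eq {D D' : Diagram H} (h : D'.rot = D.rot) (x y : H) :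
    D'.SameVertex x y ↔ D.SameVertex x y := by
  unfold SameVertex; rw [h]

theorem sameVertex_rot_rot_left (D : Diagram H) {x y : H} :
    D.SameVertex (D.rot (D.rot x)) y ↔ D.SameVertex x y := by
  rw [sameVertex_rot_left, sameVertex_rot_left]

theorem sameVertex_rot_right (D : Diagram H) {x y : H} :
    D.SameVertex x (D.rot y) ↔ D.SameVertex x y := Perm.sameCycle_apply_right

/-- Up to a rotation of the triangle, the first strand is over or under both others. -/
theorem MoveIII.exists_slide {D D' : Diagram H} (h : D.MoveIII D') :
    ∃ τ a b c, Slide D D' τ a b c := by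
  classical
  obtain ⟨a, b, c, ha, hb, hc, hab, hbc, hca, ea, eb, ec, ho, hR, hO, hE⟩ := h
  have key : ∀ x, D'.edge (D.triangleSwap a b c x) = D.triangleSwap a b c (D.edge x) := fun x => by
    rw [hE]
    simp only [Perm.mul_apply]
    congr 2
    exact (D.triangleSwap a b c).symm_apply_apply x
  obtain ⟨va, vb, vc, v⟩ : (D.triangleSwap a b c a = D.rot (D.rot (D.rot b)) ∧
      D.triangleSwap a b c (D.rot a) = D.rot (D.rot c) ∧
      D.triangleSwap a b c (D.rot (D.rot a)) = D.rot b ∧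
      D.triangleSwap a b c (D.rot (D.rot (D.rot a))) = c) ∧
      (D.triangleSwap a b c b = D.rot (D.rot (D.rot c)) ∧
      D.triangleSwap a b c (D.rot b) = D.rot (D.rot a) ∧
      D.triangleSwap a b c (D.rot (D.rot b)) = D.rot c ∧
      D.triangleSwap a b c (D.rot (D.rot (D.rot b))) = a) ∧
      (D.triangleSwap a b c c = D.rot (D.rot (D.rot a)) ∧
      D.triangleSwap a b c (D.rot c) = D.rot (D.rot b) ∧
      D.triangleSwap a b c (D.rot (D.rot c)) = D.rot a ∧
      D.triangleSwap a b c (D.rot (D.rot (D.rot c))) = b) ∧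
      ∀ x, ¬ D.SameVertex a x → ¬ D.SameVertex b x → ¬ D.SameVertex c x →
        D.triangleSwap a b c x = x := by
    -- The twelve darts at the corners are pairwise distinct; with this recorded, they can be
    -- treated as independent variables and the transpositions evaluated.
    have dist : ∀ {x y}, ¬ D.SameVertex x y →
        ∀ u v, D.SameVertex x u → D.SameVertex y v → u ≠ v := by
      rintro x y h u _ hu hv rfl
      exact h (hu.trans hv.symm)
    have self : ∀ {x}, D.IsCrossing x → x ≠ D.rot x ∧ x ≠ D.rot (D.rot x) ∧
        x ≠ D.rot (D.rot (D.rot x)) ∧ D.rot x ≠ D.rot (D.rot x) ∧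
        D.rot x ≠ D.rot (D.rot (D.rot x)) ∧ D.rot (D.rot x) ≠ D.rot (D.rot (D.rot x)) := by
      intro x hx
      have h3 : x ≠ D.rot (D.rot (D.rot x)) := fun h => by
        have := D.rot_four x; rw [← h] at this; exact D.rot_ne x this
      refine ⟨(D.rot_ne _).symm, Ne.symm hx, h3, (D.rot_ne _).symm, ?_, (D.rot_ne _).symm⟩
      exact Ne.symm (D.isCrossing_rot.2 hx)
    obtain ⟨sa0, sa1, sa2, sa3⟩ := D.sameVertex_self a
    obtain ⟨sb0, sb1, sb2, sb3⟩ := D.sameVertex_self b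
    obtain ⟨sc0, sc1, sc2, sc3⟩ := D.sameVertex_self c
    have da := self ha
    have db := self hb
    have dc := self hc
    have dab := dist hab
    have dbc := dist hbc
    have dca := dist hca
    have n1 := (⟨dab _ _ sa0 sb0, dab _ _ sa0 sb1, dab _ _ sa0 sb2, dab _ _ sa0 sb3⟩ : _ ∧ _ ∧ _ ∧ _)
    have n2 := (⟨dab _ _ sa1 sb0, dab _ _ sa1 sb1, dab _ _ sa1 sb2, dab _ _ sa1 sb3⟩ : _ ∧ _ ∧ _ ∧ _)
    have n3 := (⟨dab _ _ sa2 sb0, dab _ _ sa2 sb1, dab _ _ sa2 sb2, dab _ _ sa2 sb3⟩ : _ ∧ _ ∧ _ ∧ _)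
    have n4 := (⟨dab _ _ sa3 sb0, dab _ _ sa3 sb1, dab _ _ sa3 sb2, dab _ _ sa3 sb3⟩ : _ ∧ _ ∧ _ ∧ _)
    have m1 := (⟨dbc _ _ sb0 sc0, dbc _ _ sb0 sc1, dbc _ _ sb0 sc2, dbc _ _ sb0 sc3⟩ : _ ∧ _ ∧ _ ∧ _)
    have m2 := (⟨dbc _ _ sb1 sc0, dbc _ _ sb1 sc1, dbc _ _ sb1 sc2, dbc _ _ sb1 sc3⟩ : _ ∧ _ ∧ _ ∧ _)
    have m3 := (⟨dbc _ _ sb2 sc0, dbc _ _ sb2 sc1, dbc _ _ sb2 sc2, dbc _ _ sb2 sc3⟩ : _ ∧ _ ∧ _ ∧ _)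
    have m4 := (⟨dbc _ _ sb3 sc0, dbc _ _ sb3 sc1, dbc _ _ sb3 sc2, dbc _ _ sb3 sc3⟩ : _ ∧ _ ∧ _ ∧ _)
    have k1 := (⟨dca _ _ sc0 sa0, dca _ _ sc0 sa1, dca _ _ sc0 sa2, dca _ _ sc0 sa3⟩ : _ ∧ _ ∧ _ ∧ _)
    have k2 := (⟨dca _ _ sc1 sa0, dca _ _ sc1 sa1, dca _ _ sc1 sa2, dca _ _ sc1 sa3⟩ : _ ∧ _ ∧ _ ∧ _)
    have k3 := (⟨dca _ _ sc2 sa0, dca _ _ sc2 sa1, dca _ _ sc2 sa2, dca _ _ sc2 sa3⟩ : _ ∧ _ ∧ _ ∧ _)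
    have k4 := (⟨dca _ _ sc3 sa0, dca _ _ sc3 sa1, dca _ _ sc3 sa2, dca _ _ sc3 sa3⟩ : _ ∧ _ ∧ _ ∧ _)
    simp only [triangleSwap, rot_inv, sameVertex_iff] at *
    clear key hE ho hO hR ea eb ec dist self dab dbc dca sa0 sa1 sa2 sa3 sb0 sb1 sb2 sb3 sc0 sc1 sc2 sc3
    clear hab hbc hca ha hb hc
    generalize D.rot (D.rot (D.rot a)) = a3 at *
    generalize D.rot (D.rot a) = a2 at *
    generalize D.rot a = a1 at *
    generalize D.rot (D.rot (D.rot b)) = b3 at *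
    generalize D.rot (D.rot b) = b2 at *
    generalize D.rot b = b1 at *
    generalize D.rot (D.rot (D.rot c)) = c3 at *
    generalize D.rot (D.rot c) = c2 at *
    generalize D.rot c = c1 at *
    simp only [Perm.mul_apply, swap_apply_def]
    refine ⟨⟨?_, ?_, ?_, ?_⟩, ⟨?_, ?_, ?_, ?_⟩, ⟨?_, ?_, ?_, ?_⟩, fun x hx1 hx2 hx3 => ?_⟩ <;> grind
  -- Three truth values that are not all equal differ somewhere in cyclic order. If they differ at
  -- `a` and `b`, the strand with darts `a` and `rot b` is over at both of its crossings or under at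
  -- both.
  have hrot : (D.isOver a ↔ ¬ D.isOver b) ∨ (D.isOver b ↔ ¬ D.isOver c) ∨
      (D.isOver c ↔ ¬ D.isOver a) := by tauto
  obtain ho | ho | ho := hrot
  · exact ⟨D.triangleSwap a b c, a, b, c, ha, hb, hc, hab, hbc, hca, ea, eb, ec, ho, hR, hO, key,
      va, vb, vc, v⟩
  · exact ⟨D.triangleSwap a b c, b, c, a, hb, hc, ha, hbc, hca, hab, eb, ec, ea, ho, hR, hO, key,
      vb, vc, va, fun x h1 h2 h3 => v x h3 h1 h2⟩
  · exact ⟨D.triangleSwap a b c, c, a, b, hc, ha, hb, hca, hab, hbc, ec, ea, eb, ho, hR, hO, key,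
      vc, va, vb, fun x h1 h2 h3 => v x h2 h3 h1⟩

/-! ### The reversed slide, and the smoothing that opens the triangle. -/

namespace Slide

variable {D D' : Diagram H} {τ : H → H} {a b c : H}

/-- The new triangle lies on the opposite side of each crossing, so its corners are the opposite
darts, and `τ` is an involution. This lets each arc map be constructed in one direction only. -/
theorem symm (h : Slide D D' τ a b c) : Slide D' D τ (D.rot (D.rot a)) (D.rot (D.rot b))
    (D.rot (D.rot c)) := by
  have h4 := D.rot_four
  have hee := D.edge_edge
  obtain ⟨a0, a1, a2, a3⟩ := h.map_a
  obtain ⟨b0, b1, b2, b3⟩ := h.map_b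
  obtain ⟨c0, c1, c2, c3⟩ := h.map_c
  have hcr := isCrossing_of_rot_eq h.rot
  have hsv := sameVertex_of_rot_eq h.rot
  have ττ : ∀ x, τ (τ x) = x := by
    intro x
    by_cases xa : D.SameVertex a x
    · obtain rfl | rfl | rfl | rfl := D.sameVertex_iff.1 xa
      · rw [a0, b3]
      · rw [a1, c2]
      · rw [a2, b1]
      · rw [a3, c0]
    by_cases xb : D.SameVertex b x
    · obtain rfl | rfl | rfl | rfl := D.sameVertex_iff.1 xb
      · rw [b0, c3]
      · rw [b1, a2]
      · rw [b2, c1]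
      · rw [b3, a0]
    by_cases xc : D.SameVertex c x
    · obtain rfl | rfl | rfl | rfl := D.sameVertex_iff.1 xc
      · rw [c0, a3]
      · rw [c1, b2]
      · rw [c2, a1]
      · rw [c3, b0]
    rw [h.map_of_not x xa xb xc, h.map_of_not x xa xb xc]
  have ov : ∀ x, D.IsCrossing x → (D.isOver (D.rot (D.rot x)) ↔ D.isOver x) := fun x hx => by
    have := D.isOver_rot x hx
    have := D.isOver_rot _ (D.isCrossing_rot.2 hx)
    tauto
  constructor
  · simpa only [hcr, isCrossing_rot] using h.ca
  · simpa only [hcr, isCrossing_rot] using h.cb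
  · simpa only [hcr, isCrossing_rot] using h.cc
  · simpa only [hsv, sameVertex_rot_rot_left, sameVertex_rot_right] using h.ne_ab
  · simpa only [hsv, sameVertex_rot_rot_left, sameVertex_rot_right] using h.ne_bc
  · simpa only [hsv, sameVertex_rot_rot_left, sameVertex_rot_right] using h.ne_ca
  · rw [← b1, h.edge, ← h.edge_a, hee, a0, h.rot, h.edge_a]
  · rw [← c1, h.edge, ← h.edge_b, hee, b0, h.rot, h.edge_b]
  · rw [← a1, h.edge, ← h.edge_c, hee, c0, h.rot, h.edge_c]
  · rw [h.isOver, ov _ h.ca, ov _ h.cb]; exact h.isOver_iff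
  · exact h.rot.symm
  · exact h.isOver.symm
  · intro x
    have := h.edge (τ x)
    rw [ττ] at this
    rw [this, ττ]
  · simp only [h.rot, h4]; exact ⟨a2, a3, a0, a1⟩
  · simp only [h.rot, h4]; exact ⟨b2, b3, b0, b1⟩
  · simp only [h.rot, h4]; exact ⟨c2, c3, c0, c1⟩
  · intro x h1 h2 h3
    simp only [hsv, sameVertex_rot_rot_left] at h1 h2 h3
    exact h.map_of_not x h1 h2 h3

/-- An exchange of the corners `a` and `b`, which is an isotopy after the smoothing at `rot c`. -/
structure CornerSwap (D : Diagram H) (a b c : H) (f : H → H) : Prop where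
  map_a : f a = D.rot (D.rot (D.rot b)) ∧ f (D.rot a) = b ∧ f (D.rot (D.rot a)) = D.rot b ∧
    f (D.rot (D.rot (D.rot a))) = D.rot (D.rot b)
  map_b : f b = D.rot a ∧ f (D.rot b) = D.rot (D.rot a) ∧
    f (D.rot (D.rot b)) = D.rot (D.rot (D.rot a)) ∧ f (D.rot (D.rot (D.rot b))) = a
  map_c : f c = b ∧ f (D.rot c) = D.rot a ∧ f (D.rot (D.rot c)) = D.rot a ∧
    f (D.rot (D.rot (D.rot c))) = b
  map_of_not : ∀ x, ¬ D.SameVertex a x → ¬ D.SameVertex b x → ¬ D.SameVertex c x → f x = x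

/-- The edges of the diagram after the move in terms of those before. -/
theorem arc_of_edge (h : Slide D D' τ a b c) {E : Diagram H} (hE : ∀ x, E.Arc x (D'.edge x)) :
    E.Arc (D.rot (D.rot (D.rot b))) (D.rot (D.rot a)) ∧
    E.Arc (D.rot (D.rot (D.rot c))) (D.rot (D.rot b)) ∧
    E.Arc (D.rot (D.rot (D.rot a))) (D.rot (D.rot c)) ∧
    ∀ x, E.Arc (τ x) (τ (D.edge x)) := by
  have key : ∀ x, E.Arc (τ x) (τ (D.edge x)) := fun x => h.edge x ▸ hE (τ x)
  refine ⟨?_, ?_, ?_, key⟩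
  · have := key a
    rwa [h.edge_a, h.map_a.1, h.map_b.2.1] at this
  · have := key b
    rwa [h.edge_b, h.map_b.1, h.map_c.2.1] at this
  · have := key c
    rwa [h.edge_c, h.map_c.1, h.map_a.2.1] at this

theorem not_side (h : Slide D D' τ a b c) (x : H)
    (hx : ¬ (x = a ∨ x = D.rot a ∨ x = b ∨ x = D.rot b ∨ x = c ∨ x = D.rot c)) :
    ¬ (D.edge x = a ∨ D.edge x = D.rot a ∨ D.edge x = b ∨ D.edge x = D.rot b ∨ D.edge x = c ∨
      D.edge x = D.rot c) := by
  have hee := D.edge_edge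
  have h1 := h.edge_a
  have h2 := h.edge_b
  have h3 := h.edge_c
  grind

theorem map_eq_of_not_side (h : Slide D D' τ a b c) {P : H → Prop}
    (pa : P (D.rot (D.rot a))) (pa' : P (D.rot (D.rot (D.rot a))))
    (pb : P (D.rot (D.rot b))) (pb' : P (D.rot (D.rot (D.rot b))))
    (pc : P (D.rot (D.rot c))) (pc' : P (D.rot (D.rot (D.rot c))))
    (p : ∀ x, ¬ D.SameVertex a x → ¬ D.SameVertex b x → ¬ D.SameVertex c x → P x) (x : H)
    (hx : ¬ (x = a ∨ x = D.rot a ∨ x = b ∨ x = D.rot b ∨ x = c ∨ x = D.rot c)) : P x := by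
  by_cases xa : D.SameVertex a x
  · obtain rfl | rfl | rfl | rfl := D.sameVertex_iff.1 xa <;> first | assumption | simp at hx
  by_cases xb : D.SameVertex b x
  · obtain rfl | rfl | rfl | rfl := D.sameVertex_iff.1 xb <;> first | assumption | simp at hx
  by_cases xc : D.SameVertex c x
  · obtain rfl | rfl | rfl | rfl := D.sameVertex_iff.1 xc <;> first | assumption | simp at hx
  exact p x xa xb xc

/-- Opened at `c`, the triangle becomes two strands side by side that cross the strand from `a` to
`b`. Sliding this strand along them is an isotopy, under which the crossing at `a` before the move
corresponds to the one at `b` after it, with darts shifted by a quarter turn, and conversely. -/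
theorem arcMap_cornerSwap (h : Slide D D' τ a b c) {f : H → H} (hf : CornerSwap D a b c f) :
    ArcMap (D.smooth (D.rot c)) (D'.smooth (D.rot c)) f := by
  have h4 := D.rot_four
  have cc := D.isCrossing_rot.2 h.cc
  have cc' := (isCrossing_of_rot_eq h.rot _).2 cc
  obtain ⟨ta0, ta1, ta2, ta3⟩ := h.map_a
  obtain ⟨tb0, tb1, tb2, tb3⟩ := h.map_b
  obtain ⟨tc0, tc1, tc2, tc3⟩ := h.map_c
  obtain ⟨fa0, fa1, fa2, fa3⟩ := hf.map_a
  obtain ⟨fb0, fb1, fb2, fb3⟩ := hf.map_b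
  obtain ⟨fc0, fc1, fc2, fc3⟩ := hf.map_c
  obtain ⟨p1, p2⟩ := D'.arc_smooth_pairs cc'
  simp only [h.rot, h4] at p1 p2
  set E := D'.smooth (D.rot c) with hE
  obtain ⟨e1, e2, e3, e4⟩ := h.arc_of_edge (E := E) fun x => Arc.edge E x
  -- Off the sides of the triangle, `f` agrees with `τ` up to arcs, and `τ` takes the edges before
  -- the move to the edges after it.
  have fτ := h.map_eq_of_not_side (P := fun x => E.Arc (f x) (τ x))
    (by rw [fa2, ta2]; exact .refl _ _) (by rw [fa3, ta3]; exact e2.symm.trans p2)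
    (by rw [fb2, tb2]; exact e3.trans p1.symm) (by rw [fb3, tb3]; exact .refl _ _)
    (by rw [fc2, tc2]; exact .refl _ _) (by rw [fc3, tc3]; exact .refl _ _)
    (fun x x1 x2 x3 => by rw [hf.map_of_not x x1 x2 x3, h.map_of_not x x1 x2 x3]; exact .refl _ _)
  have hcE : ∀ x, D.IsCrossing x → ¬ D.SameVertex c x → E.IsCrossing x ∧ E.rot x = D.rot x := by
    intro x hx hx'
    have hn : ¬ D'.SameVertex (D.rot c) x := by
      rwa [sameVertex_of_rot_eq h.rot, sameVertex_rot_left]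
    rw [hE, D'.smooth_isCrossing_iff cc', D'.smooth_rot_of_not_sameVertex hn, h.rot,
      isCrossing_of_rot_eq h.rot]
    exact ⟨⟨hx, hn⟩, rfl⟩
  refine .of_smooth cc (fun x => ?_) (fun x hx => ?_) ?_ ?_ fun x hx hx' => ?_
  · by_cases hx : x = a ∨ x = D.rot a ∨ x = b ∨ x = D.rot b ∨ x = c ∨ x = D.rot c
    · have ea := h.edge_a
      have eb := h.edge_b
      have ec := h.edge_c
      have hee := D.edge_edge
      obtain rfl | rfl | rfl | rfl | rfl | rfl := hx
      · rw [ea, fa0, fb1]; exact e1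
      · rw [← ec, hee, ec, fa1, fc0]; exact .refl _ _
      · rw [eb, fb0, fc1]; exact .refl _ _
      · rw [← ea, hee, ea, fb1, fa0]; exact e1.symm
      · rw [ec, fc0, fa1]; exact .refl _ _
      · rw [← eb, hee, eb, fc1, fb0]; exact .refl _ _
    · exact (fτ x hx).trans ((e4 x).trans (fτ _ (h.not_side x hx)).symm)
  · have n : ∀ y, D.IsCrossing y → ¬ D.SameVertex y x := fun y hy h' => hx (h'.isCrossing_iff.1 hy)
    have n' : ∀ y, D.IsCrossing y → ¬ D.SameVertex y (D.rot x) := fun y hy => by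
      rw [sameVertex_rot_right]; exact n y hy
    rw [hf.map_of_not x (n _ h.ca) (n _ h.cb) (n _ h.cc),
      hf.map_of_not _ (n' _ h.ca) (n' _ h.cb) (n' _ h.cc)]
    have := Arc.rot ((isCrossing_of_rot_eq h.rot x).not.2 hx)
    rw [h.rot] at this
    exact this.smooth cc'
  · rw [fc1, fc2]; exact .refl _ _
  · rw [h4, fc3, fc0]; exact .refl _ _
  · rw [sameVertex_rot_left] at hx'
    have nca : ∀ y, D.SameVertex a y → ¬ D.SameVertex c y := fun y h1 h2 =>
      h.ne_ca (h2.trans h1.symm)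
    have ncb : ∀ y, D.SameVertex b y → ¬ D.SameVertex c y := fun y h1 h2 =>
      h.ne_bc (h1.trans h2.symm)
    have hov : E.isOver = D.isOver := h.isOver
    have ov : ∀ x, D.IsCrossing x → (D.isOver (D.rot x) ↔ ¬ D.isOver x) := D.isOver_rot
    have ha := h.ca
    have hb := h.cb
    obtain ⟨sa0, sa1, sa2, sa3⟩ := D.sameVertex_self a
    obtain ⟨sb0, sb1, sb2, sb3⟩ := D.sameVertex_self b
    have hr := fun x => D.isCrossing_rot (x := x)
    have A0 := hcE a ha (nca _ sa0)
    have A1 := hcE (D.rot a) (by simpa only [hr]) (nca _ sa1)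
    have A2 := hcE (D.rot (D.rot a)) (by simpa only [hr]) (nca _ sa2)
    have A3 := hcE (D.rot (D.rot (D.rot a))) (by simpa only [hr]) (nca _ sa3)
    have B0 := hcE b hb (ncb _ sb0)
    have B1 := hcE (D.rot b) (by simpa only [hr]) (ncb _ sb1)
    have B2 := hcE (D.rot (D.rot b)) (by simpa only [hr]) (ncb _ sb2)
    have B3 := hcE (D.rot (D.rot (D.rot b))) (by simpa only [hr]) (ncb _ sb3)
    have oa1 := ov a ha
    have oa2 := ov (D.rot a) (by simpa only [hr])
    have oa3 := ov (D.rot (D.rot a)) (by simpa only [hr])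
    have ob1 := ov b hb
    have ob2 := ov (D.rot b) (by simpa only [hr])
    have ob3 := ov (D.rot (D.rot b)) (by simpa only [hr])
    -- A quarter turn exchanges over and under at a crossing; it is compensated because `isOver` has
    -- opposite values at `a` and `b`.
    have hover := h.isOver_iff
    have o0 : D.isOver (D.rot (D.rot (D.rot b))) ↔ D.isOver a := by
      rw [ob3, ob2, ob1, hover, not_not]
    have o1 : D.isOver b ↔ D.isOver (D.rot a) := by rw [oa1, hover, not_not]
    have o2 : D.isOver (D.rot b) ↔ D.isOver (D.rot (D.rot a)) := by
      rw [ob1, oa2, oa1, hover, not_not]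
    have o3 : D.isOver (D.rot (D.rot b)) ↔ D.isOver (D.rot (D.rot (D.rot a))) := by
      rw [ob2, ob1, oa3, oa2, oa1, hover, not_not, not_not]
    have u0 : D.isOver (D.rot a) ↔ D.isOver b := o1.symm
    have u1 : D.isOver (D.rot (D.rot a)) ↔ D.isOver (D.rot b) := o2.symm
    have u2 : D.isOver (D.rot (D.rot (D.rot a))) ↔ D.isOver (D.rot (D.rot b)) := o3.symm
    have u3 : D.isOver a ↔ D.isOver (D.rot (D.rot (D.rot b))) := o0.symm
    rw [hov]
    by_cases xa : D.SameVertex a x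
    · obtain rfl | rfl | rfl | rfl := D.sameVertex_iff.1 xa
      · rw [fa0, fa1, B3.2, h4]; exact ⟨B3.1, rfl, o0⟩
      · rw [fa1, fa2, B0.2]; exact ⟨B0.1, rfl, o1⟩
      · rw [fa2, fa3, B1.2]; exact ⟨B1.1, rfl, o2⟩
      · rw [h4, fa3, fa0, B2.2]; exact ⟨B2.1, rfl, o3⟩
    by_cases xb : D.SameVertex b x
    · obtain rfl | rfl | rfl | rfl := D.sameVertex_iff.1 xb
      · rw [fb0, fb1, A1.2]; exact ⟨A1.1, rfl, u0⟩
      · rw [fb1, fb2, A2.2]; exact ⟨A2.1, rfl, u1⟩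
      · rw [fb2, fb3, A3.2, h4]; exact ⟨A3.1, rfl, u2⟩
      · rw [h4, fb3, fb0, A0.2]; exact ⟨A0.1, rfl, u3⟩
    have k := hcE x hx hx'
    rw [hf.map_of_not x xa xb hx', hf.map_of_not (D.rot x) (by rwa [sameVertex_rot_right])
      (by rwa [sameVertex_rot_right]) (by rwa [sameVertex_rot_right]), k.2]
    exact ⟨k.1, rfl, Iff.rfl⟩

/-- The quarter turns at `a` and `b` cancel. The darts at `c`, now marked points, may move, but only
along their arcs. -/
theorem cornerSwap_cornerSwap (h : Slide D D' τ a b c) {f g : H → H} (hf : CornerSwap D a b c f)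
    (hg : CornerSwap D (D.rot (D.rot a)) (D.rot (D.rot b)) (D.rot (D.rot c)) g) (x : H) :
    ((D.smooth (D.rot c)).IsCrossing x → g (f x) = x) ∧ (D.smooth (D.rot c)).Arc (g (f x)) x := by
  have h4 := D.rot_four
  have cc := D.isCrossing_rot.2 h.cc
  obtain ⟨fa0, fa1, fa2, fa3⟩ := hf.map_a
  obtain ⟨fb0, fb1, fb2, fb3⟩ := hf.map_b
  obtain ⟨fc0, fc1, fc2, fc3⟩ := hf.map_c
  obtain ⟨ga2, ga3, ga0, ga1⟩ := hg.map_a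
  obtain ⟨gb2, gb3, gb0, gb1⟩ := hg.map_b
  simp only [h4] at ga0 ga1 ga2 ga3 gb0 gb1 gb2 gb3
  obtain ⟨p1, p2⟩ := D.arc_smooth_pairs cc
  simp only [h4] at p1 p2
  have e : ∀ x, (D.smooth (D.rot c)).Arc x (D.edge x) := fun x => Arc.edge (D.smooth (D.rot c)) x
  have e2 := e b
  have e3 := e c
  rw [h.edge_b] at e2
  rw [h.edge_c] at e3
  by_cases xc : D.SameVertex c x
  · refine ⟨fun hx => absurd xc ?_, ?_⟩
    · rw [D.smooth_isCrossing_iff cc, sameVertex_rot_left] at hx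
      exact hx.2
    obtain rfl | rfl | rfl | rfl := D.sameVertex_iff.1 xc
    · rw [fc0, gb0]; exact e3.symm
    · rw [fc1, ga1]; exact e2
    · rw [fc2, ga1]; exact e2.trans p1
    · rw [fc3, gb0]; exact e3.symm.trans p2.symm
  · have key : g (f x) = x := by
      by_cases xa : D.SameVertex a x
      · obtain rfl | rfl | rfl | rfl := D.sameVertex_iff.1 xa
        · rw [fa0, gb3]
        · rw [fa1, gb0]
        · rw [fa2, gb1]
        · rw [fa3, gb2]
      by_cases xb : D.SameVertex b x
      · obtain rfl | rfl | rfl | rfl := D.sameVertex_iff.1 xb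
        · rw [fb0, ga1]
        · rw [fb1, ga2]
        · rw [fb2, ga3]
        · rw [fb3, ga0]
      rw [hf.map_of_not x xa xb xc, hg.map_of_not x] <;> rwa [sameVertex_rot_rot_left]
    exact ⟨fun _ => key, by rw [key]; exact .refl _ _⟩

theorem bracket_smooth_rot_eq [Finite H] (h : Slide D D' τ a b c) :
    (D.smooth (D.rot c)).bracket = (D'.smooth (D.rot c)).bracket := by
  have h4 := D.rot_four
  obtain ⟨f, fa, fb, fc, f0⟩ := D.exists_map_corners h.ca h.cb h.cc h.ne_ab h.ne_bc h.ne_ca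
    (D.rot (D.rot (D.rot b))) b (D.rot b) (D.rot (D.rot b)) (D.rot a) (D.rot (D.rot a))
    (D.rot (D.rot (D.rot a))) a b (D.rot a) (D.rot a) b
  -- The map for the reversed move has opposite darts as corners. The values at `a` and `b` commute
  -- with the half turn and are those of `f`; only the values at `c` change.
  obtain ⟨g, ga, gb, gc, g0⟩ := D.exists_map_corners h.ca h.cb h.cc h.ne_ab h.ne_bc h.ne_ca
    (D.rot (D.rot (D.rot b))) b (D.rot b) (D.rot (D.rot b)) (D.rot a) (D.rot (D.rot a))
    (D.rot (D.rot (D.rot a))) a (D.rot (D.rot (D.rot a))) (D.rot (D.rot b)) (D.rot (D.rot b))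
    (D.rot (D.rot (D.rot a)))
  have hf : CornerSwap D a b c f := ⟨fa, fb, fc, f0⟩
  have hg : CornerSwap D (D.rot (D.rot a)) (D.rot (D.rot b)) (D.rot (D.rot c)) g := by
    constructor
    · simp only [h4]; tauto
    · simp only [h4]; tauto
    · simp only [h4]; tauto
    · simpa only [sameVertex_rot_rot_left] using g0
  have tr : ∀ {a b c f}, CornerSwap D a b c f → CornerSwap D' a b c f := fun h' => by
    have hsv := sameVertex_of_rot_eq h.rot
    exact ⟨by rw [h.rot]; exact h'.map_a, by rw [h.rot]; exact h'.map_b,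
      by rw [h.rot]; exact h'.map_c, by simpa only [hsv] using h'.map_of_not⟩
  have hf' : CornerSwap D' (D'.rot (D'.rot (D.rot (D.rot a)))) (D'.rot (D'.rot (D.rot (D.rot b))))
      (D'.rot (D'.rot (D.rot (D.rot c)))) f := by
    rw [h.rot]; simp only [h4]; exact tr hf
  have e1 : D.smooth (D.rot (D.rot (D.rot c))) = D.smooth (D.rot c) := D.smooth_rot_rot _
  have e2 : D'.smooth (D.rot (D.rot (D.rot c))) = D'.smooth (D.rot c) := by
    have := D'.smooth_rot_rot (D.rot c)
    rwa [h.rot] at this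
  have mg := h.symm.arcMap_cornerSwap (tr hg)
  have c2 := h.symm.cornerSwap_cornerSwap (tr hg) hf'
  simp only [h.rot, e1, e2] at mg c2
  have c1 := h.cornerSwap_cornerSwap hf hg
  exact bracket_eq_of_arcMap (h.arcMap_cornerSwap hf) mg (fun x => (c1 x).1) (fun x => (c2 x).1)
    (fun x => (c1 x).2) fun x => (c2 x).2

end Slide

/-! ### The smoothing that leaves a bigon, and the triangle with all corners smoothed. -/

/-- Smoothings at the corners `a`, `b`, `c` of a triangle that separate the side from `a` to `b` from
the others. -/
noncomputable def smoothTriangle (D : Diagram H) (a b c : H) : Diagram H :=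
  ((D.smooth c).smooth (D.rot b)).smooth (D.rot a)

section SmoothTriangle

variable {D : Diagram H} {a b c : H}

theorem smooth_rot_of_sameVertex {x y : H} (hxy : ¬ D.SameVertex c x)
    (h : D.SameVertex x y) : (D.smooth c).rot y = D.rot y :=
  D.smooth_rot_of_not_sameVertex fun h' => hxy (h'.trans h.symm)

theorem smooth_corners (ha : D.IsCrossing a) (hb : D.IsCrossing b) (hc : D.IsCrossing c)
    (hab : ¬ D.SameVertex a b) (hbc : ¬ D.SameVertex b c) (hca : ¬ D.SameVertex c a) :
    (D.smooth c).IsCrossing (D.rot b) ∧ (D.smooth c).IsCrossing (D.rot a) ∧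
      ¬ (D.smooth c).SameVertex (D.rot b) (D.rot a) := by
  have hcb : ¬ D.SameVertex c b := fun h => hbc h.symm
  have e : ¬ D.SameVertex c (D.rot b) := by rwa [sameVertex_rot_right]
  refine ⟨D.smooth_isCrossing_of_not_sameVertex hc (D.isCrossing_rot.2 hb) e,
    D.smooth_isCrossing_of_not_sameVertex hc (D.isCrossing_rot.2 ha)
      (by rwa [sameVertex_rot_right]), ?_⟩
  rw [D.smooth_sameVertex_iff e, sameVertex_rot_left, sameVertex_rot_right]
  exact fun h => hab h.symm

theorem smoothTriangle_isCrossing_iff (ha : D.IsCrossing a) (hb : D.IsCrossing b)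
    (hc : D.IsCrossing c) (hab : ¬ D.SameVertex a b) (hbc : ¬ D.SameVertex b c)
    (hca : ¬ D.SameVertex c a) (x : H) : (D.smoothTriangle a b c).IsCrossing x ↔
      D.IsCrossing x ∧ ¬ D.SameVertex a x ∧ ¬ D.SameVertex b x ∧ ¬ D.SameVertex c x := by
  obtain ⟨h1, h2, h3⟩ := smooth_corners ha hb hc hab hbc hca
  have e1 : ¬ D.SameVertex c (D.rot a) := by rwa [sameVertex_rot_right]
  have e2 : ¬ D.SameVertex c (D.rot b) := by rw [sameVertex_rot_right]; exact fun h => hbc h.symm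
  rw [smoothTriangle, smooth_smooth_isCrossing_iff h1 h2 h3, D.smooth_isCrossing_iff hc,
    D.smooth_sameVertex_iff e1, D.smooth_sameVertex_iff e2, sameVertex_rot_left, sameVertex_rot_left]
  tauto

theorem smoothTriangle_rot (hab : ¬ D.SameVertex a b) (hbc : ¬ D.SameVertex b c)
    (hca : ¬ D.SameVertex c a) {x : H}
    (h1 : ¬ D.SameVertex a x) (h2 : ¬ D.SameVertex b x) (h3 : ¬ D.SameVertex c x) :
    (D.smoothTriangle a b c).rot x = D.rot x := by
  have e1 : ¬ D.SameVertex c (D.rot a) := by rwa [sameVertex_rot_right]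
  have e2 : ¬ D.SameVertex c (D.rot b) := by rw [sameVertex_rot_right]; exact fun h => hbc h.symm
  have e3 : ¬ (D.smooth c).SameVertex (D.rot b) (D.rot a) := by
    rw [D.smooth_sameVertex_iff e2, sameVertex_rot_left, sameVertex_rot_right]
    exact fun h => hab h.symm
  have k2 : ¬ (D.smooth c).SameVertex (D.rot b) x := by
    rwa [D.smooth_sameVertex_iff e2, sameVertex_rot_left]
  have k1 : ¬ ((D.smooth c).smooth (D.rot b)).SameVertex (D.rot a) x := by
    rwa [smooth_sameVertex_iff _ e3, D.smooth_sameVertex_iff e1, sameVertex_rot_left]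
  rw [smoothTriangle, smooth_rot_of_not_sameVertex _ k1, smooth_rot_of_not_sameVertex _ k2,
    smooth_rot_of_not_sameVertex _ h3]

theorem smooth_rot_corners (hbc : ¬ D.SameVertex b c) (hca : ¬ D.SameVertex c a) :
    ((D.smooth c).rot (D.rot b) = D.rot (D.rot b) ∧
    (D.smooth c).rot (D.rot (D.rot b)) = D.rot (D.rot (D.rot b)) ∧
    (D.smooth c).rot (D.rot (D.rot (D.rot b))) = b) ∧
    ((D.smooth c).rot (D.rot a) = D.rot (D.rot a) ∧
    (D.smooth c).rot (D.rot (D.rot a)) = D.rot (D.rot (D.rot a)) ∧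
    (D.smooth c).rot (D.rot (D.rot (D.rot a))) = a) ∧
    (D.smooth c).rot b = D.rot b ∧ (D.smooth c).rot a = D.rot a := by
  have hcb : ¬ D.SameVertex c b := fun h => hbc h.symm
  obtain ⟨b0, b1, b2, b3⟩ := D.sameVertex_self b
  obtain ⟨a0, a1, a2, a3⟩ := D.sameVertex_self a
  have h4 := D.rot_four
  have ka := fun y => smooth_rot_of_sameVertex (D := D) (y := y) hca
  have kb := fun y => smooth_rot_of_sameVertex (D := D) (y := y) hcb
  rw [ka _ a0, ka _ a1, ka _ a2, ka _ a3, kb _ b0, kb _ b1, kb _ b2, kb _ b3, h4, h4]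
  exact ⟨⟨rfl, rfl, rfl⟩, ⟨rfl, rfl, rfl⟩, rfl, rfl⟩

theorem arc_smoothTriangle_pairs (ha : D.IsCrossing a) (hb : D.IsCrossing b) (hc : D.IsCrossing c)
    (hab : ¬ D.SameVertex a b) (hbc : ¬ D.SameVertex b c) (hca : ¬ D.SameVertex c a) :
    ((D.smoothTriangle a b c).Arc (D.rot a) (D.rot (D.rot a)) ∧
      (D.smoothTriangle a b c).Arc (D.rot (D.rot (D.rot a))) a) ∧
    ((D.smoothTriangle a b c).Arc (D.rot b) (D.rot (D.rot b)) ∧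
      (D.smoothTriangle a b c).Arc (D.rot (D.rot (D.rot b))) b) ∧
    (D.smoothTriangle a b c).Arc c (D.rot c) ∧
      (D.smoothTriangle a b c).Arc (D.rot (D.rot c)) (D.rot (D.rot (D.rot c))) := by
  obtain ⟨h1, h2, h3⟩ := smooth_corners ha hb hc hab hbc hca
  obtain ⟨p1, p2⟩ := D.arc_smooth_pairs hc
  obtain ⟨q1, q2, q3, q4⟩ := arc_smooth_smooth_pairs h1 h2 h3
  obtain ⟨⟨r1, r2, r3⟩, ⟨s1, s2, s3⟩, -⟩ := smooth_rot_corners hbc hca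
  rw [r1] at q1 q2
  rw [r2, r3] at q2
  rw [s1] at q3 q4
  rw [s2, s3] at q4
  exact ⟨⟨q3, q4⟩, ⟨q1, q2⟩, p1.smooth_smooth h1 h2 h3, p2.smooth_smooth h1 h2 h3⟩

/-- Each smoothing is unchanged by a half turn at its crossing; so the reversed move, with opposite
corners, leads to the same smoothings. -/
theorem smoothTriangle_opposite (hbc : ¬ D.SameVertex b c) (hca : ¬ D.SameVertex c a)
    (hab : ¬ D.SameVertex a b) :
    D.smoothTriangle (D.rot (D.rot a)) (D.rot (D.rot b)) (D.rot (D.rot c)) =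
      D.smoothTriangle a b c := by
  obtain ⟨⟨r1, r2, r3⟩, ⟨s1, s2, s3⟩, -⟩ := smooth_rot_corners hbc hca
  have e : (D.smooth c).smooth (D.rot (D.rot (D.rot b))) = (D.smooth c).smooth (D.rot b) := by
    rw [← r2, ← r1]; exact smooth_rot_rot _ _
  have hcb : ¬ D.SameVertex c b := fun h => hbc h.symm
  have n : ∀ y, D.SameVertex a y → ¬ (D.smooth c).SameVertex (D.rot b) y := fun y hy => by
    rw [D.smooth_sameVertex_iff (by rwa [sameVertex_rot_right]), sameVertex_rot_left]
    exact fun h => hab (hy.trans h.symm)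
  obtain ⟨-, a1, a2, -⟩ := D.sameVertex_self a
  have e' : ((D.smooth c).smooth (D.rot b)).smooth (D.rot (D.rot (D.rot a))) =
      ((D.smooth c).smooth (D.rot b)).smooth (D.rot a) := by
    rw [← s2, ← smooth_rot_of_not_sameVertex _ (n _ a2), ← s1,
      ← smooth_rot_of_not_sameVertex _ (n _ a1)]
    exact smooth_rot_rot _ _
  rw [smoothTriangle, smooth_rot_rot, e, e', smoothTriangle]

end SmoothTriangle

namespace Slide

variable {D D' : Diagram H} {τ : H → H} {a b c : H}

/-- The map between the triangles that are smoothed by `smoothTriangle`. -/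
structure StrandSwap (D : Diagram H) (a b c : H) (f : H → H) : Prop where
  map_a : f a = c ∧ f (D.rot a) = D.rot b ∧ f (D.rot (D.rot a)) = D.rot b ∧
    f (D.rot (D.rot (D.rot a))) = c
  map_b : f b = D.rot b ∧ f (D.rot b) = c ∧ f (D.rot (D.rot b)) = D.rot c ∧
    f (D.rot (D.rot (D.rot b))) = a
  map_c : f c = D.rot b ∧ f (D.rot c) = D.rot b ∧ f (D.rot (D.rot c)) = D.rot a ∧
    f (D.rot (D.rot (D.rot c))) = b
  map_of_not : ∀ x, ¬ D.SameVertex a x → ¬ D.SameVertex b x → ¬ D.SameVertex c x → f x = x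

/-- No crossing is left at the triangle, and before and after the move three arcs join the same
outer ends. In `D` they are `rot³ a` to `rot² b` along the side at `a`, `rot² a` to `rot³ b` along
the other two sides, and `rot² c` to `rot³ c`. The exchange `τ` takes these pairs of ends to the
pairs joined in `D'`. -/
theorem arcMap_strandSwap (h : Slide D D' τ a b c) {f : H → H} (hf : StrandSwap D a b c f) :
    ArcMap (D.smoothTriangle a b c) (D'.smoothTriangle a b c) f := by
  have h4 := D.rot_four
  have hcr := isCrossing_of_rot_eq h.rot
  have hsv := sameVertex_of_rot_eq h.rot
  obtain ⟨ta0, ta1, ta2, ta3⟩ := h.map_a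
  obtain ⟨tb0, tb1, tb2, tb3⟩ := h.map_b
  obtain ⟨tc0, tc1, tc2, tc3⟩ := h.map_c
  obtain ⟨fa0, fa1, fa2, fa3⟩ := hf.map_a
  obtain ⟨fb0, fb1, fb2, fb3⟩ := hf.map_b
  obtain ⟨fc0, fc1, fc2, fc3⟩ := hf.map_c
  have ha' := (hcr a).2 h.ca
  have hb' := (hcr b).2 h.cb
  have hc' := (hcr c).2 h.cc
  have hab' := (hsv a b).not.2 h.ne_ab
  have hbc' := (hsv b c).not.2 h.ne_bc
  have hca' := (hsv c a).not.2 h.ne_ca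
  obtain ⟨⟨pa1, pa2⟩, ⟨pb1, pb2⟩, pc1, pc2⟩ := arc_smoothTriangle_pairs ha' hb' hc' hab' hbc' hca'
  simp only [h.rot] at pa1 pa2 pb1 pb2 pc1 pc2
  have ciff := smoothTriangle_isCrossing_iff ha' hb' hc' hab' hbc' hca'
  have crot := fun x => smoothTriangle_rot (x := x) hab' hbc' hca'
  simp only [hcr, hsv, h.rot] at ciff crot
  set E := D'.smoothTriangle a b c with hE
  obtain ⟨e1, e2, e3, e4⟩ := h.arc_of_edge (E := E) fun x => Arc.edge E x
  -- On the outer darts `f` is `τ`; each dart on a side goes to a dart on the corresponding arc of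
  -- `E`.
  have fτ := h.map_eq_of_not_side (P := fun x => f x = τ x)
    (by rw [fa2, ta2]) (by rw [fa3, ta3]) (by rw [fb2, tb2]) (by rw [fb3, tb3]) (by rw [fc2, tc2])
    (by rw [fc3, tc3])
    (fun x x1 x2 x3 => by rw [hf.map_of_not x x1 x2 x3, h.map_of_not x x1 x2 x3])
  obtain ⟨h1, h2, h3⟩ := smooth_corners h.ca h.cb h.cc h.ne_ab h.ne_bc h.ne_ca
  obtain ⟨⟨r1, r2, r3⟩, ⟨s1, s2, s3⟩, -⟩ := smooth_rot_corners h.ne_bc h.ne_ca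
  have hov : E.isOver = D.isOver := h.isOver
  refine .of_smooth_smooth h1 h2 h3 (fun x => ?_) (fun x hx => ?_) ?_ ?_ ?_ ?_ fun x hx x1 x2 => ?_
  · change E.Arc (f x) (f (D.edge x))
    by_cases hx : x = a ∨ x = D.rot a ∨ x = b ∨ x = D.rot b ∨ x = c ∨ x = D.rot c
    · have ea := h.edge_a
      have eb := h.edge_b
      have ec := h.edge_c
      have hee := D.edge_edge
      obtain rfl | rfl | rfl | rfl | rfl | rfl := hx
      · rw [ea, fa0, fb1]; exact .refl _ _
      · rw [← ec, hee, ec, fa1, fc0]; exact .refl _ _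
      · rw [eb, fb0, fc1]; exact .refl _ _
      · rw [← ea, hee, ea, fb1, fa0]; exact .refl _ _
      · rw [ec, fc0, fa1]; exact .refl _ _
      · rw [← eb, hee, eb, fc1, fb0]; exact .refl _ _
    · rw [fτ x hx, fτ _ (h.not_side x hx)]; exact e4 x
  · by_cases hs : D.SameVertex c x
    · obtain ⟨v0, v1, v2, v3⟩ := D.smooth_rot_values h.cc
      have k : E.Arc (D.rot a) b := pa1.trans (e1.symm.trans pb2)
      obtain rfl | rfl | rfl | rfl := D.sameVertex_iff.1 hs
      · rw [v0, fc0, fc1]; exact .refl _ _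
      · rw [v1, fc0, fc1]; exact .refl _ _
      · rw [v2, fc2, fc3]; exact k
      · rw [v3, fc2, fc3]; exact k.symm
    · have hx' : ¬ D.IsCrossing x := fun h' => hx ((D.smooth_isCrossing_iff h.cc x).2 ⟨h', hs⟩)
      have n : ∀ y, D.IsCrossing y → ¬ D.SameVertex y x := fun y hy h' =>
        hx' (h'.isCrossing_iff.1 hy)
      have n' : ∀ y, D.IsCrossing y → ¬ D.SameVertex y (D.rot x) := fun y hy => by
        rw [sameVertex_rot_right]; exact n y hy
      rw [D.smooth_rot_of_not_sameVertex hs, hf.map_of_not x (n _ h.ca) (n _ h.cb) (n _ h.cc),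
        hf.map_of_not _ (n' _ h.ca) (n' _ h.cb) (n' _ h.cc),
        ← crot x (n _ h.ca) (n _ h.cb) (n _ h.cc)]
      exact .rot fun h' => hx' ((ciff x).1 h').1
  · rw [r1, fb1, fb2]; exact pc1
  · rw [r1, r2, r3, fb3, fb0]
    exact pa2.symm.trans (e3.trans (pc2.trans (e2.trans pb1.symm)))
  · rw [s1, fa1, fa2]; exact .refl _ _
  · rw [s1, s2, s3, fa3, fa0]; exact .refl _ _
  · obtain ⟨hx1, hx2⟩ := (D.smooth_isCrossing_iff h.cc x).1 hx
    have e1 : ¬ D.SameVertex c (D.rot a) := by rw [sameVertex_rot_right]; exact h.ne_ca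
    have e2 : ¬ D.SameVertex c (D.rot b) := by
      rw [sameVertex_rot_right]; exact fun h' => h.ne_bc h'.symm
    rw [D.smooth_sameVertex_iff e2, sameVertex_rot_left] at x1
    rw [D.smooth_sameVertex_iff e1, sameVertex_rot_left] at x2
    rw [D.smooth_rot_of_not_sameVertex hx2, hf.map_of_not x x2 x1 hx2,
      hf.map_of_not (D.rot x) (by rwa [sameVertex_rot_right]) (by rwa [sameVertex_rot_right])
      (by rwa [sameVertex_rot_right]), crot x x2 x1 hx2, hov]
    exact ⟨(ciff x).2 ⟨hx1, x2, x1, hx2⟩, rfl, Iff.rfl⟩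

theorem strandSwap_strandSwap (h : Slide D D' τ a b c) {f g : H → H} (hf : StrandSwap D a b c f)
    (hg : StrandSwap D (D.rot (D.rot a)) (D.rot (D.rot b)) (D.rot (D.rot c)) g) (x : H) :
    ((D.smoothTriangle a b c).IsCrossing x → g (f x) = x) ∧
      (D.smoothTriangle a b c).Arc (g (f x)) x := by
  have h4 := D.rot_four
  obtain ⟨fa0, fa1, fa2, fa3⟩ := hf.map_a
  obtain ⟨fb0, fb1, fb2, fb3⟩ := hf.map_b
  obtain ⟨fc0, fc1, fc2, fc3⟩ := hf.map_c
  obtain ⟨ga2, ga3, ga0, ga1⟩ := hg.map_a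
  obtain ⟨gb2, gb3, gb0, gb1⟩ := hg.map_b
  obtain ⟨gc2, gc3, gc0, gc1⟩ := hg.map_c
  simp only [h4] at ga0 ga1 ga2 ga3 gb0 gb1 gb2 gb3 gc0 gc1 gc2 gc3
  obtain ⟨⟨pa1, pa2⟩, ⟨pb1, pb2⟩, pc1, pc2⟩ :=
    arc_smoothTriangle_pairs h.ca h.cb h.cc h.ne_ab h.ne_bc h.ne_ca
  have ciff := smoothTriangle_isCrossing_iff h.ca h.cb h.cc h.ne_ab h.ne_bc h.ne_ca x
  set E := D.smoothTriangle a b c with hE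
  have e : ∀ x, E.Arc x (D.edge x) := fun x => Arc.edge E x
  have e1 := e a
  have e2 := e b
  have e3 := e c
  rw [h.edge_a] at e1
  rw [h.edge_b] at e2
  rw [h.edge_c] at e3
  have k : E.Arc (D.rot (D.rot a)) c := pa1.symm.trans e3.symm
  refine ⟨fun hx => ?_, ?_⟩
  · obtain ⟨-, x1, x2, x3⟩ := ciff.1 hx
    rw [hf.map_of_not x x1 x2 x3, hg.map_of_not x] <;> rwa [sameVertex_rot_rot_left]
  by_cases xa : D.SameVertex a x
  · obtain rfl | rfl | rfl | rfl := D.sameVertex_iff.1 xa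
    · rw [fa0, gc0]; exact pa2
    · rw [fa1, gb1]; exact pa1.symm
    · rw [fa2, gb1]; exact .refl _ _
    · rw [fa3, gc0]; exact .refl _ _
  by_cases xb : D.SameVertex b x
  · obtain rfl | rfl | rfl | rfl := D.sameVertex_iff.1 xb
    · rw [fb0, gb1]; exact k.trans (pc1.trans e2.symm)
    · rw [fb1, gc0]; exact pa2.trans e1
    · rw [fb2, gc1]; exact .refl _ _
    · rw [fb3, ga0]; exact .refl _ _
  by_cases xc : D.SameVertex c x
  · obtain rfl | rfl | rfl | rfl := D.sameVertex_iff.1 xc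
    · rw [fc0, gb1]; exact k
    · rw [fc1, gb1]; exact k.trans pc1
    · rw [fc2, ga1]; exact .refl _ _
    · rw [fc3, gb0]; exact .refl _ _
  rw [hf.map_of_not x xa xb xc, hg.map_of_not x]
  · exact .refl _ _
  all_goals rwa [sameVertex_rot_rot_left]

theorem bracket_smoothTriangle_eq [Finite H] (h : Slide D D' τ a b c) :
    (D.smoothTriangle a b c).bracket = (D'.smoothTriangle a b c).bracket := by
  have h4 := D.rot_four
  obtain ⟨f, fa, fb, fc, f0⟩ := D.exists_map_corners h.ca h.cb h.cc h.ne_ab h.ne_bc h.ne_ca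
    c (D.rot b) (D.rot b) c (D.rot b) c (D.rot c) a (D.rot b) (D.rot b) (D.rot a) b
  obtain ⟨g, ga, gb, gc, g0⟩ := D.exists_map_corners h.ca h.cb h.cc h.ne_ab h.ne_bc h.ne_ca
    (D.rot (D.rot (D.rot b))) (D.rot (D.rot c)) (D.rot (D.rot c)) (D.rot (D.rot (D.rot b)))
    (D.rot (D.rot (D.rot c))) (D.rot (D.rot a)) (D.rot (D.rot (D.rot b))) (D.rot (D.rot c))
    (D.rot (D.rot (D.rot a))) (D.rot (D.rot b)) (D.rot (D.rot (D.rot b))) (D.rot (D.rot (D.rot b)))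
  have hf : StrandSwap D a b c f := ⟨fa, fb, fc, f0⟩
  have hg : StrandSwap D (D.rot (D.rot a)) (D.rot (D.rot b)) (D.rot (D.rot c)) g := by
    constructor
    · simp only [h4]; tauto
    · simp only [h4]; tauto
    · simp only [h4]; tauto
    · simpa only [sameVertex_rot_rot_left] using g0
  have tr : ∀ {a b c f}, StrandSwap D a b c f → StrandSwap D' a b c f := fun h' => by
    have hsv := sameVertex_of_rot_eq h.rot
    exact ⟨by rw [h.rot]; exact h'.map_a, by rw [h.rot]; exact h'.map_b,
      by rw [h.rot]; exact h'.map_c, by simpa only [hsv] using h'.map_of_not⟩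
  have hf' : StrandSwap D' (D'.rot (D'.rot (D.rot (D.rot a)))) (D'.rot (D'.rot (D.rot (D.rot b))))
      (D'.rot (D'.rot (D.rot (D.rot c)))) f := by
    rw [h.rot]; simp only [h4]; exact tr hf
  have hsv := sameVertex_of_rot_eq h.rot
  have e1 := smoothTriangle_opposite h.ne_bc h.ne_ca h.ne_ab
  have e2 := smoothTriangle_opposite ((hsv b c).not.2 h.ne_bc) ((hsv c a).not.2 h.ne_ca)
    ((hsv a b).not.2 h.ne_ab)
  rw [h.rot] at e2
  have mg := h.symm.arcMap_strandSwap (tr hg)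
  have c2 := h.symm.strandSwap_strandSwap (tr hg) hf'
  rw [e1, e2] at mg
  rw [e2] at c2
  have c1 := h.strandSwap_strandSwap hf hg
  exact bracket_eq_of_arcMap (h.arcMap_strandSwap hf) mg (fun x => (c1 x).1) (fun x => (c2 x).1)
    (fun x => (c1 x).2) fun x => (c2 x).2

/-- The smoothing at `c` joins the two sides that meet there into one side from `rot a` to `b`, with
the marked points at `c` and `rot c`. The strand from `a` to `rot b` is the other side, and its
constant height is the condition on the corners. -/
theorem bigon (h : Slide D D' τ a b c) : (D.smooth c).Bigon a (D.rot b)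
    fun x => x = a ∨ x = D.rot a ∨ x = b ∨ x = D.rot b ∨ x = c ∨ x = D.rot c := by
  obtain ⟨h1, h2, h3⟩ := smooth_corners h.ca h.cb h.cc h.ne_ab h.ne_bc h.ne_ca
  obtain ⟨⟨r1, r2, r3⟩, ⟨s1, s2, s3⟩, r0, s0⟩ := smooth_rot_corners h.ne_bc h.ne_ca
  obtain ⟨p1, p2⟩ := D.arc_smooth_pairs h.cc
  obtain ⟨v0, v1, v2, v3⟩ := D.smooth_rot_values h.cc
  have e : ∀ x, (D.smooth c).Arc x (D.edge x) := fun x => Arc.edge (D.smooth c) x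
  have e1 := e a
  have e2 := e b
  have e3 := e c
  rw [h.edge_a] at e1
  rw [h.edge_b] at e2
  rw [h.edge_c] at e3
  have ob := D.isOver_rot b h.cb
  have hc : ¬ (D.smooth c).IsCrossing c := by
    rw [D.smooth_isCrossing_iff h.cc]; exact fun h => h.2 (D.sameVertex_self c).1
  have hc' : ¬ (D.smooth c).IsCrossing (D.rot c) := by
    rw [D.smooth_isCrossing_iff h.cc]; exact fun h => h.2 (D.sameVertex_self c).2.1
  have h1' : (D.smooth c).IsCrossing b := by rwa [← isCrossing_rot, r0]
  have h2' : (D.smooth c).IsCrossing a := by rwa [← isCrossing_rot, s0]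
  constructor
  · exact h2'
  · exact h1
  · rwa [← s0, sameVertex_rot_right] at h3
  · exact (h.isOver_iff.trans ob.symm)
  · intro x
    refine ⟨fun hx => ?_, fun hx => ?_⟩
    · by_contra hn
      exact h.not_side x hn hx
    · by_contra hn
      have hee : D.edge ((D.smooth c).edge x) = x := D.edge_edge x
      have := h.not_side _ hn
      rw [hee] at this
      exact this hx
  · intro x hx
    have n1 : ∀ y, (D.smooth c).IsCrossing y → x ≠ y ∧ (D.smooth c).rot x ≠ y := fun y hy =>
      ⟨fun h => hx (h ▸ hy), fun h => hx (by rwa [← isCrossing_rot, h])⟩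
    obtain ⟨y1, y1'⟩ := n1 a h2'
    obtain ⟨y2, y2'⟩ := n1 b h1'
    obtain ⟨y3, y3'⟩ := n1 _ h1
    obtain ⟨y4, y4'⟩ := n1 _ h2
    have k1 : (D.smooth c).rot x = c ↔ x = D.rot c := by
      rw [← (D.smooth c).rot.injective.eq_iff (b := D.rot c), v1]
    have k2 : (D.smooth c).rot x = D.rot c ↔ x = c := by
      rw [← (D.smooth c).rot.injective.eq_iff (b := c), v0]
    simp only [k1, k2, y1, y1', y2, y2', y3, y3', y4, y4', false_or]
    exact or_comm
  · intro x hx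
    have y1 : x ≠ c := fun h => hc (h ▸ hx)
    have y2 : x ≠ D.rot c := fun h => hc' (h ▸ hx)
    simp only [r1, r2, r3, s0, y1, y2, or_false]
    rw [or_comm (a := x = b)]
  · rw [s0]
    rintro x (rfl | rfl | rfl | rfl | rfl | rfl)
    · exact .inl (.refl _ _)
    · exact .inr (.refl _ _)
    · exact .inr (e2.trans (p1.symm.trans e3))
    · exact .inl e1.symm
    · exact .inr e3
    · exact .inr (p1.symm.trans e3)
  · exact e1
  · rw [r1, r2, r3, s0]
    exact (e2.trans (p1.symm.trans e3)).symm

theorem bracket_smooth_sub_mem [Finite H] (h : Slide D D' τ a b c) {col : H → Bool}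
    (hcol : D.Checkerboard col) :
    (D.smooth c).bracket - (D.smoothTriangle a b c).bracket ∈ I := by
  have := h.bigon.bracket_sub_mem (hcol.smooth c)
  rwa [(smooth_rot_corners h.ne_bc h.ne_ca).2.2.2] at this

/-- Expand both diagrams at `c`. The smoothings that open the triangle have equal brackets, and the
others agree modulo `I` with the common bracket of the fully smoothed triangles. -/
theorem bracket_sub_mem [Finite H] (h : Slide D D' τ a b c) {col col' : H → Bool}
    (hcol : D.Checkerboard col) (hcol' : D'.Checkerboard col') : D.bracket - D'.bracket ∈ I := by
  classical
  have hsv := sameVertex_of_rot_eq h.rot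
  have k1 := h.bracket_smooth_sub_mem hcol
  -- For `D'` the bigon belongs to the reversed move; its smoothing at `rot² c` is the smoothing at
  -- `c`.
  have k2 := h.symm.bracket_smooth_sub_mem hcol'
  have e2 := smoothTriangle_opposite ((hsv b c).not.2 h.ne_bc) ((hsv c a).not.2 h.ne_ca)
    ((hsv a b).not.2 h.ne_ab)
  have e3 := D'.smooth_rot_rot c
  rw [h.rot] at e2 e3
  rw [e2, e3, ← h.bracket_smoothTriangle_eq] at k2
  have s1 := D.bracket_skein_of_isCrossing h.cc
  have s2 := D'.bracket_skein_of_isCrossing ((isCrossing_of_rot_eq h.rot c).2 h.cc)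
  simp only [h.rot, h.isOver] at s2
  rw [s1, s2, h.bracket_smooth_rot_eq]
  convert I.mul_mem_left (weight (!decide (D.isOver c))) (I.sub_mem k1 k2) using 1
  ring

end Slide

theorem MoveIII.bracket_sub_mem [Finite H] {D D' : Diagram H} (h : D.MoveIII D') {c c' : H → Bool}
    (hc : D.Checkerboard c) (hc' : D'.Checkerboard c') : D.bracket - D'.bracket ∈ I := by
  obtain ⟨τ, a, b, c, hs⟩ := h.exists_slide
  exact hs.bracket_sub_mem hc hc'

end Diagram

/-! ### Invariance along a regular isotopy. -/

/-- Isotopies preserve the bracket itself. Move II needs a colouring only of the diagram with the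
bigon, move III one on each side, since a bigon is removed from a smoothing of either diagram. -/
theorem LinkDiagram.Step.mk_bracket_eq {D D' : LinkDiagram} (h : LinkDiagram.Step D D') :
    Ideal.Quotient.mk BracketRing.I D.bracket = Ideal.Quotient.mk BracketRing.I D'.bracket := by
  cases h with
  | iso D D' h =>
    have := D.finite
    exact congrArg _ h.bracket_eq
  | subdivision fin fin' D D' hD hD' h => exact congrArg _ h.bracket_eq
  | moveII fin D D' hD hD' h =>
    obtain ⟨c, hc⟩ := hD.exists_checkerboard
    exact Ideal.Quotient.eq.2 (h.bracket_sub_mem hc)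
  | moveIII fin D D' hD hD' h =>
    obtain ⟨c, hc⟩ := hD.exists_checkerboard
    obtain ⟨c', hc'⟩ := hD'.exists_checkerboard
    exact Ideal.Quotient.eq.2 (h.bracket_sub_mem hc hc')

theorem LinkDiagram.RegularIsotopic.mk_bracket_eq {D D' : LinkDiagram} (h : D.RegularIsotopic D') :
    Ideal.Quotient.mk BracketRing.I D.bracket = Ideal.Quotient.mk BracketRing.I D'.bracket := by
  induction h with
  | rel _ _ h => exact h.mk_bracket_eq
  | refl _ => rfl
  | symm _ _ _ ih => exact ih.symm
  | trans _ _ _ _ _ h1 h2 => exact h1.trans h2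

/-- The generalized bracket is a function of diagrams up to planar isotopy (isomorphism, and marked
points on the strands) that obeys its defining rules (the skein rule at every crossing, the circle
rule, the value 1 on the empty diagram), and its class modulo `I` is a regular isotopy invariant. -/
theorem theorem1 :
    (∀ (H H' : Type) (_ : Finite H) (D : Diagram H) (D' : Diagram H'), D.Iso D' →
      D.bracket = D'.bracket) ∧
    (∀ (H : Type) (_ : Finite H) (D : Diagram H) (D' : Diagram (H ⊕ Bool)), D.Subdivision D' →
      D.bracket = D'.bracket) ∧
    (∀ (H : Type) (_ : Finite H) (D : Diagram H) (x : H), D.IsCrossing x → D.isOver x →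
      D.bracket = BracketRing.α * (D.smooth (D.rot x)).bracket +
        BracketRing.β * (D.smooth x).bracket) ∧
    (∀ (H : Type) (_ : Finite H) (D : Diagram H),
      D.addCircle.bracket = BracketRing.δ * D.bracket) ∧
    Diagram.empty.bracket = 1 ∧
    ∀ D D' : LinkDiagram, D.RegularIsotopic D' →
      Ideal.Quotient.mk BracketRing.I D.bracket = Ideal.Quotient.mk BracketRing.I D'.bracket := by
  refine ⟨fun H H' _ D D' h => h.bracket_eq, fun H _ D D' h => h.bracket_eq,
    fun H _ D x h ho => D.bracket_skein h ho, fun H _ D => D.bracket_addCircle,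
    Diagram.bracket_empty, fun D D' h => h.mk_bracket_eq⟩
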